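/- For an undirected graph $G=(V,E)$ (finite, without loops or multiple edges) let $n=|V|$ and $m=|E|$. The problem Shortest Path Most Vital Edges (SP-MVE) with unit-length edges asks, given $G$, two vertices $s,t\in V$ and integers $k,\ell\in\mathbb{N}$, whether there is an edge subset $S\subseteq E$ with $|S|\le k$ such that every $st$-path in $G-S$ has at least $\ell$ edges (so that it is allowed to separate $s$ from $t$). The cluster vertex deletion number $x$ of $G$ is the minimum size of a set $X\subseteq V$ such that $G[V\setminus X]$ is a disjoint union of cliques. Theorem. SP-MVE with unit-length edges can be solved in $2^{2^{O(x)}}\cdot(n+m)$ time, where $x$ is the cluster vertex deletion number of the input graph. That is, there are a single word RAM program and a constant $c$ such that on every input $(G,s,t,k,\ell)$, with $V=\{0,\dots,n-1\}$ and $E$ given as a list of edges in arbitrary order, the program halts with the correct yes/no answer after at most $2^{2^{c(x+1)}}\cdot(n+m)$ steps. Here arithmetic operations, comparisons, memory accesses and branches on words cost one step each, and no number occurring in the run exceeds $(n+m+1)^{c}+k+\ell$. Neither $x$ nor a set $X$ is part of the input. -/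

import Mathlib

/-! ## The graph problem -/

section GraphProblem

variable {V : Type*}

/-- `G` is a cluster graph: it is a disjoint union of cliques, that is, any two distinct vertices
of the same connected component are adjacent. -/
def IsClusterGraph (G : SimpleGraph V) : Prop :=
  ∀ u v : V, G.Reachable u v → u ≠ v → G.Adj u v

/-- `X` is a cluster vertex deletion set of `G`: the subgraph induced by the vertices outside `X`
is a cluster graph. -/
def IsClusterVertexDeletionSet (G : SimpleGraph V) (X : Finset V) : Prop :=
  IsClusterGraph (G.induce {v : V | v ∉ X})

/-- The cluster vertex deletion number of a (finite) graph: the minimum cardinality of a cluster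
vertex deletion set. The set of cardinalities is not empty, since the set of all vertices is a
cluster vertex deletion set. -/
noncomputable def clusterVertexDeletionNumber (G : SimpleGraph V) : ℕ :=
  sInf {x : ℕ | ∃ X : Finset V, IsClusterVertexDeletionSet G X ∧ X.card = x}

/-- Shortest Path Most Vital Edges (decision problem) with edge lengths `τ`: there is a set `S` of
at most `k` edges of `G` such that a shortest `s`-`t`-path in `G - S` has length at least `ℓ`, that
is, every `s`-`t`-path in `G - S` has length at least `ℓ`. In particular, separating `s` from `t`
is allowed (the distance is then infinite). Only the values of `τ` on edges of `G` matter. -/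
def SPMVE (G : SimpleGraph V) (τ : Sym2 V → ℕ) (s t : V) (k ℓ : ℕ) : Prop :=
  ∃ S : Finset (Sym2 V), (S : Set (Sym2 V)) ⊆ G.edgeSet ∧ S.card ≤ k ∧
    ∀ P : (G.deleteEdges (S : Set (Sym2 V))).Walk s t, P.IsPath → ℓ ≤ (P.edges.map τ).sum

/-- The problem for unit-length edges: every edge has length one. -/
def UnitSPMVE (G : SimpleGraph V) (s t : V) (k ℓ : ℕ) : Prop :=
  SPMVE G (fun _ => 1) s t k ℓ

/-- The list `L` enumerates the edges of `G`: every edge occurs exactly once, with its two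
endpoints in an arbitrary order. In particular, the length of `L` is the number of edges. -/
def IsEdgeList (G : SimpleGraph V) (L : List (V × V)) : Prop :=
  (L.map fun e => s(e.1, e.2)).Nodup ∧
    ∀ e : Sym2 V, e ∈ L.map (fun e => s(e.1, e.2)) ↔ e ∈ G.edgeSet

end GraphProblem

/-! ## The machine model: a word RAM

A machine has registers and a random-access memory, both holding natural numbers. A program is a
fixed structured program over these; its arithmetic operations, comparisons, register and memory
accesses and branches cost one step each. All numbers that occur are bounded by a capacity `B`
(words have `⌈log₂ (B + 1)⌉` bits): a program that produces a larger number has no execution. -/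

namespace WordRAM

/-- A machine state: the contents of the registers and of the memory cells. -/
structure State where
  reg : ℕ → ℕ
  mem : ℕ → ℕ

/-- The binary operations on words. -/
inductive Op where
  | add | sub | mul | div | mod | lt | eq

/-- The value of an operation. Subtraction is truncated at zero, division rounds down (division by
zero yields zero, and `a` modulo zero is `a`), comparisons yield `1` for true and `0` for false. -/
def Op.eval : Op → ℕ → ℕ → ℕ
  | .add, a, b => a + b
  | .sub, a, b => a - b
  | .mul, a, b => a * b
  | .div, a, b => a / b
  | .mod, a, b => a % b
  | .lt, a, b => if a < b then 1 else 0
  | .eq, a, b => if a = b then 1 else 0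

/-- Expressions: constants, registers, memory cells (with a computed address) and operations. -/
inductive Term where
  | const (a : ℕ)
  | reg (i : ℕ)
  | load (addr : Term)
  | op (o : Op) (e f : Term)

/-- The value of an expression in a state. -/
def Term.eval (σ : State) : Term → ℕ
  | .const a => a
  | .reg i => σ.reg i
  | .load e => σ.mem (e.eval σ)
  | .op o e f => o.eval (e.eval σ) (f.eval σ)

/-- The number of steps for evaluating an expression: one for every constant, register access,
memory access and operation in it. -/
def Term.cost : Term → ℕ
  | .const _ => 1
  | .reg _ => 1
  | .load e => e.cost + 1
  | .op _ e f => e.cost + f.cost + 1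

/-- In the evaluation of an expression no number (intermediate results and memory addresses
included) exceeds the capacity `B`. -/
def Term.Fits (B : ℕ) (σ : State) : Term → Prop
  | .const a => a ≤ B
  | .reg i => σ.reg i ≤ B
  | .load e => e.Fits B σ ∧ σ.mem (e.eval σ) ≤ B
  | .op o e f => e.Fits B σ ∧ f.Fits B σ ∧ o.eval (e.eval σ) (f.eval σ) ≤ B

/-- Programs. -/
inductive Prog where
  /-- do nothing -/
  | nop
  /-- write the value of `e` into register `i` -/
  | assign (i : ℕ) (e : Term)
  /-- write the value of `e` into the memory cell whose address is the value of `addr` -/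
  | store (addr e : Term)
  /-- first `p`, then `q` -/
  | seq (p q : Prog)
  /-- `p` if the value of `e` is not zero, and `q` otherwise -/
  | cond (e : Term) (p q : Prog)
  /-- repeat `p` as long as the value of `e` is not zero -/
  | loop (e : Term) (p : Prog)

/-- `Exec B p σ T σ'`: the program `p`, started in the state `σ` on a machine of capacity `B`,
halts after exactly `T` steps in the state `σ'`. -/
inductive Exec (B : ℕ) : Prog → State → ℕ → State → Prop where
  | nop (σ : State) : Exec B .nop σ 1 σ
  | assign (σ : State) (i : ℕ) (e : Term) (he : e.Fits B σ) :
      Exec B (.assign i e) σ (e.cost + 1)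
        { reg := Function.update σ.reg i (e.eval σ), mem := σ.mem }
  | store (σ : State) (a e : Term) (ha : a.Fits B σ) (he : e.Fits B σ) :
      Exec B (.store a e) σ (a.cost + e.cost + 1)
        { reg := σ.reg, mem := Function.update σ.mem (a.eval σ) (e.eval σ) }
  | seq {σ₁ σ₂ σ₃ : State} {p q : Prog} {T₁ T₂ : ℕ}
      (hp : Exec B p σ₁ T₁ σ₂) (hq : Exec B q σ₂ T₂ σ₃) :
      Exec B (.seq p q) σ₁ (T₁ + T₂) σ₃
  | cond_true {σ σ' : State} {e : Term} {p q : Prog} {T : ℕ}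
      (he : e.Fits B σ) (h : e.eval σ ≠ 0) (hp : Exec B p σ T σ') :
      Exec B (.cond e p q) σ (e.cost + 1 + T) σ'
  | cond_false {σ σ' : State} {e : Term} {p q : Prog} {T : ℕ}
      (he : e.Fits B σ) (h : e.eval σ = 0) (hq : Exec B q σ T σ') :
      Exec B (.cond e p q) σ (e.cost + 1 + T) σ'
  | loop_stop {σ : State} {e : Term} {p : Prog}
      (he : e.Fits B σ) (h : e.eval σ = 0) :
      Exec B (.loop e p) σ (e.cost + 1) σ
  | loop_step {σ₁ σ₂ σ₃ : State} {e : Term} {p : Prog} {T₁ T₂ : ℕ}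
      (he : e.Fits B σ₁) (h : e.eval σ₁ ≠ 0)
      (hp : Exec B p σ₁ T₁ σ₂) (hl : Exec B (.loop e p) σ₂ T₂ σ₃) :
      Exec B (.loop e p) σ₁ (e.cost + 1 + T₁ + T₂) σ₃

/-- The initial state on an input: the input is written into the first memory cells; all other
memory cells and all registers are zero. -/
def initState (input : List ℕ) : State where
  reg := fun _ => 0
  mem := fun i => input.getD i 0

end WordRAM

/-- The encoding of an instance on the vertices `0, …, n - 1`: the numbers `n`, `m`, `s`, `t`, `k`,
`ℓ`, followed by the two endpoints of each of the `m` edges. -/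
def encodeInstance (n : ℕ) (L : List (Fin n × Fin n)) (s t : Fin n) (k ℓ : ℕ) : List ℕ :=
  [n, L.length, (s : ℕ), (t : ℕ), k, ℓ] ++ L.flatMap fun e => [(e.1 : ℕ), (e.2 : ℕ)]

/-! Raising the distance from `s` to `t` to at least `l` amounts to labelling the vertices with
numbers from `0` to `l`, with `0` at `s` and `l` at `t`: the edges whose end labels differ by more
than one have to be deleted (`unitSPMVE_iff`; truncated distances are such labels). The task is to
minimize the number of these edges.

A cluster vertex deletion set `X` of at most `3x + 2` vertices that contains `s` and `t` comes from
packing disjoint induced paths on three vertices, each of which meets every cluster vertex deletion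
set (`IsPacking.add_path`, `packing_spec`). Vertices of one clique outside `X` with equal
neighbourhoods in `X` are twins, and a whole twin class may copy the label of its cheapest member
(`HasLabeling.exists_const`). So a clique needs at most `2 ^ |X|` labels (`earlier_card_lt`).

Large `l` can be cut down. Let every clique have at most `q` classes and consider `|X|` disjoint
blocks of `q + 1` consecutive labels. Some block is avoided by all of `X`, since `s` has label `0`,
and every clique misses some label of that block. Raising all larger labels by one, with each
clique's missing label as its threshold, creates no new deletion (`HasLabeling.succ`). Hence only `l
≤ |X| * (q + 1)` matters.

Once the labels on `X` are fixed, the cliques are independent (`hasLabeling_iff`), and the optimum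
is the sum of the optima of the cliques (`IsBest.extends_iff`). One counter with `q` digits runs
through the labels of the classes in all cliques in parallel, at the price of a linear pass for each
value; an outer counter runs through the labels of `X`. The number of combinations is doubly
exponential in `x` by `pow_labels_le`.

The program is written in a small language whose translation is verified once (`Tri.of_wp_size`).
Overflow is excluded because all contents stay at most quadratic in `n + m` and all expressions have
bounded size (`fits_of_weight_le`). Cluster graphs are recognised in linear time by comparing
degrees and least closed neighbours along edges (`isCluster_of_agree`, `exists_third`). -/

namespace MVE

open WordRAM

/-! ## A small imperative language with named variables and arrays, compiled to the word RAM -/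

/-- Program variables, kept in registers. -/
inductive Var
  | n | m | s | t | k | l | i | j | e | u | v | found | fu | fv | fw | xc | hi | diff
  | goOuter | goInner | carry | ans | sum
  deriving DecidableEq

/-- Program arrays of unbounded length, interleaved in the memory. -/
inductive Arr
  | fst | snd | adj | del | deg | rep | xs | cls | slot | dig | best | cost
  deriving DecidableEq

/-- The register of a variable; register `0` holds the base address of the arrays. -/
def Var.idx : Var → ℕ
  | .n => 1 | .m => 2 | .s => 3 | .t => 4 | .k => 5 | .l => 6 | .i => 7 | .j => 8 | .e => 9
  | .u => 10 | .v => 11 | .found => 12 | .fu => 13 | .fv => 14 | .fw => 15 | .xc => 16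
  | .hi => 17 | .diff => 18 | .goOuter => 19 | .goInner => 20 | .carry => 21 | .ans => 22
  | .sum => 23

/-- The residue modulo `16` of the addresses of an array, relative to the base address. -/
def Arr.idx : Arr → ℕ
  | .fst => 0 | .snd => 1 | .adj => 2 | .del => 3 | .deg => 4 | .rep => 5 | .xs => 6 | .cls => 7
  | .slot => 8 | .dig => 9 | .best => 10 | .cost => 11

theorem Var.idx_injective : Function.Injective Var.idx := by
  intro a b h
  cases a <;> cases b <;> simp_all [Var.idx]

theorem Var.idx_pos (x : Var) : 0 < x.idx := by
  cases x <;> simp [Var.idx]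

theorem Arr.idx_injective : Function.Injective Arr.idx := by
  intro a b h
  cases a <;> cases b <;> simp_all [Arr.idx]

theorem Arr.idx_lt (a : Arr) : a.idx < 16 := by
  cases a <;> simp [Arr.idx]

/-- The values of the variables and the contents of the arrays. -/
structure St where
  v : Var → ℕ
  a : Arr → ℕ → ℕ

namespace St

/-- Assignment to a variable. -/
def set (h : St) (x : Var) (b : ℕ) : St := ⟨Function.update h.v x b, h.a⟩

/-- Assignment to an array cell. -/
def put (h : St) (r : Arr) (i b : ℕ) : St :=
  ⟨h.v, Function.update h.a r (Function.update (h.a r) i b)⟩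

@[simp] theorem set_v (h : St) (x y : Var) (b : ℕ) :
    (h.set x b).v y = if y = x then b else h.v y := by
  simp [set, Function.update_apply]

@[simp] theorem set_a (h : St) (x : Var) (b : ℕ) : (h.set x b).a = h.a := rfl

@[simp] theorem put_v (h : St) (r : Arr) (i b : ℕ) : (h.put r i b).v = h.v := rfl

@[simp] theorem put_a (h : St) (r q : Arr) (i j b : ℕ) :
    (h.put r i b).a q j = if q = r ∧ j = i then b else h.a q j := by
  unfold put
  by_cases hq : q = r
  · subst hq; simp [Function.update_apply]
  · simp [hq]

end St

/-- `Frame R A h h'`: the states differ at most in the variables `R` and the arrays `A`. -/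
structure Frame (R : List Var) (A : List Arr) (h h' : St) : Prop where
  v : ∀ x, x ∉ R → h'.v x = h.v x
  a : ∀ r, r ∉ A → h'.a r = h.a r

namespace Frame

variable {R R' : List Var} {A A' : List Arr} {h h' h'' : St}

@[simp] theorem refl (R : List Var) (A : List Arr) (h : St) : Frame R A h h :=
  ⟨fun _ _ => rfl, fun _ _ => rfl⟩

theorem trans (h1 : Frame R A h h') (h2 : Frame R A h' h'') : Frame R A h h'' :=
  ⟨fun x hx => (h2.v x hx).trans (h1.v x hx), fun r hr => (h2.a r hr).trans (h1.a r hr)⟩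

theorem mono (h1 : Frame R A h h') (hR : R ⊆ R') (hA : A ⊆ A') : Frame R' A' h h' :=
  ⟨fun x hx => h1.v x fun h => hx (hR h), fun r hr => h1.a r fun h => hr (hA h)⟩

@[simp] theorem set (h1 : Frame R A h h') {x : Var} (b : ℕ) (hx : x ∈ R) :
    Frame R A h (h'.set x b) := by
  refine ⟨fun y hy => ?_, fun r hr => h1.a r hr⟩
  have : y ≠ x := fun e => hy (e ▸ hx)
  simp [this, h1.v y hy]

@[simp] theorem put (h1 : Frame R A h h') {r : Arr} (i b : ℕ) (hr : r ∈ A) :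
    Frame R A h (h'.put r i b) := by
  refine ⟨fun y hy => h1.v y hy, fun q hq => ?_⟩
  have : q ≠ r := fun e => hq (e ▸ hr)
  funext j
  simp [this, h1.a q hq]

end Frame

/-- Expressions over variables and arrays. -/
inductive Exp where
  | lit (b : ℕ)
  | var (x : Var)
  | get (r : Arr) (e : Exp)
  | op (o : Op) (e f : Exp)

namespace Exp

/-- The value of an expression. -/
def eval (h : St) : Exp → ℕ
  | .lit b => b
  | .var x => h.v x
  | .get r e => h.a r (e.eval h)
  | .op o e f => o.eval (e.eval h) (f.eval h)

/-- The address of an array cell. -/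
def address (r : Arr) (e : Term) : Term :=
  .op .add (.op .add (.reg 0) (.op .mul (.const 16) e)) (.const r.idx)

/-- Translation to the word RAM. -/
def compile : Exp → Term
  | .lit b => .const b
  | .var x => .reg x.idx
  | .get r e => .load (address r e.compile)
  | .op o e f => .op o e.compile f.compile

instance : Coe Var Exp := ⟨.var⟩
instance : Add Exp := ⟨.op .add⟩
instance : Mul Exp := ⟨.op .mul⟩
instance (b : ℕ) : OfNat Exp b := ⟨.lit b⟩

/-- Comparison. -/
def lt (e f : Exp) : Exp := .op .lt e f
/-- Equality test. -/
def eq (e f : Exp) : Exp := .op .eq e f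

variable (h : St) (e f : Exp)

@[simp] theorem eval_lit (b : ℕ) : (lit b).eval h = b := rfl
@[simp] theorem eval_zero : (0 : Exp).eval h = 0 := rfl
@[simp] theorem eval_one : (1 : Exp).eval h = 1 := rfl
@[simp] theorem eval_six : (6 : Exp).eval h = 6 := rfl
@[simp] theorem eval_seven : (7 : Exp).eval h = 7 := rfl
@[simp] theorem eval_var (x : Var) : (var x).eval h = h.v x := rfl
@[simp] theorem eval_get (r : Arr) : (get r e).eval h = h.a r (e.eval h) := rfl
@[simp] theorem eval_add : (e + f).eval h = e.eval h + f.eval h := rfl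
@[simp] theorem eval_mul : (e * f).eval h = e.eval h * f.eval h := rfl
@[simp] theorem eval_lt : (lt e f).eval h = if e.eval h < f.eval h then 1 else 0 := rfl
@[simp] theorem eval_eq : (eq e f).eval h = if e.eval h = f.eval h then 1 else 0 := rfl

end Exp

/-! ### Absence of overflow -/

/-- The size of an expression, with constants counted in unary. -/
def weight : Term → ℕ
  | .const b => b + 1
  | .reg _ => 1
  | .load e => weight e + 1
  | .op _ e f => weight e + weight f + 1

theorem cost_le_weight (e : Term) : e.cost ≤ weight e := by
  induction e <;> (simp_all only [Term.cost, weight]; try omega)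

/-- An operation at most multiplies the bounds of its operands or doubles a common bound, and the
exponent absorbs both; a load starts afresh from the bound `M` on the memory. -/
theorem eval_le_pow {M : ℕ} (hM : 2 ≤ M) {σ : State} (hr : ∀ i, σ.reg i ≤ M)
    (hm : ∀ i, σ.mem i ≤ M) (e : Term) : e.eval σ ≤ M ^ weight e := by
  have hpos : 1 ≤ M := by omega
  induction e with
  | const b =>
    -- Counting constants in unary makes this crude estimate sufficient.
    calc b ≤ 2 ^ b := Nat.lt_two_pow_self.le
      _ ≤ M ^ b := Nat.pow_le_pow_left hM b
      _ ≤ M ^ (b + 1) := Nat.pow_le_pow_right hpos (by omega)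
  | reg i => simpa [weight, Term.eval] using hr i
  | load e _ => exact (hm _).trans (Nat.le_self_pow (by simp [weight]) M)
  | op o e f he hf =>
    have h1 : M ^ weight e ≤ M ^ (weight e + weight f) := Nat.pow_le_pow_right hpos (by omega)
    have h2 : M ^ weight f ≤ M ^ (weight e + weight f) := Nat.pow_le_pow_right hpos (by omega)
    have h3 : 1 ≤ M ^ (weight e + weight f) := Nat.one_le_pow _ _ hpos
    have h4 : M ^ (weight e + weight f) * 2 ≤ M ^ (weight e + weight f + 1) := by
      rw [pow_succ]; exact Nat.mul_le_mul_left _ hM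
    have h5 : (e.eval σ) * (f.eval σ) ≤ M ^ (weight e + weight f) := by
      rw [pow_add]; exact Nat.mul_le_mul he hf
    show o.eval (e.eval σ) (f.eval σ) ≤ M ^ (weight e + weight f + 1)
    generalize e.eval σ = a at *
    generalize f.eval σ = b at *
    cases o <;> simp only [Op.eval]
    · omega
    · omega
    · omega
    · have := Nat.div_le_self a b
      omega
    · have := Nat.mod_le a b
      omega
    · split <;> omega
    · split <;> omega

/-- Subexpressions have smaller weight, so the single inequality `M ^ K ≤ B` covers all intermediate
values and addresses. -/
theorem fits_of_weight_le {M B K : ℕ} (hM : 2 ≤ M) (hB : M ^ K ≤ B) {σ : State}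
    (hr : ∀ i, σ.reg i ≤ M) (hm : ∀ i, σ.mem i ≤ M) (e : Term) (he : weight e ≤ K) :
    e.Fits B σ := by
  have key : ∀ f : Term, weight f ≤ K → f.eval σ ≤ B := fun f hf =>
    (eval_le_pow hM hr hm f).trans ((Nat.pow_le_pow_right (by omega) hf).trans hB)
  induction e with
  | const b => exact key _ he
  | reg i => exact key _ he
  | load e ih => exact ⟨ih (by simp only [weight] at he; omega), key (.load e) he⟩
  | op o e f ihe ihf =>
    exact ⟨ihe (by simp only [weight] at he; omega), ihf (by simp only [weight] at he; omega),
      key (.op o e f) he⟩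

/-! ### Commands and their simulation on the word RAM -/

/-- Commands. -/
inductive Cmd where
  | skip
  | set (x : Var) (e : Exp)
  | put (r : Arr) (i e : Exp)
  | read (x : Var) (e : Exp)
  | seq (c d : Cmd)
  | ite (e : Exp) (c d : Cmd)
  | loop (e : Exp) (c : Cmd)

infixr:60 " ;; " => Cmd.seq

namespace Cmd

/-- Translation to the word RAM. -/
def compile : Cmd → Prog
  | skip => .nop
  | set x e => .assign x.idx e.compile
  | put r i e => .store (Exp.address r i.compile) e.compile
  | read x e => .assign x.idx (.load e.compile)
  | seq c d => .seq c.compile d.compile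
  | ite e c d => .cond e.compile c.compile d.compile
  | .loop e c => .loop e.compile c.compile

/-- An upper bound for the running time of a loop-free command. -/
def size : Cmd → ℕ
  | skip => 1
  | set _ e => weight e.compile + 1
  | put r i e => weight (Exp.address r i.compile) + weight e.compile + 1
  | read _ e => weight e.compile + 2
  | seq c d => c.size + d.size
  | ite e c d => weight e.compile + 1 + (c.size + d.size)
  | .loop e _ => weight e.compile + 1

/-- Conditional without alternative. -/
def when (e : Exp) (c : Cmd) : Cmd := .ite e c .skip

/-- Repeat `c` for `x = 0, 1, …`, as long as `x` is smaller than the value of `b`. -/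
def forTo (x : Var) (b : Exp) (c : Cmd) : Cmd :=
  set x 0 ;; .loop (Exp.lt x b) (c ;; set x (x + 1))

end Cmd

/-- The bound for the size of the loop-free pieces of the program. -/
def pieceSize : ℕ := 1000

/-- The parameters of an execution: the capacity, a bound for the contents of all registers and
memory cells, the base address of the arrays, and the memory below that address. -/
structure Machine where
  B : ℕ
  M : ℕ
  D : ℕ
  inp : ℕ → ℕ
  hM : 2 ≤ M
  hB : M ^ pieceSize ≤ B

/-- The machine state `σ` represents `h`. -/
structure Sim (mc : Machine) (σ : State) (h : St) : Prop where
  reg_le : ∀ i, σ.reg i ≤ mc.M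
  mem_le : ∀ i, σ.mem i ≤ mc.M
  base : σ.reg 0 = mc.D
  var : ∀ x : Var, σ.reg x.idx = h.v x
  arr : ∀ (r : Arr) (i : ℕ), σ.mem (mc.D + 16 * i + r.idx) = h.a r i
  inp : ∀ i < mc.D, σ.mem i = mc.inp i

namespace Sim

variable {mc : Machine} {σ : State} {h : St}

theorem eval_compile (H : Sim mc σ h) (e : Exp) : e.compile.eval σ = e.eval h := by
  induction e with
  | lit b => rfl
  | var x => exact H.var x
  | get r e ih =>
    simp [Exp.compile, Exp.address, Term.eval, Op.eval, ih, H.base, H.arr]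
  | op o e f ihe ihf => simp [Exp.compile, Term.eval, Exp.eval, ihe, ihf]

theorem eval_address (H : Sim mc σ h) (r : Arr) (e : Exp) :
    (Exp.address r e.compile).eval σ = mc.D + 16 * e.eval h + r.idx := by
  simp [Exp.address, Term.eval, Op.eval, H.eval_compile, H.base]

theorem fits (H : Sim mc σ h) {e : Term} (he : weight e ≤ pieceSize) : e.Fits mc.B σ :=
  fits_of_weight_le mc.hM mc.hB H.reg_le H.mem_le e he

theorem set (H : Sim mc σ h) (x : Var) {b : ℕ} (hb : b ≤ mc.M) :
    Sim mc ⟨Function.update σ.reg x.idx b, σ.mem⟩ (h.set x b) where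
  reg_le i := by
    simp only [Function.update_apply]
    split
    · exact hb
    · exact H.reg_le i
  mem_le := H.mem_le
  base := by
    simp [(Var.idx_pos x).ne, H.base]
  var y := by
    simp [Function.update_apply, Var.idx_injective.eq_iff, H.var]
  arr := H.arr
  inp := H.inp

theorem put (H : Sim mc σ h) (r : Arr) (i : ℕ) {b : ℕ} (hb : b ≤ mc.M) :
    Sim mc ⟨σ.reg, Function.update σ.mem (mc.D + 16 * i + r.idx) b⟩ (h.put r i b) where
  reg_le := H.reg_le
  mem_le j := by
    simp only [Function.update_apply]
    split
    · exact hb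
    · exact H.mem_le j
  base := H.base
  var := H.var
  arr q j := by
    have h1 := r.idx_lt
    have h2 := q.idx_lt
    -- Both residues are below `16`, so an address determines the array and the index.
    have : mc.D + 16 * j + q.idx = mc.D + 16 * i + r.idx ↔ q = r ∧ j = i := by
      rw [← Arr.idx_injective.eq_iff]
      omega
    simp [Function.update_apply, this, H.arr]
  inp j hj := by
    -- Array cells lie at or above the base address, so writing to them preserves the input.
    rw [← H.inp j hj]
    simp only [Function.update_apply]
    rw [if_neg (by omega)]

end Sim

/-! ### Time-bounded Hoare triples -/

/-- Started in `h`, the command `c` halts after at most `T` steps in a state that satisfies `Q`. -/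
def Tri (mc : Machine) (c : Cmd) (h : St) (T : ℕ) (Q : St → Prop) : Prop :=
  ∀ σ, Sim mc σ h → ∃ T' σ' h', Exec mc.B c.compile σ T' σ' ∧ T' ≤ T ∧ Sim mc σ' h' ∧ Q h'

/-- Weakest preconditions of loop-free commands. -/
def wp (mc : Machine) : Cmd → (St → Prop) → St → Prop
  | .skip, Q, h => Q h
  | .set x e, Q, h => e.eval h ≤ mc.M ∧ Q (h.set x (e.eval h))
  | .put r i e, Q, h => e.eval h ≤ mc.M ∧ Q (h.put r (i.eval h) (e.eval h))
  | .read x e, Q, h => (e.eval h < mc.D ∧ mc.inp (e.eval h) ≤ mc.M) ∧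
      Q (h.set x (mc.inp (e.eval h)))
  | .seq c d, Q, h => wp mc c (wp mc d Q) h
  | .ite e c d, Q, h => (e.eval h ≠ 0 → wp mc c Q h) ∧ (e.eval h = 0 → wp mc d Q h)
  | .loop _ _, _, _ => False

/-- Lower an array cell to a given value, if it is larger. -/
def Cmd.lower (r : Arr) (i e : Exp) : Cmd := .when (.lt e (.get r i)) (.put r i e)

theorem St.put_self (h : St) (r : Arr) (i : ℕ) : h.put r i (h.a r i) = h := by
  simp [St.put]

-- The conditional write has the same effect as an unconditional write of the minimum, which spares
-- later proofs a case distinction.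
@[simp] theorem wp_lower {mc : Machine} {r : Arr} {i e : Exp} {Q : St → Prop} {h : St} :
    wp mc (.lower r i e) Q h ↔ (e.eval h < h.a r (i.eval h) → e.eval h ≤ mc.M) ∧
      Q (h.put r (i.eval h) (min (h.a r (i.eval h)) (e.eval h))) := by
  by_cases hlt : e.eval h < h.a r (i.eval h)
  · simp [Cmd.lower, Cmd.when, wp, hlt, hlt.le]
  · simp [Cmd.lower, Cmd.when, wp, hlt, not_lt.1 hlt, St.put_self]

namespace Tri

variable {mc : Machine} {c d : Cmd} {h : St} {T T₁ T₂ : ℕ} {Q R : St → Prop}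

theorem mono (H : Tri mc c h T₁ R) (hT : T₁ ≤ T) (hQ : ∀ h', R h' → Q h') : Tri mc c h T Q := by
  intro σ hσ
  obtain ⟨T', σ', h', h1, h2, h3, h4⟩ := H σ hσ
  exact ⟨T', σ', h', h1, h2.trans hT, h3, hQ _ h4⟩

theorem seq (hc : Tri mc c h T₁ R) (hd : ∀ h', R h' → Tri mc d h' T₂ Q) :
    Tri mc (c ;; d) h (T₁ + T₂) Q := by
  intro σ hσ
  obtain ⟨T', σ', h', h1, h2, h3, h4⟩ := hc σ hσ
  obtain ⟨T'', σ'', h'', k1, k2, k3, k4⟩ := hd h' h4 σ' h3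
  exact ⟨T' + T'', σ'', h'', .seq h1 k1, by omega, k3, k4⟩

/-- The size adds up both branches of a conditional, hence bounds every run. The same bound keeps
each expression light enough to exclude overflow. -/
theorem of_wp_size (hs : c.size ≤ pieceSize) (hw : wp mc c Q h) : Tri mc c h c.size Q := by
  intro σ hσ
  induction c generalizing h σ Q with
  | skip => exact ⟨1, σ, h, .nop σ, le_rfl, hσ, hw⟩
  | set x e =>
    have hf : e.compile.Fits mc.B σ := hσ.fits (by simp only [Cmd.size] at hs; omega)
    have := cost_le_weight e.compile
    refine ⟨_, _, _, .assign σ x.idx e.compile hf, by simp only [Cmd.size]; omega, ?_, hw.2⟩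
    rw [hσ.eval_compile]
    exact hσ.set x hw.1
  | put r i e =>
    simp only [Cmd.size] at hs
    have hf : e.compile.Fits mc.B σ := hσ.fits (by omega)
    have hi : (Exp.address r i.compile).Fits mc.B σ := hσ.fits (by omega)
    have h1 := cost_le_weight e.compile
    have h2 := cost_le_weight (Exp.address r i.compile)
    refine ⟨_, _, _, .store σ _ e.compile hi hf, by simp only [Cmd.size]; omega, ?_, hw.2⟩
    rw [hσ.eval_compile, hσ.eval_address]
    exact hσ.put r _ hw.1
  | read x e =>
    simp only [Cmd.size] at hs
    have hf : (Term.load e.compile).Fits mc.B σ := hσ.fits (by simp only [weight]; omega)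
    have h1 := cost_le_weight e.compile
    refine ⟨_, _, _, .assign σ x.idx _ hf, by simp only [Cmd.size, Term.cost]; omega, ?_, hw.2⟩
    rw [Term.eval, hσ.eval_compile, hσ.inp _ hw.1.1]
    exact hσ.set x hw.1.2
  | seq c d ihc ihd =>
    simp only [Cmd.size] at hs
    obtain ⟨T', σ', h', h1, h2, h3, h4⟩ := ihc (by omega) hw σ hσ
    obtain ⟨T'', σ'', h'', k1, k2, k3, k4⟩ := ihd (by omega) h4 σ' h3
    exact ⟨T' + T'', σ'', h'', .seq h1 k1, by simp only [Cmd.size]; omega, k3, k4⟩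
  | ite e c d ihc ihd =>
    simp only [Cmd.size] at hs
    have hf : e.compile.Fits mc.B σ := hσ.fits (by omega)
    have h0 := cost_le_weight e.compile
    have he := hσ.eval_compile e
    by_cases hz : e.eval h = 0
    · obtain ⟨T', σ', h', h1, h2, h3, h4⟩ := ihd (by omega) (hw.2 hz) σ hσ
      exact ⟨_, σ', h', .cond_false hf (he.trans hz) h1, by simp only [Cmd.size]; omega, h3, h4⟩
    · obtain ⟨T', σ', h', h1, h2, h3, h4⟩ := ihc (by omega) (hw.1 hz) σ hσ
      exact ⟨_, σ', h', .cond_true hf (by rwa [he]) h1, by simp only [Cmd.size]; omega, h3, h4⟩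
  | loop e c _ => exact hw.elim

/-- Loop-free commands. -/
theorem of_wp (hs : c.size ≤ pieceSize) (hw : wp mc c Q h) : Tri mc c h pieceSize Q :=
  (of_wp_size hs hw).mono hs fun _ h => h

/-- For conditionals whose branches contain loops, where `wp` is of no use. -/
theorem ite {e : Exp} (he : weight e.compile + 1 ≤ pieceSize)
    (hc : e.eval h ≠ 0 → Tri mc c h T Q) (hd : e.eval h = 0 → Tri mc d h T Q) :
    Tri mc (.ite e c d) h (T + pieceSize) Q := by
  intro σ hσ
  have hf : e.compile.Fits mc.B σ := hσ.fits (by omega)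
  have h0 := cost_le_weight e.compile
  have hev := hσ.eval_compile e
  by_cases hz : e.eval h = 0
  · obtain ⟨T', σ', h', h1, h2, h3, h4⟩ := hd hz σ hσ
    exact ⟨_, σ', h', .cond_false hf (hev.trans hz) h1, by omega, h3, h4⟩
  · obtain ⟨T', σ', h', h1, h2, h3, h4⟩ := hc hz σ hσ
    exact ⟨_, σ', h', .cond_true hf (by rwa [hev]) h1, by omega, h3, h4⟩

/-- Loops with an invariant that counts the rounds, of which there are at most `K`. -/
theorem loop {e : Exp} (he : weight e.compile + 1 ≤ pieceSize) (I : ℕ → St → Prop) (K : ℕ)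
    (h0 : I 0 h) (hK : ∀ j h', I j h' → e.eval h' ≠ 0 → j < K)
    (hc : ∀ j h', I j h' → e.eval h' ≠ 0 → Tri mc c h' T (I (j + 1)))
    (hQ : ∀ j h', I j h' → e.eval h' = 0 → Q h') :
    Tri mc (.loop e c) h (K * (T + pieceSize) + pieceSize) Q := by
  -- Induction on the number `d` of rounds that may still follow; when none is left, `hK` forces the
  -- loop condition to be false.
  have key : ∀ d j h', I j h' → K ≤ j + d →
      Tri mc (.loop e c) h' (d * (T + pieceSize) + pieceSize) Q := by
    intro d
    induction d with
    | zero =>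
      intro j h' hI hj σ hσ
      have hz : e.eval h' = 0 := by
        by_contra hne
        have := hK j h' hI hne
        omega
      have h0 := cost_le_weight e.compile
      exact ⟨_, σ, h', Exec.loop_stop (hσ.fits (by omega)) ((hσ.eval_compile e).trans hz), by omega,
        hσ, hQ j h' hI hz⟩
    | succ d ih =>
      intro j h' hI hj σ hσ
      have h0 := cost_le_weight e.compile
      by_cases hz : e.eval h' = 0
      · exact ⟨_, σ, h', Exec.loop_stop (hσ.fits (by omega)) ((hσ.eval_compile e).trans hz),
          by omega, hσ, hQ j h' hI hz⟩
      · obtain ⟨T', σ', h'', h1, h2, h3, h4⟩ := hc j h' hI hz σ hσ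
        obtain ⟨T'', σ'', h''', k1, k2, k3, k4⟩ := ih (j + 1) h'' h4 (by omega) σ' h3
        refine ⟨_, σ'', h''', .loop_step (hσ.fits (by omega)) (by rwa [hσ.eval_compile e]) h1 k1,
          ?_, k3, k4⟩
        have : (d + 1) * (T + pieceSize) = d * (T + pieceSize) + (T + pieceSize) := by ring
        omega
  exact key K 0 h h0 (by omega)

/-- Counting loops. -/
theorem forTo {x : Var} {b : Exp} (hb : weight b.compile + 3 ≤ pieceSize) (I : ℕ → St → Prop)
    (K : ℕ) (hKM : K ≤ mc.M) (h0 : I 0 (h.set x 0))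
    (hcount : ∀ j h', I j h' → h'.v x = j ∧ b.eval h' = K)
    (hc : ∀ j < K, ∀ h', I j h' → Tri mc c h' T fun h'' =>
      h''.v x = j ∧ I (j + 1) (h''.set x (j + 1)))
    (hQ : ∀ h', I K h' → Q h') :
    Tri mc (.forTo x b c) h (K * (T + 2 * pieceSize) + 2 * pieceSize) Q := by
  have hinit : Tri mc (.set x 0) h pieceSize fun h' => h' = h.set x 0 :=
    of_wp (show 2 ≤ 1000 by omega) ⟨by simp, by simp⟩
  have hloop : ∀ h', h' = h.set x 0 →
      Tri mc (.loop (Exp.lt x b) (c ;; .set x (x + 1))) h'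
        (K * ((T + pieceSize) + pieceSize) + pieceSize) Q := by
    rintro _ rfl
    refine loop (I := fun j h' => j ≤ K ∧ I j h') ?_ K ⟨by omega, h0⟩ ?_ ?_ ?_
    · simp only [Exp.lt, Exp.compile, weight]; omega
    · rintro j h' ⟨_, hI⟩ he
      simpa [hcount j h' hI] using he
    · rintro j h' ⟨_, hI⟩ he
      have hj : j < K := by simpa [hcount j h' hI] using he
      refine (hc j hj h' hI).seq fun h'' hh => ?_
      refine of_wp (show 5 ≤ 1000 by omega) ?_
      simp only [wp, Exp.eval_add, Exp.eval_var, Exp.eval_one, hh.1]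
      exact ⟨by omega, by omega, hh.2⟩
    · rintro j h' ⟨hj, hI⟩ he
      have : ¬ j < K := by simpa [hcount j h' hI] using he
      have : j = K := by omega
      exact hQ h' (this ▸ hI)
  exact (hinit.seq hloop).mono (by ring_nf; omega) fun _ h => h

end Tri

end MVE

namespace MVE

/-! ## Graphs given by edge lists -/

/-- A graph on the vertices `0, …, n - 1`, given by the endpoints of its `m` edges. -/
structure EdgeList where
  n : ℕ
  m : ℕ
  fst : ℕ → ℕ
  snd : ℕ → ℕ
  fst_lt : ∀ i < m, fst i < n
  snd_lt : ∀ i < m, snd i < n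
  ne : ∀ i < m, fst i ≠ snd i
  uniq : ∀ i < m, ∀ j < m,
    (fst i = fst j ∧ snd i = snd j) ∨ (fst i = snd j ∧ snd i = fst j) → i = j

namespace EdgeList

variable (E : EdgeList)

/-- Adjacency through one of the first `j` edges. -/
def AdjUpTo (j u v : ℕ) : Prop :=
  ∃ i < j, (E.fst i = u ∧ E.snd i = v) ∨ (E.fst i = v ∧ E.snd i = u)

/-- Adjacency. -/
def Adj (u v : ℕ) : Prop := E.AdjUpTo E.m u v

instance (j u v : ℕ) : Decidable (E.AdjUpTo j u v) := by unfold AdjUpTo; infer_instance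
instance (u v : ℕ) : Decidable (E.Adj u v) := by unfold Adj; infer_instance

variable {E} {u v w : ℕ}

theorem AdjUpTo.symm {j : ℕ} (h : E.AdjUpTo j u v) : E.AdjUpTo j v u := by
  obtain ⟨i, hi, h⟩ := h
  exact ⟨i, hi, h.symm⟩

theorem Adj.symm (h : E.Adj u v) : E.Adj v u := AdjUpTo.symm h

theorem adj_comm : E.Adj u v ↔ E.Adj v u := ⟨Adj.symm, Adj.symm⟩

theorem adj_edge {i : ℕ} (hi : i < E.m) : E.Adj (E.fst i) (E.snd i) := ⟨i, hi, .inl ⟨rfl, rfl⟩⟩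

theorem Adj.ne (h : E.Adj u v) : u ≠ v := by
  obtain ⟨i, hi, h⟩ := h
  have := E.ne i hi
  omega

theorem Adj.lt_left (h : E.Adj u v) : u < E.n := by
  obtain ⟨i, hi, h⟩ := h
  have := E.fst_lt i hi
  have := E.snd_lt i hi
  omega

theorem Adj.lt_right (h : E.Adj u v) : v < E.n := h.symm.lt_left

theorem adjUpTo_zero : ¬ E.AdjUpTo 0 u v := by
  rintro ⟨i, hi, _⟩
  omega

theorem adjUpTo_succ {j : ℕ} : E.AdjUpTo (j + 1) u v ↔
    E.AdjUpTo j u v ∨ (E.fst j = u ∧ E.snd j = v) ∨ (E.fst j = v ∧ E.snd j = u) := by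
  constructor
  · rintro ⟨i, hi, h⟩
    rcases Nat.lt_succ_iff_lt_or_eq.1 hi with h1 | rfl
    · exact .inl ⟨i, h1, h⟩
    · exact .inr h
  · rintro (⟨i, hi, h⟩ | h)
    · exact ⟨i, by omega, h⟩
    · exact ⟨j, by omega, h⟩

variable (E)

/-- Summation over both orientations of all edges is summation over all adjacent pairs. -/
theorem sum_edges (F : ℕ → ℕ → ℕ) :
    ∑ i ∈ Finset.range E.m, (F (E.fst i) (E.snd i) + F (E.snd i) (E.fst i)) =
      ∑ u ∈ Finset.range E.n, ∑ v ∈ Finset.range E.n, if E.Adj u v then F u v else 0 := by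
  -- An adjacent pair is realised by exactly one edge in exactly one orientation, because there are
  -- neither loops nor repeated edges.
  have key : ∀ u v, (if E.Adj u v then F u v else 0) = ∑ i ∈ Finset.range E.m,
      ((if E.fst i = u ∧ E.snd i = v then F u v else 0) +
        (if E.fst i = v ∧ E.snd i = u then F u v else 0)) := by
    intro u v
    split
    next h =>
      obtain ⟨i, hi, h⟩ := h
      rw [Finset.sum_eq_single i]
      · have hne := E.ne i hi
        rcases h with ⟨h1, h2⟩ | ⟨h1, h2⟩
        · rw [if_pos ⟨h1, h2⟩, if_neg (by omega)]; simp
        · rw [if_neg (by omega), if_pos ⟨h1, h2⟩]; simp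
      · intro j hj hji
        have hj := Finset.mem_range.1 hj
        have := E.uniq j hj i hi
        simp only [if_neg (show ¬(E.fst j = u ∧ E.snd j = v) by omega),
          if_neg (show ¬(E.fst j = v ∧ E.snd j = u) by omega), add_zero]
      · intro h'; simp at h'; omega
    next h =>
      symm
      refine Finset.sum_eq_zero fun i hi => ?_
      have hi := Finset.mem_range.1 hi
      rw [if_neg fun h' => h ⟨i, hi, .inl h'⟩, if_neg fun h' => h ⟨i, hi, .inr h'⟩, add_zero]
  simp_rw [key]
  rw [Finset.sum_congr rfl fun u _ => Finset.sum_comm, Finset.sum_comm]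
  refine Finset.sum_congr rfl fun i hi => ?_
  have hi := Finset.mem_range.1 hi
  have h1 := E.fst_lt i hi
  have h2 := E.snd_lt i hi
  simp_rw [Finset.sum_add_distrib, ite_and]
  congr 1
  · simp [h1, h2]
  · rw [Finset.sum_comm]
    simp [h1, h2]

/-! ### Labelings, and common labels on sets of twins -/

/-- An edge whose ends have labels `a` and `b` has to be deleted. -/
def jump (a b : ℕ) : ℕ := if a + 1 < b ∨ b + 1 < a then 1 else 0

theorem jump_comm (a b : ℕ) : jump a b = jump b a := by
  unfold jump; simp only [or_comm]

theorem jump_self (a : ℕ) : jump a a = 0 := by simp [jump]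

theorem jump_le_one (a b : ℕ) : jump a b ≤ 1 := by unfold jump; split <;> omega

/-- The number of edges that have to be deleted for the distance labels `d`. -/
def cost (d : ℕ → ℕ) : ℕ := ∑ i ∈ Finset.range E.m, jump (d (E.fst i)) (d (E.snd i))

/-- Unlike the sum over the edge list, the symmetric double sum can be split along any set of
vertices; the factor two accounts for both orientations. -/
theorem two_mul_cost (d : ℕ → ℕ) : 2 * E.cost d =
    ∑ u ∈ Finset.range E.n, ∑ v ∈ Finset.range E.n,
      if E.Adj u v then jump (d u) (d v) else 0 := by
  rw [← E.sum_edges fun u v => jump (d u) (d v), Finset.sum_add_distrib, cost]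
  simp_rw [fun i => jump_comm (d (E.snd i)) (d (E.fst i))]
  ring

/-- Labels of the vertices by truncated distances from `s` in the remaining graph. -/
structure IsLabeling (s t l : ℕ) (d : ℕ → ℕ) : Prop where
  source : d s = 0
  target : d t = l
  le : ∀ v, d v ≤ l

/-- Labels of the vertices of cost at most `k`. -/
def HasLabeling (s t k l : ℕ) : Prop := ∃ d, IsLabeling s t l d ∧ E.cost d ≤ k

/-- The set `S` of vertices with equal adjacencies outside `S` can be given a common label. -/
theorem exists_common_label (S : Finset ℕ) (hS : S ⊆ Finset.range E.n) (hne : S.Nonempty)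
    (hadj : ∀ u ∈ S, ∀ v ∈ S, ∀ w ∉ S, E.Adj u w → E.Adj v w) (d : ℕ → ℕ) :
    ∃ b ∈ S, E.cost (fun v => if v ∈ S then d b else d v) ≤ E.cost d := by
  classical
  obtain ⟨r, hr⟩ := hne
  set C := (Finset.range E.n) \ S with hC
  -- The cost, towards the rest of the graph, of one member of `S` with label `a`. By `hadj` it is
  -- the same for all members, so any `r` can serve as reference.
  let g : ℕ → ℕ := fun a => ∑ w ∈ C, if E.Adj r w then jump a (d w) else 0
  obtain ⟨b, hb, hmin⟩ := S.exists_min_image (fun u => g (d u)) ⟨r, hr⟩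
  refine ⟨b, hb, ?_⟩
  set d' : ℕ → ℕ := fun v => if v ∈ S then d b else d v with hd'
  have split2 : ∀ f : ℕ → ℕ, 2 * E.cost f =
      (∑ u ∈ S, ∑ v ∈ S, if E.Adj u v then jump (f u) (f v) else 0) +
      2 * (∑ u ∈ S, ∑ v ∈ C, if E.Adj u v then jump (f u) (f v) else 0) +
      (∑ u ∈ C, ∑ v ∈ C, if E.Adj u v then jump (f u) (f v) else 0) := by
    intro f
    rw [two_mul_cost]
    simp_rw [← Finset.sum_sdiff hS, Finset.sum_add_distrib]
    rw [← hC]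
    have : (∑ u ∈ C, ∑ v ∈ S, if E.Adj u v then jump (f u) (f v) else 0) =
        ∑ u ∈ S, ∑ v ∈ C, if E.Adj u v then jump (f u) (f v) else 0 := by
      rw [Finset.sum_comm]
      refine Finset.sum_congr rfl fun u _ => Finset.sum_congr rfl fun v _ => ?_
      rw [jump_comm, if_congr adj_comm rfl rfl]
    rw [this]
    ring
  have hCd : ∀ w ∈ C, d' w = d w := fun w hw => if_neg (Finset.mem_sdiff.1 hw).2
  have hSd : ∀ w ∈ S, d' w = d b := fun w hw => if_pos hw
  have hg : ∀ f : ℕ → ℕ, (∀ w ∈ C, f w = d w) → ∀ u ∈ S,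
      (∑ v ∈ C, if E.Adj u v then jump (f u) (f v) else 0) = g (f u) := by
    intro f hf u hu
    refine Finset.sum_congr rfl fun w hw => ?_
    have hwS := (Finset.mem_sdiff.1 hw).2
    rw [hf w hw, if_congr ⟨hadj u hu r hr w hwS, hadj r hr u hu w hwS⟩ rfl rfl]
  -- Edges inside `S` become free, and each vertex of `S` now pays the least price `g (d b)` towards
  -- the outside.
  have h1 : (∑ u ∈ S, ∑ v ∈ S, if E.Adj u v then jump (d' u) (d' v) else 0) = 0 := by
    refine Finset.sum_eq_zero fun u hu => Finset.sum_eq_zero fun v hv => ?_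
    rw [hSd u hu, hSd v hv, jump_self, ite_self]
  have h2 : (∑ u ∈ S, ∑ v ∈ C, if E.Adj u v then jump (d' u) (d' v) else 0) ≤
      ∑ u ∈ S, ∑ v ∈ C, if E.Adj u v then jump (d u) (d v) else 0 := by
    refine Finset.sum_le_sum fun u hu => ?_
    rw [hg d' hCd u hu, hg d (fun _ _ => rfl) u hu, hSd u hu]
    exact hmin u hu
  have h3 : (∑ u ∈ C, ∑ v ∈ C, if E.Adj u v then jump (d' u) (d' v) else 0) =
      ∑ u ∈ C, ∑ v ∈ C, if E.Adj u v then jump (d u) (d v) else 0 := by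
    refine Finset.sum_congr rfl fun u hu => Finset.sum_congr rfl fun v hv => ?_
    rw [hCd u hu, hCd v hv]
  have e1 := split2 d'
  have e2 := split2 d
  omega

end EdgeList

end MVE

namespace MVE

namespace EdgeList

variable (E : EdgeList)

/-! ## Cluster vertex deletion sets and labels -/

/-- Deleting `X` leaves a cluster graph: there is no induced path on three vertices. -/
def IsCluster (X : Finset ℕ) : Prop :=
  ∀ u v w, u ∉ X → v ∉ X → w ∉ X → E.Adj u v → E.Adj v w → u ≠ w → E.Adj u w

/-- Two vertices outside `X` are equal or adjacent, with the same neighbours in `X`. -/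
structure Same (X : Finset ℕ) (u v : ℕ) : Prop where
  left : u ∉ X
  right : v ∉ X
  adj : u = v ∨ E.Adj u v
  iff : ∀ z ∈ X, E.Adj u z ↔ E.Adj v z

variable {E} {X : Finset ℕ} {s t k l u v w : ℕ}

theorem Same.refl (h : v ∉ X) : E.Same X v v := ⟨h, h, .inl rfl, fun _ _ => Iff.rfl⟩

theorem Same.symm (h : E.Same X u v) : E.Same X v u :=
  ⟨h.right, h.left, h.adj.imp Eq.symm Adj.symm, fun z hz => (h.iff z hz).symm⟩

theorem IsCluster.adj_trans (hX : E.IsCluster X) (hu : u ∉ X) (hv : v ∉ X) (hw : w ∉ X)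
    (h1 : u = v ∨ E.Adj u v) (h2 : v = w ∨ E.Adj v w) : u = w ∨ E.Adj u w := by
  rcases h1 with rfl | h1
  · exact h2
  · rcases h2 with rfl | h2
    · exact .inr h1
    · by_cases h : u = w
      · exact .inl h
      · exact .inr (hX u v w hu hv hw h1 h2 h)

theorem Same.trans (hX : E.IsCluster X) (h1 : E.Same X u v) (h2 : E.Same X v w) : E.Same X u w :=
  ⟨h1.left, h2.right, hX.adj_trans h1.left h1.right h2.right h1.adj h2.adj,
    fun z hz => (h1.iff z hz).trans (h2.iff z hz)⟩

/-- Some optimal labels are constant on classes of twins. -/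
theorem HasLabeling.exists_const (hX : E.IsCluster X) (hs : s ∈ X) (ht : t ∈ X)
    (h : E.HasLabeling s t k l) :
    ∃ d, IsLabeling s t l d ∧ E.cost d ≤ k ∧ ∀ u v, E.Same X u v → d u = d v := by
  classical
  -- The classes are made uniform one after the other. Relabelling the class of `r` does no harm to
  -- earlier ones, since every class is contained in `S` or disjoint from it.
  have key : ∀ r, ∃ d, IsLabeling s t l d ∧ E.cost d ≤ k ∧
      ∀ u < r, ∀ v, E.Same X u v → d u = d v := by
    intro r
    induction r with
    | zero =>
      obtain ⟨d, h1, h2⟩ := h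
      exact ⟨d, h1, h2, fun u hu => by omega⟩
    | succ r ih =>
      obtain ⟨d, h1, h2, h3⟩ := ih
      set S := (Finset.range E.n).filter fun v => E.Same X r v with hS
      by_cases hne : S.Nonempty
      swap
      · refine ⟨d, h1, h2, fun u hu v huv => ?_⟩
        rcases Nat.lt_succ_iff_lt_or_eq.1 hu with hu | rfl
        · exact h3 u hu v huv
        · rcases huv.adj with rfl | hadj
          · rfl
          · exact (hne ⟨v, by simp [hS, huv, hadj.lt_right]⟩).elim
      have mem : ∀ v, E.Same X r v → v ∈ S := by
        intro v hv
        obtain ⟨w, hw⟩ := hne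
        rcases hv.adj with rfl | hadj
        · simp only [hS, Finset.mem_filter, Finset.mem_range] at hw ⊢
          rcases hw.2.adj with rfl | hadj
          · exact ⟨hw.1, hv⟩
          · exact ⟨hadj.lt_left, hv⟩
        · simp [hS, hv, hadj.lt_right]
      have mem' : ∀ v, v ∈ S → E.Same X r v := fun v hv => (Finset.mem_filter.1 hv).2
      obtain ⟨b, hb, hcost⟩ := E.exists_common_label S (Finset.filter_subset _ _) hne
        (by
          intro u hu v hv w hw hadj
          -- Twins have the same neighbours outside their class: in `X` by definition, in the clique
          -- because adjacency is transitive there.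
          have huv := (mem' u hu).symm.trans hX (mem' v hv)
          by_cases hwX : w ∈ X
          · exact (huv.iff w hwX).1 hadj
          · rcases hX.adj_trans huv.right huv.left hwX huv.symm.adj (.inr hadj) with rfl | h
            · exact (hw hv).elim
            · exact h) d
      refine ⟨_, ⟨?_, ?_, ?_⟩, hcost.trans h2, ?_⟩
      · have : s ∉ S := fun h => (mem' s h).right hs
        simp [this, h1.source]
      · have : t ∉ S := fun h => (mem' t h).right ht
        simp [this, h1.target]
      · intro v
        show (if v ∈ S then d b else d v) ≤ l
        split <;> exact h1.le _
      · intro u hu v huv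
        show (if u ∈ S then d b else d u) = (if v ∈ S then d b else d v)
        by_cases huS : u ∈ S
        · rw [if_pos huS, if_pos (mem v ((mem' u huS).trans hX huv))]
        · have hvS : v ∉ S := fun h => huS (mem u ((mem' v h).trans hX huv.symm))
          rw [if_neg huS, if_neg hvS]
          rcases Nat.lt_succ_iff_lt_or_eq.1 hu with hu | rfl
          · exact h3 u hu v huv
          · exact (huS (mem u (.refl huv.left))).elim
  obtain ⟨d, h1, h2, h3⟩ := key E.n
  refine ⟨d, h1, h2, fun u v huv => ?_⟩
  rcases huv.adj with rfl | hadj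
  · rfl
  · exact h3 u hadj.lt_left v huv

/-- Truncating all labels at `l'` never increases the difference of two labels. -/
theorem HasLabeling.of_le {l' : ℕ} (h : E.HasLabeling s t k l) (hl : l' ≤ l) :
    E.HasLabeling s t k l' := by
  obtain ⟨d, h1, h2⟩ := h
  refine ⟨fun v => min (d v) l', ⟨by simp [h1.source], by simp [h1.target, hl], by simp⟩, ?_⟩
  refine le_trans (Finset.sum_le_sum fun i _ => ?_) h2
  simp only [jump]
  split <;> split <;> omega

/-! ### Slots, and the bound on the relevant distances -/

variable (E X)

/-- The numbers that the algorithm assigns to the vertices: `rep` names the clique of a vertex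
outside `X`, and `slot` numbers the vertices of `X` and the twin classes of each clique. -/
structure IsSlots (rep slot : ℕ → ℕ) (hi : ℕ) : Prop where
  sub : X ⊆ Finset.range E.n
  cluster : E.IsCluster X
  rep_lt : ∀ v < E.n, rep v < E.n
  rep_iff : ∀ u < E.n, ∀ v < E.n, u ∉ X → v ∉ X → (rep u = rep v ↔ u = v ∨ E.Adj u v)
  slot_lt : ∀ x ∈ X, slot x < X.card
  slot_inj : ∀ x ∈ X, ∀ y ∈ X, slot x = slot y → x = y
  slot_ge : ∀ v < E.n, v ∉ X → X.card ≤ slot v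
  slot_lt_hi : ∀ v < E.n, v ∉ X → slot v < hi
  slot_same : ∀ u v, u ∉ X → v ∉ X → E.Adj u v → slot u = slot v → E.Same X u v

variable {E X} {rep slot : ℕ → ℕ} {hi : ℕ}

/-- Labels on the same side of `p` keep their difference. Labels on different sides, neither equal
to `p`, differ by at least two, so their edge is already paid for. -/
theorem jump_shift_le {a b a' b' p : ℕ} (ha : a ≠ p) (hb : b ≠ p)
    (ha' : a' = if p < a then a + 1 else a) (hb' : b' = if p < b then b + 1 else b) :
    jump a' b' ≤ jump a b := by
  subst ha' hb'
  unfold jump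
  split_ifs <;> omega

/-- A label block that no vertex of `X` uses. -/
theorem exists_free_block (d : ℕ → ℕ) (hs : s ∈ X) (hd : d s = 0) (g : ℕ) (hg : 0 < g) :
    ∃ j < X.card, ∀ x ∈ X, d x ≤ j * g ∨ (j + 1) * g < d x := by
  by_contra! hcon
  -- If all `|X|` blocks were hit, `x ↦ (d x - 1) / g` would map `X` without `s` onto them; `s`
  -- itself hits no block, as blocks start above label `0`.
  have : (Finset.range X.card).card ≤ (X.erase s).card := by
    refine Finset.card_le_card_of_surjOn (fun x => (d x - 1) / g) fun j hj => ?_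
    obtain ⟨x, hx, h1, h2⟩ := hcon j (by simpa using hj)
    have hxs : x ≠ s := by
      rintro rfl
      omega
    refine ⟨x, by simp [hx, hxs], ?_⟩
    show (d x - 1) / g = j
    rw [Nat.div_eq_iff hg]
    have : (j + 1) * g = j * g + g := by ring
    omega
  have := Finset.card_erase_lt_of_mem hs
  simp at *
  omega

/-- Large distances can be increased by one at no cost. -/
theorem HasLabeling.succ (H : E.IsSlots X rep slot hi) (hs : s ∈ X) (ht : t ∈ X)
    (h : E.HasLabeling s t k l) (hl : X.card * (hi - X.card + 1) ≤ l) :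
    E.HasLabeling s t k (l + 1) := by
  classical
  obtain ⟨d, h1, h2, h3⟩ := h.exists_const H.cluster hs ht
  set q := hi - X.card with hq
  obtain ⟨j, hj, hfree⟩ := exists_free_block d hs h1.source (q + 1) (by omega)
  set a := j * (q + 1) with ha
  have ha2 : (j + 1) * (q + 1) = a + q + 1 := by rw [ha]; ring
  rw [ha2] at hfree
  have hal : a + q + 1 ≤ l := by
    rw [← ha2]
    exact (Nat.mul_le_mul_right _ hj).trans hl
  -- `p` is a label of the free block that the clique of `u` does not use. It exists because the
  -- block has `q + 1` labels and the clique at most `q` slots.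
  let P : ℕ → ℕ → Prop := fun u p => a < p ∧ p ≤ a + q + 1 ∧
    ∀ v < E.n, v ∉ X → (u = v ∨ E.Adj u v) → d v ≠ p
  have hP : ∀ u < E.n, u ∉ X → ∃ p, P u p := by
    intro u hu huX
    set C := (Finset.range E.n).filter fun v => v ∉ X ∧ (u = v ∨ E.Adj u v) with hC
    have hcard : (C.image d).card < (Finset.Ioc a (a + q + 1)).card := by
      -- Members of the clique with equal slots are twins and share their label, so there are no
      -- more labels than slots.
      have h4 : (C.image d).card ≤ (C.image slot).card := by
        refine Finset.card_le_card_of_surjOn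
          (fun r => if h : ∃ v ∈ C, slot v = r then d h.choose else 0) ?_
        intro b hb
        obtain ⟨v, hv, rfl⟩ := Finset.mem_image.1 hb
        have hex : ∃ w ∈ C, slot w = slot v := ⟨v, hv, rfl⟩
        refine ⟨slot v, by simpa using hex, ?_⟩
        simp only [dif_pos hex]
        obtain ⟨hw, hws⟩ := hex.choose_spec
        generalize hex.choose = w at *
        simp only [hC, Finset.mem_filter, Finset.mem_range] at hw hv
        refine h3 w v ?_
        rcases H.cluster.adj_trans hw.2.1 huX hv.2.1 (hw.2.2.imp Eq.symm Adj.symm) hv.2.2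
          with rfl | hadj
        · exact .refl hw.2.1
        · exact H.slot_same w v hw.2.1 hv.2.1 hadj hws
      have h5 : C.image slot ⊆ Finset.Ico X.card hi := by
        intro r hr
        obtain ⟨v, hv, rfl⟩ := Finset.mem_image.1 hr
        simp only [hC, Finset.mem_filter, Finset.mem_range] at hv
        simp [H.slot_ge v hv.1 hv.2.1, H.slot_lt_hi v hv.1 hv.2.1]
      have h6 := Finset.card_le_card h5
      simp only [Nat.card_Ico, Nat.card_Ioc] at *
      omega
    obtain ⟨p, hp, hpC⟩ := Finset.exists_mem_notMem_of_card_lt_card hcard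
    simp only [Finset.mem_Ioc] at hp
    refine ⟨p, hp.1, by omega, fun v hv hvX huv hdv => hpC ?_⟩
    exact Finset.mem_image.2 ⟨v, by simp [hC, hv, hvX, huv], hdv⟩
  -- Taking the least such label makes the choice depend on the clique only, so both ends of an edge
  -- inside a clique get the same threshold.
  let p : ℕ → ℕ := fun u => sInf {p | P u p}
  have hp : ∀ u < E.n, u ∉ X → P u (p u) := fun u hu huX => Nat.sInf_mem (hP u hu huX)
  have hpeq : ∀ u v, u ∉ X → v ∉ X → E.Adj u v → p u = p v := by
    intro u v hu hv huv
    have : ∀ b, P u b ↔ P v b := by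
      intro b
      refine and_congr_right fun _ => and_congr_right fun _ => ?_
      refine forall_congr' fun w => forall_congr' fun _ => forall_congr' fun hw => ?_
      have : (u = w ∨ E.Adj u w) ↔ (v = w ∨ E.Adj v w) :=
        ⟨H.cluster.adj_trans hv hu hw (.inr huv.symm), H.cluster.adj_trans hu hv hw (.inr huv)⟩
      rw [this]
    simp only [p, this]
  -- Labels of `X` avoid the whole block, so for them the threshold `a` acts like any threshold in
  -- the block. Numbers that are not vertices get an arbitrary default.
  let c : ℕ → ℕ := fun v => if v ∈ X then a else if v < E.n then p v else a
  let d' : ℕ → ℕ := fun v => if c v < d v then d v + 1 else d v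
  have hX : ∀ x ∈ X, ∀ b, a < b → b ≤ a + q + 1 →
      d x ≠ b ∧ d' x = if b < d x then d x + 1 else d x := by
    intro x hx b hb1 hb2
    have := hfree x hx
    simp only [d', c, if_pos hx]
    split_ifs <;> omega
  have hK : ∀ v < E.n, v ∉ X → d v ≠ p v ∧ d' v = if p v < d v then d v + 1 else d v := by
    intro v hv hvX
    refine ⟨(hp v hv hvX).2.2 v hv hvX (.inl rfl), ?_⟩
    simp only [d', c, if_neg hvX, if_pos hv]
  refine ⟨d', ⟨?_, ?_, ?_⟩, le_trans (Finset.sum_le_sum fun i hi => ?_) h2⟩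
  · simp [d', h1.source]
  · have := h1.target
    simp only [d', c, if_pos ht]
    rw [if_pos (by omega), this]
  · intro v
    have := h1.le v
    simp only [d']
    split_ifs <;> omega
  · have hi := Finset.mem_range.1 hi
    have hf := E.fst_lt i hi
    have hg := E.snd_lt i hi
    have hadj := adj_edge hi
    have : ∃ b, (d (E.fst i) ≠ b ∧ d' (E.fst i) =
          if b < d (E.fst i) then d (E.fst i) + 1 else d (E.fst i)) ∧
        (d (E.snd i) ≠ b ∧ d' (E.snd i) =
          if b < d (E.snd i) then d (E.snd i) + 1 else d (E.snd i)) := by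
      by_cases hfX : E.fst i ∈ X
      · by_cases hgX : E.snd i ∈ X
        · exact ⟨a + 1, hX _ hfX _ (by omega) (by omega), hX _ hgX _ (by omega) (by omega)⟩
        · have := hp _ hg hgX
          exact ⟨p (E.snd i), hX _ hfX _ this.1 this.2.1, hK _ hg hgX⟩
      · by_cases hgX : E.snd i ∈ X
        · have := hp _ hf hfX
          exact ⟨p (E.fst i), hK _ hf hfX, hX _ hgX _ this.1 this.2.1⟩
        · refine ⟨p (E.fst i), hK _ hf hfX, ?_⟩
          rw [hpeq _ _ hfX hgX hadj]
          exact hK _ hg hgX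
    obtain ⟨b, ⟨x1, x2⟩, y1, y2⟩ := this
    exact jump_shift_le x1 y1 x2 y2

/-- Only small distances matter. -/
theorem hasLabeling_min_iff (H : E.IsSlots X rep slot hi) (hs : s ∈ X) (ht : t ∈ X) :
    E.HasLabeling s t k (min l (X.card * (hi - X.card + 1))) ↔ E.HasLabeling s t k l := by
  refine ⟨fun h => ?_, fun h => h.of_le (min_le_left _ _)⟩
  rcases le_total l (X.card * (hi - X.card + 1)) with hl | hl
  · rwa [min_eq_left hl] at h
  · rw [min_eq_right hl] at h
    -- The distance is raised in unit steps, starting from the bound.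
    induction l, hl using Nat.le_induction with
    | base => exact h
    | succ l hl ih => exact ih.succ H hs ht hl

/-! ## The costs of the cliques are independent -/

variable (E X)

/-- The clique (or the vertex of `X`) that accounts for an edge. -/
def owner (rep : ℕ → ℕ) (i : ℕ) : ℕ :=
  if E.fst i ∈ X then rep (E.snd i) else rep (E.fst i)

/-- The cost, among the first `j` edges, of those that `o` accounts for. -/
def costUpTo (rep slot : ℕ → ℕ) (g : ℕ → ℕ) (o j : ℕ) : ℕ :=
  ∑ i ∈ Finset.range j,
    if E.owner X rep i = o then jump (g (slot (E.fst i))) (g (slot (E.snd i))) else 0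

/-- The cost of the edges that `o` accounts for. -/
def costAt (rep slot : ℕ → ℕ) (g : ℕ → ℕ) (o : ℕ) : ℕ := E.costUpTo X rep slot g o E.m

theorem costUpTo_le (rep slot : ℕ → ℕ) (g : ℕ → ℕ) (o j : ℕ) :
    E.costUpTo X rep slot g o j ≤ j := by
  calc _ ≤ ∑ i ∈ Finset.range j, 1 := Finset.sum_le_sum fun i _ => by
        split
        · exact jump_le_one _ _
        · omega
    _ = j := by simp

/-- The labels `f` of the vertices of `X` extend to labels of all vertices of cost at most `k`. -/
structure Extends (rep slot : ℕ → ℕ) (s t k l : ℕ) (f : ℕ → ℕ) : Prop where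
  source : f (slot s) = 0
  target : f (slot t) = l
  ex : ∃ G : ℕ → ℕ → ℕ, (∀ o, ∀ r < X.card, G o r = f r) ∧ (∀ o r, G o r ≤ l) ∧
    ∑ o ∈ Finset.range E.n, E.costAt X rep slot (G o) o ≤ k

variable {E X}

/-- Two adjacent vertices outside `X` lie in the same clique and have the same name. Edges inside
`X` may be charged anywhere, since all cliques see the same labels on `X`. -/
theorem owner_eq (H : E.IsSlots X rep slot hi) {i : ℕ} (hi' : i < E.m) :
    (E.fst i ∉ X → rep (E.fst i) = E.owner X rep i) ∧
      (E.snd i ∉ X → rep (E.snd i) = E.owner X rep i) := by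
  have hf := E.fst_lt i hi'
  have hg := E.snd_lt i hi'
  unfold owner
  refine ⟨fun h => by rw [if_neg h], fun h => ?_⟩
  split
  · rfl
  next hf' => exact ((H.rep_iff _ hf _ hg hf' h).2 (.inr (adj_edge hi'))).symm

theorem owner_lt (H : E.IsSlots X rep slot hi) {i : ℕ} (hi' : i < E.m) :
    E.owner X rep i < E.n := by
  unfold owner
  split
  · exact H.rep_lt _ (E.snd_lt i hi')
  · exact H.rep_lt _ (E.fst_lt i hi')

/-- Every edge has exactly one owner, and the labels `G o` of its owner agree with `d` at both ends.
-/
theorem sum_costAt (H : E.IsSlots X rep slot hi) (G : ℕ → ℕ → ℕ) (d : ℕ → ℕ)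
    (hX : ∀ x ∈ X, ∀ o, d x = G o (slot x))
    (hK : ∀ v < E.n, v ∉ X → d v = G (rep v) (slot v)) :
    ∑ o ∈ Finset.range E.n, E.costAt X rep slot (G o) o = E.cost d := by
  unfold costAt costUpTo cost
  rw [Finset.sum_comm]
  refine Finset.sum_congr rfl fun i hi => ?_
  have hi := Finset.mem_range.1 hi
  rw [Finset.sum_eq_single (E.owner X rep i), if_pos rfl]
  · have key : ∀ v < E.n, (v ∉ X → rep v = E.owner X rep i) →
        G (E.owner X rep i) (slot v) = d v := by
      intro v hv ho
      by_cases hvX : v ∈ X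
      · exact (hX v hvX _).symm
      · rw [hK v hv hvX, ho hvX]
    rw [key _ (E.fst_lt i hi) (owner_eq H hi).1, key _ (E.snd_lt i hi) (owner_eq H hi).2]
  · intro o _ ho
    rw [if_neg ho.symm]
  · intro ho
    exact (ho (Finset.mem_range.2 (owner_lt H hi))).elim

/-- The only interaction between different cliques is through `X`. Hence the labels for each clique
can be chosen separately once those on `X` are given, and twins may be assumed to share a label. -/
theorem hasLabeling_iff (H : E.IsSlots X rep slot hi) (hs : s ∈ X) (ht : t ∈ X) :
    E.HasLabeling s t k l ↔ ∃ f, (∀ r, f r ≤ l) ∧ E.Extends X rep slot s t k l f := by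
  classical
  constructor
  · intro h
    obtain ⟨d, h1, h2, h3⟩ := h.exists_const H.cluster hs ht
    -- A slot determines its vertex in `X`; unused slots get the default `0`.
    let f : ℕ → ℕ := fun r => if h : ∃ x ∈ X, slot x = r then d h.choose else 0
    have hf : ∀ x ∈ X, f (slot x) = d x := by
      intro x hx
      have hex : ∃ y ∈ X, slot y = slot x := ⟨x, hx, rfl⟩
      simp only [f, dif_pos hex]
      rw [H.slot_inj _ hex.choose_spec.1 x hx hex.choose_spec.2]
    have hf0 : ∀ r, f r ≤ l := by
      intro r
      simp only [f]
      split
      · exact h1.le _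
      · omega
    -- Inside the clique `o` a slot stands for a twin class, on which `d` is constant, so it does
    -- not matter which member is chosen.
    let G : ℕ → ℕ → ℕ := fun o r => if r < X.card then f r else
      if h : ∃ v < E.n, v ∉ X ∧ rep v = o ∧ slot v = r then d h.choose else 0
    have hG : ∀ v < E.n, v ∉ X → d v = G (rep v) (slot v) := by
      intro v hv hvX
      have hex : ∃ w < E.n, w ∉ X ∧ rep w = rep v ∧ slot w = slot v := ⟨v, hv, hvX, rfl, rfl⟩
      have := H.slot_ge v hv hvX
      simp only [G, if_neg this.not_gt, dif_pos hex]
      obtain ⟨w1, w2, w3, w4⟩ := hex.choose_spec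
      generalize hex.choose = w at *
      rcases (H.rep_iff w w1 v hv w2 hvX).1 w3 with rfl | hadj
      · rfl
      · exact (h3 w v (H.slot_same w v w2 hvX hadj w4)).symm
    refine ⟨f, hf0, by rw [hf s hs, h1.source], by rw [hf t ht, h1.target], G, ?_, ?_, ?_⟩
    · intro o r hr
      simp only [G, if_pos hr]
    · intro o r
      simp only [G]
      split
      · exact hf0 r
      · split
        · exact h1.le _
        · omega
    · rw [sum_costAt H G d _ hG]
      · exact h2
      · intro x hx o
        simp only [G, if_pos (H.slot_lt x hx), hf x hx]
  · rintro ⟨f, hf0, hfs, hft, G, hG1, hG2, hG3⟩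
    refine ⟨fun v => if v ∈ X then f (slot v) else G (rep v) (slot v), ⟨?_, ?_, ?_⟩, ?_⟩
    · simp [hs, hfs]
    · simp [ht, hft]
    · intro v
      show (if v ∈ X then f (slot v) else G (rep v) (slot v)) ≤ l
      split
      · exact hf0 _
      · exact hG2 _ _
    · rw [← sum_costAt H G _ _ _]
      · exact hG3
      · intro x hx o
        simp only [if_pos hx, hG1 o _ (H.slot_lt x hx)]
      · intro v hv hvX
        simp only [if_neg hvX]

end EdgeList

end MVE

namespace MVE

/-! ## Connection with the graph problem -/

theorem getD_flatMap_pair {α : Type*} (f g : α → ℕ) (L : List α) (i : ℕ) (hi : i < L.length) :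
    (L.flatMap fun e => [f e, g e]).getD (2 * i) 0 = f L[i] ∧
      (L.flatMap fun e => [f e, g e]).getD (2 * i + 1) 0 = g L[i] := by
  induction L generalizing i with
  | nil => simp at hi
  | cons e L ih =>
    cases i with
    | zero => simp
    | succ i =>
      have := ih i (by simpa using hi)
      simpa [List.flatMap_cons, mul_add] using this

section

variable {n : ℕ} (L : List (Fin n × Fin n)) (s t : Fin n) (k l : ℕ)

theorem getD_encode (i : ℕ) (hi : i < L.length) :
    (encodeInstance n L s t k l).getD (6 + 2 * i) 0 = (L[i].1 : ℕ) ∧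
      (encodeInstance n L s t k l).getD (7 + 2 * i) 0 = (L[i].2 : ℕ) := by
  have := getD_flatMap_pair (fun e : Fin n × Fin n => (e.1 : ℕ)) (fun e => (e.2 : ℕ)) L i hi
  rw [show 7 + 2 * i = 6 + (2 * i + 1) by ring, encodeInstance,
    List.getD_append_right _ _ _ _ (by simp), List.getD_append_right _ _ _ _ (by simp)]
  simpa [Nat.add_sub_cancel_left] using this

theorem length_encode : (encodeInstance n L s t k l).length = 6 + 2 * L.length := by
  simp [encodeInstance, List.length_flatMap]
  ring

end

/-- The edge list of a graph with arithmetic indices. -/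
def edgeListOf {n : ℕ} {G : SimpleGraph (Fin n)} {L : List (Fin n × Fin n)} (hL : IsEdgeList G L) :
    EdgeList where
  n := n
  m := L.length
  fst i := if h : i < L.length then (L[i].1 : ℕ) else 0
  snd i := if h : i < L.length then (L[i].2 : ℕ) else 0
  fst_lt i hi := by simp [hi]
  snd_lt i hi := by simp [hi]
  ne i hi := by
    have : s(L[i].1, L[i].2) ∈ G.edgeSet := (hL.2 _).1 (by
      simp only [List.mem_map]
      exact ⟨L[i], List.getElem_mem hi, rfl⟩)
    simpa [hi, Fin.val_inj] using this.ne
  uniq i hi j hj h := by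
    simp only [hi, hj, dif_pos, Fin.val_inj] at h
    have := (List.nodup_iff_injective_get.1 hL.1)
    have h2 := @this ⟨i, by simpa using hi⟩ ⟨j, by simpa using hj⟩
      (by simpa only [List.get_eq_getElem, List.getElem_map, Sym2.eq_iff] using h)
    simpa using h2

section

variable {n : ℕ} {G : SimpleGraph (Fin n)} {L : List (Fin n × Fin n)} (hL : IsEdgeList G L)

theorem edge_mem (hL : IsEdgeList G L) (i : ℕ) (hi : i < L.length) :
    s(L[i].1, L[i].2) ∈ G.edgeSet := by
  refine (hL.2 _).1 ?_
  simp only [List.mem_map]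
  exact ⟨L[i], List.getElem_mem hi, rfl⟩

theorem adj_edgeListOf (u v : Fin n) : (edgeListOf hL).Adj u v ↔ G.Adj u v := by
  constructor
  · rintro ⟨i, hi, h⟩
    have hi : i < L.length := hi
    simp only [edgeListOf, hi, dif_pos, Fin.val_inj] at h
    have := edge_mem hL i hi
    rcases h with ⟨rfl, rfl⟩ | ⟨rfl, rfl⟩
    · exact this
    · exact (G.mem_edgeSet.1 this).symm
  · intro h
    have : s(u, v) ∈ L.map fun e => s(e.1, e.2) := (hL.2 _).2 h
    obtain ⟨e, he, h⟩ := List.mem_map.1 this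
    obtain ⟨i, hi, rfl⟩ := List.getElem_of_mem he
    refine ⟨i, hi, ?_⟩
    simp only [edgeListOf, hi, dif_pos, Fin.val_inj]
    exact Sym2.eq_iff.1 h

theorem cost_edgeListOf (d : ℕ → ℕ) : (edgeListOf hL).cost d =
    (Finset.univ.filter fun i : Fin L.length =>
      EdgeList.jump (d (L[i].1 : ℕ)) (d (L[i].2 : ℕ)) = 1).card := by
  rw [EdgeList.cost, Finset.card_filter]
  show ∑ i ∈ Finset.range L.length, _ = _
  rw [Finset.sum_range]
  refine Finset.sum_congr rfl fun i _ => ?_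
  simp only [edgeListOf, i.2, dif_pos]
  have := EdgeList.jump_le_one (d (L[i].1 : ℕ)) (d (L[i].2 : ℕ))
  simp only [Fin.getElem_fin] at this ⊢
  split <;> omega

theorem edge_injective (hL : IsEdgeList G L) :
    Function.Injective fun i : Fin L.length => s(L[i].1, L[i].2) := by
  intro i j hij
  have := (List.nodup_iff_injective_get.1 hL.1)
  have h2 := @this ⟨i, by simp⟩ ⟨j, by simp⟩ (by simpa using hij)
  simpa [Fin.ext_iff] using h2

/-- From a solution, distances from `s` truncated at `l` give labels that jump only along deleted
edges. Conversely, after deleting the jumps a label grows by at most one per step, so a walk from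
label `0` to label `l` needs `l` steps. -/
theorem unitSPMVE_iff (s t : Fin n) (k l : ℕ) :
    UnitSPMVE G s t k l ↔ (edgeListOf hL).HasLabeling s t k l := by
  classical
  constructor
  · rintro ⟨S, hS, hSk, hP⟩
    set H := G.deleteEdges (S : Set (Sym2 (Fin n))) with hH
    -- Shortcuts turn a walk into a path that is no longer; unlike paths, walks can be extended by
    -- an arbitrary edge.
    have hwalk : ∀ p : H.Walk s t, l ≤ p.length := by
      intro p
      have := hP p.bypass p.bypass_isPath
      simp only [List.map_const', List.sum_replicate, SimpleGraph.Walk.length_edges,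
        smul_eq_mul, mul_one] at this
      exact this.trans p.length_bypass_le_length
    -- Including `l` itself truncates the distance and settles the unreachable vertices.
    let D : Fin n → ℕ := fun v => sInf {r | r = l ∨ ∃ p : H.Walk s v, p.length = r}
    have hD : ∀ v, D v = l ∨ ∃ p : H.Walk s v, p.length = D v :=
      fun v => Nat.sInf_mem (s := {r | r = l ∨ ∃ p : H.Walk s v, p.length = r}) ⟨l, .inl rfl⟩
    have hDl : ∀ v, D v ≤ l := fun v => Nat.sInf_le (.inl rfl)
    have hDp : ∀ v (p : H.Walk s v), D v ≤ p.length := fun v p => Nat.sInf_le (.inr ⟨p, rfl⟩)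
    have hadj : ∀ u v, H.Adj u v → D v ≤ D u + 1 := by
      intro u v huv
      rcases hD u with h | ⟨p, hp⟩
      · have := hDl v
        omega
      · have := hDp v (p.concat huv)
        simpa [hp] using this
    let d : ℕ → ℕ := fun v => if h : v < n then D ⟨v, h⟩ else 0
    have hd : ∀ v : Fin n, d v = D v := fun v => by simp [d]
    refine ⟨d, ⟨?_, ?_, ?_⟩, ?_⟩
    · rw [hd]
      have := hDp s .nil
      simpa using this
    · rw [hd]
      rcases hD t with h | ⟨p, hp⟩
      · exact h
      · have := hwalk p
        have := hDl t
        omega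
    · intro v
      simp only [d]
      split
      · exact hDl _
      · omega
    · rw [cost_edgeListOf]
      refine le_trans ?_ hSk
      refine Finset.card_le_card_of_injOn (fun i => s(L[i].1, L[i].2)) ?_
        (edge_injective hL).injOn
      intro i hi
      simp only [Finset.coe_filter, Finset.mem_univ, true_and, Set.mem_ofPred_eq, hd] at hi
      -- A surviving edge changes the truncated distance by at most one in either direction, so it
      -- is no jump.
      by_contra hiS
      have hGadj : G.Adj L[i].1 L[i].2 := edge_mem hL i i.2
      have hHadj : H.Adj L[i].1 L[i].2 := by
        rw [hH, SimpleGraph.deleteEdges_adj]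
        exact ⟨hGadj, by simpa using hiS⟩
      have h1 := hadj _ _ hHadj
      have h2 := hadj _ _ hHadj.symm
      unfold EdgeList.jump at hi
      split at hi <;> omega
  · rintro ⟨d, hd, hk⟩
    rw [cost_edgeListOf] at hk
    set C := Finset.univ.filter fun i : Fin L.length =>
      EdgeList.jump (d (L[i].1 : ℕ)) (d (L[i].2 : ℕ)) = 1 with hC
    set S := C.image fun i => s(L[i].1, L[i].2) with hS
    refine ⟨S, ?_, Finset.card_image_le.trans hk, ?_⟩
    · intro e he
      obtain ⟨i, _, rfl⟩ := Finset.mem_image.1 he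
      exact edge_mem hL i i.2
    · have hadj : ∀ u v : Fin n, (G.deleteEdges (S : Set (Sym2 (Fin n)))).Adj u v →
          d v ≤ d u + 1 := by
        intro u v huv
        rw [SimpleGraph.deleteEdges_adj] at huv
        have : s(u, v) ∈ L.map fun e => s(e.1, e.2) := (hL.2 _).2 huv.1
        obtain ⟨e, he, h⟩ := List.mem_map.1 this
        obtain ⟨i, hi, rfl⟩ := List.getElem_of_mem he
        have hnot : (⟨i, hi⟩ : Fin L.length) ∉ C := fun hmem =>
          huv.2 (by rw [← h]; exact Finset.mem_coe.2 (Finset.mem_image.2 ⟨⟨i, hi⟩, hmem, rfl⟩))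
        have hnot : ¬ EdgeList.jump (d (L[i].1 : ℕ)) (d (L[i].2 : ℕ)) = 1 := fun h =>
          hnot (Finset.mem_filter.2 ⟨Finset.mem_univ _, h⟩)
        unfold EdgeList.jump at hnot
        simp only [Sym2.eq_iff] at h
        rcases h with ⟨rfl, rfl⟩ | ⟨rfl, rfl⟩ <;> split at hnot <;> omega
      have hwalk : ∀ u v (p : (G.deleteEdges (S : Set (Sym2 (Fin n)))).Walk u v),
          d v ≤ d u + p.length := by
        intro u v p
        induction p with
        | nil => simp
        | cons h p ih =>
          have := hadj _ _ h
          rw [SimpleGraph.Walk.length_cons]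
          omega
      intro P _
      have := hwalk _ _ P
      simp only [List.map_const', List.sum_replicate, SimpleGraph.Walk.length_edges,
        smul_eq_mul, mul_one]
      rw [hd.source, hd.target] at this
      omega

/-- Distances of at least `n` are infinite. -/
theorem unitSPMVE_min (s t : Fin n) (k l : ℕ) :
    UnitSPMVE G s t k (min l n) ↔ UnitSPMVE G s t k l := by
  unfold UnitSPMVE SPMVE
  refine exists_congr fun S => and_congr_right fun _ => and_congr_right fun _ =>
    forall_congr' fun P => forall_congr' fun hP => ?_
  have := hP.length_lt
  simp only [List.map_const', List.sum_replicate, SimpleGraph.Walk.length_edges,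
        smul_eq_mul, mul_one, Fintype.card_fin] at this ⊢
  omega

/-- More deletions than edges are not needed. -/
theorem hasLabeling_min (E : EdgeList) (s t k l : ℕ) :
    E.HasLabeling s t (min k E.m) l ↔ E.HasLabeling s t k l := by
  refine exists_congr fun d => and_congr_right fun _ => ?_
  have : E.cost d ≤ E.m := by
    calc E.cost d ≤ ∑ i ∈ Finset.range E.m, 1 :=
          Finset.sum_le_sum fun i _ => EdgeList.jump_le_one _ _
      _ = E.m := by simp
  omega

/-- Two consecutive edges outside `X` put their ends into one component, so the definition through
components rules out induced paths on three vertices. Only this direction is needed, because `Y`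
appears in the analysis and not in the program. -/
theorem exists_isCluster : ∃ Y : Finset ℕ, (edgeListOf hL).IsCluster Y ∧
    Y.card = clusterVertexDeletionNumber G := by
  have hmem := Nat.sInf_mem (s := {x : ℕ | ∃ X : Finset (Fin n),
    IsClusterVertexDeletionSet G X ∧ X.card = x}) ⟨_, Finset.univ, by
      intro u
      exact (u.2 (Finset.mem_univ _)).elim, rfl⟩
  obtain ⟨X, hX, hc⟩ := hmem
  refine ⟨X.map Fin.valEmbedding, ?_, by rw [Finset.card_map, hc]; rfl⟩
  intro u v w hu hv hw huv hvw huw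
  have hun : u < n := huv.lt_left
  have hvn : v < n := huv.lt_right
  have hwn : w < n := hvw.lt_right
  lift u to Fin n using hun
  lift v to Fin n using hvn
  lift w to Fin n using hwn
  simp only [Finset.mem_map, Fin.valEmbedding_apply, Fin.val_inj, exists_eq_right] at hu hv hw
  rw [adj_edgeListOf] at huv hvw ⊢
  have h1 : (G.induce {v : Fin n | v ∉ X}).Adj ⟨u, hu⟩ ⟨v, hv⟩ := huv
  have h2 : (G.induce {v : Fin n | v ∉ X}).Adj ⟨v, hv⟩ ⟨w, hw⟩ := hvw
  have h3 := hX ⟨u, hu⟩ ⟨w, hw⟩ (h1.reachable.trans h2.reachable)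
    (by simpa [Fin.val_inj] using huw)
  exact h3

end

end MVE

namespace MVE

/-! ## The program -/

namespace Cmd

open Exp

/-- The `adj` entry of two vertices. -/
def adjEntry (e f : Exp) : Exp := get .adj (e * var .n + f)

/-- Reads the edges and fills the adjacency matrix. -/
def readEdges : Cmd :=
  forTo .e (var .m)
    (read .u (6 + (var .e + var .e)) ;; read .v (7 + (var .e + var .e)) ;;
      put .fst (var .e) (var .u) ;; put .snd (var .e) (var .v) ;;
      put .adj (var .u * var .n + var .v) 1 ;; put .adj (var .v * var .n + var .u) 1)

/-- Loads the current edge. -/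
def loadEdge : Cmd := set .u (get .fst (var .e)) ;; set .v (get .snd (var .e))

/-- Neither end of the current edge is deleted. -/
def bothKept : Exp := lt (get .del (var .u) + get .del (var .v)) 1

/-- Initializes degrees and clique names. -/
def initDegrees : Cmd := forTo .i (var .n) (put .deg (var .i) 0 ;; put .rep (var .i) (var .i))

/-- The degrees and the least closed neighbours in the remaining graph. -/
def degrees : Cmd :=
  forTo .e (var .m) (loadEdge ;; when bothKept
    (put .deg (var .u) (get .deg (var .u) + 1) ;; put .deg (var .v) (get .deg (var .v) + 1) ;;
      lower .rep (var .u) (var .v) ;; lower .rep (var .v) (var .u)))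

/-- Finds an edge whose ends differ in degree or least closed neighbour. -/
def findEdge : Cmd :=
  forTo .e (var .m) (loadEdge ;; when bothKept
    (when (lt (eq (get .deg (var .u)) (get .deg (var .v)) +
        eq (get .rep (var .u)) (get .rep (var .v))) (1 + 1))
      (set .found 1 ;; set .fu (var .u) ;; set .fv (var .v))))

/-- Finds a vertex that completes such an edge to an induced path on three vertices. -/
def findThird : Cmd :=
  forTo .i (var .n)
    (when (lt (eq (var .i) (var .fu) + eq (var .i) (var .fv) + get .del (var .i) +
        eq (adjEntry (var .fu) (var .i)) (adjEntry (var .fv) (var .i))) 1)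
      (set .fw (var .i)))

/-- Deletes the vertices of a maximal packing of induced paths on three vertices. -/
def packing : Cmd :=
  (put .del (var .s) 1 ;; put .del (var .t) 1 ;; set .found 1) ;;
  loop (var .found)
    (set .found 0 ;; initDegrees ;; degrees ;; findEdge ;; ite (var .found)
      (findThird ;; (put .del (var .fu) 1 ;; put .del (var .fv) 1 ;; put .del (var .fw) 1)) skip)

/-- Lists the deleted vertices. -/
def numberDeleted : Cmd :=
  set .xc 0 ;;
  forTo .i (var .n) (when (get .del (var .i))
    (put .xs (var .xc) (var .i) ;; put .slot (var .i) (var .xc) ;; set .xc (var .xc + 1)))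

/-- Initializes the twin classes and the slots of the remaining vertices. -/
def initClasses : Cmd :=
  forTo .i (var .n) (put .cls (var .i) (var .i) ;;
    when (lt (get .del (var .i)) 1) (put .slot (var .i) (var .xc)))

/-- Compares the deleted neighbours of the ends of the current edge. -/
def compareEnds : Cmd :=
  forTo .j (var .xc) (when (lt (eq (adjEntry (var .u) (get .xs (var .j)))
      (adjEntry (var .v) (get .xs (var .j)))) 1) (set .diff 1))

/-- The least member of each twin class. -/
def classes : Cmd :=
  forTo .e (var .m) ((loadEdge ;; set .diff (lt bothKept 1)) ;; compareEnds ;;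
    when (lt (var .diff) 1) (lower .cls (var .u) (var .v) ;; lower .cls (var .v) (var .u)))

/-- Numbers the twin classes in each clique. -/
def slots : Cmd :=
  forTo .e (var .m) (loadEdge ;; when bothKept
    (when (eq (var .u) (get .cls (var .u)) * lt (var .u) (get .cls (var .v)))
        (put .slot (var .v) (get .slot (var .v) + 1)) ;;
      when (eq (var .v) (get .cls (var .v)) * lt (var .v) (get .cls (var .u)))
        (put .slot (var .u) (get .slot (var .u) + 1))))

/-- The number of slots. -/
def maxSlot : Cmd :=
  set .hi (var .xc) ;;
  forTo .i (var .n) (when (lt (var .hi) (get .slot (var .i) + 1))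
    (set .hi (get .slot (var .i) + 1)))

/-- The distance bound after which nothing changes. -/
def distBound : Exp := var .xc * (op .sub (var .hi) (var .xc) + 1)

/-- The next digit sequence in the slots from `lo` to `hi`; `go` becomes `0` after the last one. -/
def next (lo hi : Exp) (go : Var) : Cmd :=
  set .carry 1 ;;
  forTo .j hi (when (var .carry * lt lo (var .j + 1))
    (ite (lt (get .dig (var .j)) (var .l))
      (put .dig (var .j) (get .dig (var .j) + 1) ;; set .carry 0) (put .dig (var .j) 0))) ;;
  set go (lt (var .carry) 1)

/-- The cost of the current labels in each clique. -/
def costs : Cmd :=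
  forTo .e (var .m) (loadEdge ;;
    set .fu (get .dig (get .slot (var .u))) ;; set .fv (get .dig (get .slot (var .v))) ;;
    ite (get .del (var .u)) (set .fw (get .rep (var .v))) (set .fw (get .rep (var .u))) ;;
    when (lt (var .fu + 1) (var .fv) + lt (var .fv + 1) (var .fu))
      (put .cost (var .fw) (get .cost (var .fw) + 1)))

/-- The best costs of the cliques for fixed labels of the deleted vertices. -/
def inner : Cmd :=
  forTo .i (var .n) (put .best (var .i) (var .m)) ;;
  set .goInner 1 ;;
  loop (var .goInner)
    (forTo .i (var .n) (put .cost (var .i) 0) ;; costs ;;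
      forTo .i (var .n) (lower .best (var .i) (get .cost (var .i))) ;;
      next (var .xc) (var .hi) .goInner)

/-- Tries all labels of the deleted vertices. -/
def outer : Cmd :=
  (set .ans 0 ;; set .goOuter 1) ;;
  loop (var .goOuter)
    (inner ;; set .sum 0 ;;
      forTo .i (var .n) (set .sum (var .sum + get .best (var .i))) ;;
      when (lt (var .sum) (var .k + 1) * eq (get .dig (get .slot (var .s))) 0 *
        eq (get .dig (get .slot (var .t))) (var .l)) (set .ans 1) ;;
      next 0 (var .xc) .goOuter)

/-- The algorithm, after the initialization of the machine. -/
def main : Cmd :=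
  (read .n 0 ;; read .m 1 ;; read .s (1 + 1) ;; read .t (1 + 1 + 1) ;; read .k (1 + 1 + 1 + 1) ;;
    read .l (1 + 1 + 1 + 1 + 1)) ;;
  readEdges ;; packing ;; numberDeleted ;; initClasses ;; classes ;; slots ;; maxSlot ;;
  when (lt distBound (var .l)) (set .l distBound) ;; outer

end Cmd

/-! ## Correctness of the program -/

/-- The bound for the contents of registers and memory cells leaves enough room. -/
structure Room (mc : Machine) (E : EdgeList) : Prop where
  lin : 4 * (E.n + E.m + 4) ≤ mc.M
  mul : E.n * E.m ≤ mc.M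

/-- The state holds the graph and the other parts of the input, except for the distance. -/
structure Base (E : EdgeList) (s t k : ℕ) (h : St) : Prop where
  n : h.v .n = E.n
  m : h.v .m = E.m
  s : h.v .s = s
  t : h.v .t = t
  k : h.v .k = k
  fst : ∀ i < E.m, h.a .fst i = E.fst i
  snd : ∀ i < E.m, h.a .snd i = E.snd i
  adj : ∀ u < E.n, ∀ v < E.n, h.a .adj (u * E.n + v) = if E.Adj u v then 1 else 0

theorem Base.of_frame {E : EdgeList} {s t k : ℕ} {h h' : St} (hB : Base E s t k h) {R : List Var}
    {A : List Arr} (hF : Frame R A h h') (hR : ∀ x ∈ [Var.n, .m, .s, .t, .k], x ∉ R)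
    (hA : ∀ r ∈ [Arr.fst, .snd, .adj], r ∉ A) : Base E s t k h' := by
  simp only [List.mem_cons, List.not_mem_nil, or_false, forall_eq_or_imp, forall_eq] at hR hA
  obtain ⟨h1, h2, h3, h4, h5⟩ := hR
  obtain ⟨h6, h7, h8⟩ := hA
  refine ⟨?_, ?_, ?_, ?_, ?_, ?_, ?_, ?_⟩
  · rw [hF.v _ h1, hB.n]
  · rw [hF.v _ h2, hB.m]
  · rw [hF.v _ h3, hB.s]
  · rw [hF.v _ h4, hB.t]
  · rw [hF.v _ h5, hB.k]
  · rw [hF.a _ h6]; exact hB.fst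
  · rw [hF.a _ h7]; exact hB.snd
  · rw [hF.a _ h8]; exact hB.adj

/-- Row-major addressing of the adjacency matrix. -/
theorem index_inj {n u v u' v' : ℕ} (hv : v < n) (hv' : v' < n) :
    u * n + v = u' * n + v' ↔ u = u' ∧ v = v' := by
  constructor
  · intro h
    have h1 : (u * n + v) / n = u := by
      rw [Nat.div_eq_iff (by omega)]
      omega
    have h2 : (u' * n + v') / n = u' := by
      rw [Nat.div_eq_iff (by omega)]
      omega
    have h3 : u = u' := by rw [← h1, ← h2, h]
    subst h3
    exact ⟨rfl, by omega⟩
  · rintro ⟨rfl, rfl⟩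
    rfl

section

variable {mc : Machine} {E : EdgeList} {s t k : ℕ} {h : St}

/-- The quadratic matrix is available in time linear in `m`, because the memory is zero at the start
and only the two entries of each edge are written. -/
theorem Cmd.readEdges_spec (room : Room mc E) (hn : h.v .n = E.n) (hm : h.v .m = E.m)
    (h0 : ∀ i, h.a .adj i = 0)
    (hinp : ∀ i < E.m, 7 + 2 * i < mc.D ∧ mc.inp (6 + 2 * i) = E.fst i ∧
      mc.inp (7 + 2 * i) = E.snd i) :
    Tri mc readEdges h (E.m * (3 * pieceSize) + 2 * pieceSize) fun h' =>
      Frame [.e, .u, .v] [.fst, .snd, .adj] h h' ∧ (∀ i < E.m, h'.a .fst i = E.fst i) ∧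
      (∀ i < E.m, h'.a .snd i = E.snd i) ∧
      ∀ u < E.n, ∀ v < E.n, h'.a .adj (u * E.n + v) = if E.Adj u v then 1 else 0 := by
  have lin := room.lin
  refine (Tri.forTo (T := pieceSize) (by decide) (fun j h' => h'.v .e = j ∧
    Frame [.e, .u, .v] [.fst, .snd, .adj] h h' ∧ (∀ i < j, h'.a .fst i = E.fst i) ∧
      (∀ i < j, h'.a .snd i = E.snd i) ∧
      ∀ u < E.n, ∀ v < E.n, h'.a .adj (u * E.n + v) = if E.AdjUpTo j u v then 1 else 0) E.m
    (by omega) ?_ ?_ ?_ ?_).mono (by unfold pieceSize; omega) fun _ h => h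
  · simp [h0, EdgeList.adjUpTo_zero, (Frame.refl _ _ h).set]
  · rintro j h' ⟨h1, h2, -⟩
    simp [h1, h2.v .m, hm]
  · rintro j hj h' ⟨h1, h2, h3, h4, h5⟩
    obtain ⟨i1, i2, i3⟩ := hinp j hj
    have hf := E.fst_lt j hj
    have hs := E.snd_lt j hj
    have hn' : h'.v .n = E.n := by rw [h2.v .n (by decide), hn]
    refine Tri.of_wp (by decide) ?_
    simp only [two_mul] at i1 i2 i3
    simp [wp, h1, i2, i3, hn']
    refine ⟨⟨by omega, by omega⟩, ⟨by omega, by omega⟩, by omega, by omega, by omega,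
      ?_, ?_, ?_, ?_⟩
    · simp (maxDischargeDepth := 20) [h2]
    · grind
    · grind
    · intro u hu v hv
      simp only [index_inj hv hf, index_inj hv hs, h5 u hu v hv]
      rw [ if_congr EdgeList.adjUpTo_succ rfl rfl]
      grind
  · rintro h' ⟨_, h2, h3, h4, h5⟩
    exact ⟨h2, h3, h4, h5⟩

end

end MVE

namespace MVE

/-! ### Recognising cluster graphs by degrees and least closed neighbours -/

namespace EdgeList

variable (E : EdgeList) (X : Finset ℕ)

/-- Adjacency in the graph without `X`. -/
def KeptAdj (u v : ℕ) : Prop := u ∉ X ∧ v ∉ X ∧ E.Adj u v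

/-- The degree in the graph without `X`, as far as the first `j` edges are concerned. -/
def degUpTo (j x : ℕ) : ℕ := ∑ i ∈ Finset.range j,
  if E.fst i ∉ X ∧ E.snd i ∉ X then
    (if E.fst i = x then 1 else 0) + (if E.snd i = x then 1 else 0) else 0

/-- After the first `j` edges, `f v` is the least vertex among `v` and its `R`-neighbours. -/
structure Least (R : ℕ → ℕ → Prop) (j : ℕ) (f : ℕ → ℕ) : Prop where
  le : ∀ v < E.n, f v ≤ v
  mem : ∀ v < E.n, f v = v ∨ R v (f v)
  fst_le : ∀ i < j, R (E.fst i) (E.snd i) → f (E.fst i) ≤ E.snd i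
  snd_le : ∀ i < j, R (E.fst i) (E.snd i) → f (E.snd i) ≤ E.fst i

variable {E X} {R : ℕ → ℕ → Prop} {j : ℕ} {f g : ℕ → ℕ}

theorem KeptAdj.symm {u v : ℕ} (h : E.KeptAdj X u v) : E.KeptAdj X v u := ⟨h.2.1, h.1, h.2.2.symm⟩

theorem Least.zero (h : ∀ v < E.n, f v = v) : E.Least R 0 f :=
  ⟨fun v hv => (h v hv).le, fun v hv => .inl (h v hv), fun _ hi => by omega,
    fun _ hi => by omega⟩

theorem Least.skip (h : E.Least R j f) (hR : ¬ R (E.fst j) (E.snd j)) : E.Least R (j + 1) f := by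
  refine ⟨h.le, h.mem, fun i hi => ?_, fun i hi => ?_⟩ <;>
    rcases Nat.lt_succ_iff_lt_or_eq.1 hi with hi | rfl
  · exact h.fst_le i hi
  · exact fun h => (hR h).elim
  · exact h.snd_le i hi
  · exact fun h => (hR h).elim

/-- `g` is the outcome of lowering the entries at both ends of edge `j`; the two updates do not
interfere, as the ends differ. -/
theorem Least.step (h : E.Least R j f) (hs : ∀ u v, R u v → R v u) (hj : j < E.m)
    (hR : R (E.fst j) (E.snd j))
    (hg : ∀ v, g v = if v = E.fst j then min (f v) (E.snd j) else
      if v = E.snd j then min (f v) (E.fst j) else f v) : E.Least R (j + 1) g := by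
  have hne := E.ne j hj
  have h1 := E.fst_lt j hj
  have h2 := E.snd_lt j hj
  have hgf : ∀ v, g v ≤ f v := by
    intro v
    rw [hg]
    split_ifs <;> simp
  refine ⟨fun v hv => (hgf v).trans (h.le v hv), fun v hv => ?_, fun i hi => ?_, fun i hi => ?_⟩
  · have := h.mem v hv
    rw [hg]
    split_ifs with e1 e2
    · subst e1
      rcases min_choice (f (E.fst j)) (E.snd j) with e | e <;> rw [e]
      · exact this
      · exact .inr hR
    · subst e2
      rcases min_choice (f (E.snd j)) (E.fst j) with e | e <;> rw [e]
      · exact this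
      · exact .inr (hs _ _ hR)
    · exact this
  · rcases Nat.lt_succ_iff_lt_or_eq.1 hi with hi | rfl
    · exact fun h' => (hgf _).trans (h.fst_le i hi h')
    · intro _
      rw [hg, if_pos rfl]
      exact min_le_right _ _
  · rcases Nat.lt_succ_iff_lt_or_eq.1 hi with hi | rfl
    · exact fun h' => (hgf _).trans (h.snd_le i hi h')
    · intro _
      rw [hg, if_neg hne.symm, if_pos rfl]
      exact min_le_right _ _

theorem Least.le_of_rel (h : E.Least R E.m f) (hs : ∀ u v, R u v → R v u) {v w : ℕ}
    (hadj : E.Adj v w) (hvw : R v w) : f v ≤ w := by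
  obtain ⟨i, hi, ⟨rfl, rfl⟩ | ⟨rfl, rfl⟩⟩ := hadj
  · exact h.fst_le i hi hvw
  · exact h.snd_le i hi (hs _ _ hvw)

theorem Least.lt (h : E.Least R j f) {v : ℕ} (hv : v < E.n) : f v < E.n :=
  (h.le v hv).trans_lt hv

/-- The neighbours in the graph without `X`. -/
def keptNeighbors (E : EdgeList) (X : Finset ℕ) (x : ℕ) : Finset ℕ :=
  (Finset.range E.n).filter fun w => E.Adj x w ∧ w ∉ X

/-- The count over the edge list becomes a count over vertices by `sum_edges`, applied to the
indicator of kept pairs starting at `x`. -/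
theorem degUpTo_eq {x : ℕ} (hx : x ∉ X) :
    E.degUpTo X E.m x = (E.keptNeighbors X x).card := by
  have h1 := E.sum_edges fun u v => if u ∉ X ∧ v ∉ X ∧ u = x then 1 else 0
  have h2 : E.degUpTo X E.m x = ∑ i ∈ Finset.range E.m,
      ((if E.fst i ∉ X ∧ E.snd i ∉ X ∧ E.fst i = x then 1 else 0) +
        (if E.snd i ∉ X ∧ E.fst i ∉ X ∧ E.snd i = x then 1 else 0)) := by
    refine Finset.sum_congr rfl fun i _ => ?_
    split_ifs <;> grind
  rw [h2, h1, keptNeighbors, Finset.card_filter]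
  by_cases hxn : x < E.n
  · rw [Finset.sum_eq_single x]
    · refine Finset.sum_congr rfl fun v _ => ?_
      grind
    · intro u _ hu
      refine Finset.sum_eq_zero fun v _ => ?_
      grind
    · intro h
      simp at h
      omega
  · have hno : ∀ w, ¬ E.Adj x w := fun w hw => hxn hw.lt_left
    rw [Finset.sum_eq_zero, Finset.sum_eq_zero]
    · intro u _
      grind
    · intro u hu
      refine Finset.sum_eq_zero fun v _ => ?_
      grind

theorem degUpTo_le (j x : ℕ) : E.degUpTo X j x ≤ 2 * j := by
  calc _ ≤ ∑ i ∈ Finset.range j, 2 := Finset.sum_le_sum fun i _ => by split_ifs <;> omega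
    _ = 2 * j := by simp [mul_comm]

/-- Equal degrees and equal least closed neighbours at the ends of all edges characterize cluster
graphs. -/
theorem isCluster_of_agree {rep : ℕ → ℕ} (hrep : E.Least (E.KeptAdj X) E.m rep)
    (h : ∀ u v, E.KeptAdj X u v → E.degUpTo X E.m u = E.degUpTo X E.m v ∧ rep u = rep v) :
    E.IsCluster X := by
  -- Every `y` in the closed neighbourhood of `x` has the same least closed neighbour `rep x`, so it
  -- lies in the closed neighbourhood of `rep x`. Equal degrees turn this inclusion into an
  -- equality. Adjacent vertices share `rep`, hence also their closed neighbourhoods.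
  have hclosed : ∀ x < E.n, x ∉ X →
      insert x (E.keptNeighbors X x) = insert (rep x) (E.keptNeighbors X (rep x)) := by
    intro x hx hxX
    have hr : rep x = x ∨ E.KeptAdj X x (rep x) := hrep.mem x hx
    have hrX : rep x ∉ X := by
      rcases hr with hr | hr
      · rwa [hr]
      · exact hr.2.1
    have hsub : insert x (E.keptNeighbors X x) ⊆ insert (rep x) (E.keptNeighbors X (rep x)) := by
      intro y hy
      have hy : y = x ∨ E.KeptAdj X x y := by
        simp only [keptNeighbors, Finset.mem_insert, Finset.mem_filter] at hy
        exact hy.imp id fun h => ⟨hxX, h.2.2, h.2.1⟩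
      have hyn : y < E.n := by
        rcases hy with rfl | hy
        · exact hx
        · exact hy.2.2.lt_right
      have hrep' : rep y = rep x := by
        rcases hy with rfl | hy
        · rfl
        · exact (h _ _ hy).2.symm
      have := hrep.mem y hyn
      rw [hrep'] at this
      simp only [keptNeighbors, Finset.mem_insert, Finset.mem_filter, Finset.mem_range]
      rcases this with h1 | h1
      · exact .inl h1.symm
      · exact .inr ⟨hyn, h1.2.2.symm, h1.1⟩
    refine Finset.eq_of_subset_of_card_le hsub ?_
    rw [Finset.card_insert_of_notMem, Finset.card_insert_of_notMem, ← degUpTo_eq hxX,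
      ← degUpTo_eq hrX]
    · rcases hr with hr | hr
      · rw [hr]
      · rw [(h _ _ hr).1]
    · exact fun h => (Finset.mem_filter.1 h).2.1.ne rfl
    · exact fun h => (Finset.mem_filter.1 h).2.1.ne rfl
  intro u v w hu hv hw huv hvw huw
  have h1 := hclosed u huv.lt_left hu
  have h2 := hclosed v huv.lt_right hv
  rw [← (h u v ⟨hu, hv, huv⟩).2, ← h1] at h2
  have : w ∈ insert v (E.keptNeighbors X v) := by
    simp [keptNeighbors, hvw, hw, hvw.lt_right]
  rw [h2] at this
  simp only [keptNeighbors, Finset.mem_insert, Finset.mem_filter] at this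
  grind

/-- `u`, `v`, `w` induce a path with an end at `w`. -/
structure Third (E : EdgeList) (X : Finset ℕ) (u v w : ℕ) : Prop where
  notMem : w ∉ X
  ne_left : w ≠ u
  ne_right : w ≠ v
  adj : ¬ (E.Adj u w ↔ E.Adj v w)

theorem Third.lt {u v w : ℕ} (h : E.Third X u v w) : w < E.n := by
  by_contra hw
  have : ∀ x, ¬ E.Adj x w := fun x hx => hw hx.lt_right
  have := h.adj
  grind

/-- If no third vertex distinguished the adjacent vertices `u` and `v`, their closed neighbourhoods
would be equal, and with them the degrees and the least members. -/
theorem exists_third {rep : ℕ → ℕ} (hrep : E.Least (E.KeptAdj X) E.m rep) {u v : ℕ}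
    (huv : E.KeptAdj X u v)
    (h : ¬ (E.degUpTo X E.m u = E.degUpTo X E.m v ∧ rep u = rep v)) :
    ∃ w, E.Third X u v w := by
  by_contra hcon
  have hw : ∀ w, w ∉ X → w ≠ u → w ≠ v → (E.Adj u w ↔ E.Adj v w) := by
    intro w h1 h2 h3
    by_contra h4
    exact hcon ⟨w, h1, h2, h3, h4⟩
  refine h ⟨?_, ?_⟩
  · rw [degUpTo_eq huv.1, degUpTo_eq huv.2.1]
    have hv : v ∈ E.keptNeighbors X u := by
      simp [keptNeighbors, huv.2.1, huv.2.2, huv.2.2.lt_right]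
    have hu : u ∈ E.keptNeighbors X v := by
      simp [keptNeighbors, huv.1, huv.2.2.symm, huv.2.2.lt_left]
    have : (E.keptNeighbors X u).erase v = (E.keptNeighbors X v).erase u := by
      ext w
      have h1 : ∀ x, ¬ E.Adj x x := fun x hx => hx.ne rfl
      have := hw w
      simp only [keptNeighbors, Finset.mem_erase, Finset.mem_filter]
      grind
    rw [← Finset.card_erase_add_one hv, ← Finset.card_erase_add_one hu, this]
  -- By symmetry one inequality suffices: the least closed neighbour of `v` is also a closed
  -- neighbour of `u`.
  · have key : ∀ u v, E.KeptAdj X u v →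
        (∀ w, w ∉ X → w ≠ u → w ≠ v → (E.Adj u w ↔ E.Adj v w)) → rep u ≤ rep v := by
      intro u v huv hw
      rcases hrep.mem v huv.2.2.lt_right with hv | hv
      · rw [hv]
        exact hrep.le_of_rel (fun _ _ => KeptAdj.symm) huv.2.2 huv
      · by_cases hu : rep v = u
        · rw [hu]
          exact hrep.le u huv.2.2.lt_left
        · have := (hw (rep v) hv.2.1 hu hv.2.2.ne.symm).2 hv.2.2
          exact hrep.le_of_rel (fun _ _ => KeptAdj.symm) this ⟨huv.1, hv.2.1, this⟩
    exact le_antisymm (key u v huv hw)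
      (key v u huv.symm fun w h1 h2 h3 => (hw w h1 h3 h2).symm)

/-- Every cluster vertex deletion set contains a vertex of an induced path. -/
theorem Third.exists_mem {Y : Finset ℕ} (hY : E.IsCluster Y) {u v w : ℕ} (huv : E.Adj u v)
    (h : E.Third X u v w) : u ∈ Y ∨ v ∈ Y ∨ w ∈ Y := by
  by_contra! hcon
  obtain ⟨hu, hv, hw⟩ := hcon
  refine h.adj ⟨fun h1 => ?_, fun h1 => ?_⟩
  · exact hY v u w hv hu hw huv.symm h1 h.ne_right.symm
  · exact hY u v w hu hv hw huv h1 h.ne_left.symm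

end EdgeList

/-! ### Greedy packing of induced paths on three vertices -/

/-- The state holds the set `X` of deleted vertices. -/
structure IsDel (E : EdgeList) (X : Finset ℕ) (h : St) : Prop where
  sub : X ⊆ Finset.range E.n
  eq : ∀ v < E.n, h.a .del v = if v ∈ X then 1 else 0

section

variable {mc : Machine} {E : EdgeList} {s t k : ℕ} {h : St} {X : Finset ℕ}

theorem IsDel.of_frame {h' : St} (hX : IsDel E X h) {R : List Var}
    {A : List Arr} (hF : Frame R A h h') (hA : Arr.del ∉ A) : IsDel E X h' :=
  ⟨hX.sub, by rw [hF.a _ hA]; exact hX.eq⟩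

theorem IsDel.eq_zero_iff (hX : IsDel E X h) {v : ℕ} (hv : v < E.n) : h.a .del v = 0 ↔ v ∉ X := by
  rw [hX.eq v hv]
  split <;> simp_all

namespace Cmd

theorem initDegrees_spec (room : Room mc E) (hB : Base E s t k h) :
    Tri mc initDegrees h (E.n * (3 * pieceSize) + 2 * pieceSize) fun h' =>
      Frame [.i] [.deg, .rep] h h' ∧ ∀ v < E.n, h'.a .deg v = 0 ∧ h'.a .rep v = v := by
  have lin := room.lin
  refine (Tri.forTo (T := pieceSize) (by decide) (fun j h' => h'.v .i = j ∧
    Frame [.i] [.deg, .rep] h h' ∧ ∀ v < j, h'.a .deg v = 0 ∧ h'.a .rep v = v) E.n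
    (by omega) ?_ ?_ ?_ ?_).mono (by unfold pieceSize; omega) fun _ h => h
  · simp
  · rintro j h' ⟨h1, h2, -⟩
    simp [h1, h2.v .n, hB.n]
  · rintro j hj h' ⟨h1, h2, h3⟩
    refine Tri.of_wp (by decide) ?_
    simp [wp, h1]
    refine ⟨by omega, ?_, ?_⟩
    · simp (maxDischargeDepth := 20) [h2]
    · grind
  · rintro h' ⟨_, h2, h3⟩
    exact ⟨h2, h3⟩

theorem degrees_spec (room : Room mc E) (hB : Base E s t k h) (hX : IsDel E X h)
    (h0 : ∀ v < E.n, h.a .deg v = 0 ∧ h.a .rep v = v) :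
    Tri mc degrees h (E.m * (3 * pieceSize) + 2 * pieceSize) fun h' =>
      Frame [.e, .u, .v] [.deg, .rep] h h' ∧
      (∀ v < E.n, h'.a .deg v = E.degUpTo X E.m v) ∧
      E.Least (E.KeptAdj X) E.m (h'.a .rep) := by
  have lin := room.lin
  refine (Tri.forTo (T := pieceSize) (by decide) (fun j h' => h'.v .e = j ∧
    Frame [.e, .u, .v] [.deg, .rep] h h' ∧
      (∀ v < E.n, h'.a .deg v = E.degUpTo X j v) ∧
      E.Least (E.KeptAdj X) j (h'.a .rep)) E.m
    (by omega) ?_ ?_ ?_ ?_).mono (by unfold pieceSize; omega) fun _ h => h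
  · refine ⟨by simp, by simp, ?_, .zero fun v hv => by simp [h0 v hv]⟩
    intro v hv
    simp [h0 v hv, EdgeList.degUpTo]
  · rintro j h' ⟨h1, h2, -⟩
    simp [h1, h2.v .m, hB.m]
  · rintro j hj h' ⟨h1, h2, h3, h4⟩
    have hf := E.fst_lt j hj
    have hs := E.snd_lt j hj
    have hne := E.ne j hj
    have hB' := hB.of_frame h2 (by decide) (by decide)
    have hX' := hX.of_frame h2 (by decide)
    have hdf := E.degUpTo_le (X := X) j (E.fst j)
    have hds := E.degUpTo_le (X := X) j (E.snd j)
    have hadj := EdgeList.adj_edge hj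
    have hdeg : ∀ x, E.degUpTo X (j + 1) x = E.degUpTo X j x +
      if E.fst j ∉ X ∧ E.snd j ∉ X then
        (if E.fst j = x then 1 else 0) + (if E.snd j = x then 1 else 0) else 0 :=
      fun x => Finset.sum_range_succ _ _
    refine Tri.of_wp (by decide) ?_
    simp [wp, loadEdge, Cmd.when, bothKept, h1, hB'.fst j hj, hB'.snd j hj, h3 _ hf, h3 _ hs,
      hX'.eq_zero_iff hf, hX'.eq_zero_iff hs]
    refine ⟨by omega, by omega, fun hfX hsX => ?_, fun hX => ?_⟩
    · simp [hne.symm]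
      refine ⟨by omega, by omega, by omega, by omega, ?_, ?_, ?_⟩
      · simp (maxDischargeDepth := 20) [h2]
      · intro v hv
        have := h3 v hv
        rw [hdeg]
        simp only [hfX, hsX, not_false_eq_true, and_self, if_true]
        grind
      · refine h4.step (fun _ _ => EdgeList.KeptAdj.symm) hj ⟨hfX, hsX, hadj⟩ fun v => ?_
        simp
        grind
    · refine ⟨by simp (maxDischargeDepth := 20) [h2], ?_, h4.skip fun h => h.2.1 (hX h.1)⟩
      intro v hv
      rw [hdeg, if_neg fun h => h.2 (hX h.1), h3 v hv, add_zero]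
  · rintro h' ⟨_, h2, h3⟩
    exact ⟨h2, h3⟩

/-- The scan does not stop at a hit; a later disagreeing edge overwrites an earlier one, and any of
them will do. -/
theorem findEdge_spec (room : Room mc E) (hB : Base E s t k h) (hX : IsDel E X h)
    (h0 : h.v .found = 0) :
    Tri mc findEdge h (E.m * (3 * pieceSize) + 2 * pieceSize) fun h' =>
      Frame [.e, .u, .v, .found, .fu, .fv] [] h h' ∧
      ((h'.v .found = 0 ∧ ∀ i < E.m, E.fst i ∉ X → E.snd i ∉ X →
          h.a .deg (E.fst i) = h.a .deg (E.snd i) ∧ h.a .rep (E.fst i) = h.a .rep (E.snd i)) ∨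
        (h'.v .found = 1 ∧ E.KeptAdj X (h'.v .fu) (h'.v .fv) ∧
          ¬ (h.a .deg (h'.v .fu) = h.a .deg (h'.v .fv) ∧
            h.a .rep (h'.v .fu) = h.a .rep (h'.v .fv)))) := by
  have lin := room.lin
  refine (Tri.forTo (T := pieceSize) (by decide) (fun j h' => h'.v .e = j ∧
    Frame [.e, .u, .v, .found, .fu, .fv] [] h h' ∧
      ((h'.v .found = 0 ∧ ∀ i < j, E.fst i ∉ X → E.snd i ∉ X →
          h.a .deg (E.fst i) = h.a .deg (E.snd i) ∧ h.a .rep (E.fst i) = h.a .rep (E.snd i)) ∨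
        (h'.v .found = 1 ∧ E.KeptAdj X (h'.v .fu) (h'.v .fv) ∧
          ¬ (h.a .deg (h'.v .fu) = h.a .deg (h'.v .fv) ∧
            h.a .rep (h'.v .fu) = h.a .rep (h'.v .fv))))) E.m
    (by omega) ?_ ?_ ?_ ?_).mono (by unfold pieceSize; omega) fun _ h => h
  · simp [h0]
  · rintro j h' ⟨h1, h2, -⟩
    simp [h1, h2.v .m, hB.m]
  · rintro j hj h' ⟨h1, h2, h3⟩
    have hf := E.fst_lt j hj
    have hs := E.snd_lt j hj
    have hB' := hB.of_frame h2 (by decide) (by decide)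
    have hX' := hX.of_frame h2 (by decide)
    have hadj := EdgeList.adj_edge hj
    refine Tri.of_wp (by decide) ?_
    simp [wp, loadEdge, Cmd.when, bothKept, h1, hB'.fst j hj, hB'.snd j hj,
      hX'.eq_zero_iff hf, hX'.eq_zero_iff hs, h2.a .deg, h2.a .rep]
    refine ⟨by omega, by omega, fun hfX hsX => ⟨fun hdis => ?_, fun hagr => ?_⟩, fun hX => ?_⟩
    · refine ⟨by omega, by omega, by omega, by simp (maxDischargeDepth := 20) [h2],
        ⟨hfX, hsX, hadj⟩, ?_⟩
      grind
    · refine ⟨by simp (maxDischargeDepth := 20) [h2], ?_⟩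
      have : ∀ i, i < j + 1 ↔ i < j ∨ i = j := by intro i; omega
      grind
    · refine ⟨by simp (maxDischargeDepth := 20) [h2], ?_⟩
      have : ∀ i, i < j + 1 ↔ i < j ∨ i = j := by intro i; omega
      grind
  · rintro h' ⟨_, h2, h3⟩
    simpa using And.intro h2 h3

/-- Given an edge, one pass over two rows of the matrix finds the third vertex in time linear in
`n`; the last candidate wins. -/
theorem findThird_spec (room : Room mc E) (hB : Base E s t k h) (hX : IsDel E X h) {u v : ℕ}
    (hu : h.v .fu = u) (hv : h.v .fv = v) (hun : u < E.n) (hvn : v < E.n)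
    (hex : ∃ w, E.Third X u v w) :
    Tri mc findThird h (E.n * (3 * pieceSize) + 2 * pieceSize) fun h' =>
      Frame [.i, .fw] [] h h' ∧ E.Third X u v (h'.v .fw) := by
  have lin := room.lin
  refine (Tri.forTo (T := pieceSize) (by decide) (fun j h' => h'.v .i = j ∧
    Frame [.i, .fw] [] h h' ∧ ∀ w < j, E.Third X u v w → E.Third X u v (h'.v .fw)) E.n
    (by omega) ?_ ?_ ?_ ?_).mono (by unfold pieceSize; omega) fun _ h => h
  · simp
  · rintro j h' ⟨h1, h2, -⟩
    simp [h1, h2.v .n, hB.n]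
  · rintro j hj h' ⟨h1, h2, h3⟩
    have hB' := hB.of_frame h2 (by decide) (by decide)
    have hX' := hX.of_frame h2 (by decide)
    refine Tri.of_wp (by decide) ?_
    simp [wp, Cmd.when, adjEntry, h1, hX'.eq_zero_iff hj, h2.v .fu, h2.v .fv, hu, hv, hB'.n,
      hB'.adj u hun j hj, hB'.adj v hvn j hj]
    refine ⟨fun a1 a2 a3 a4 => ⟨by omega, by simp (maxDischargeDepth := 20) [h2], ?_⟩,
      fun a1 => ⟨by simp (maxDischargeDepth := 20) [h2], ?_⟩⟩
    · intro w _ _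
      exact ⟨a3, a1, a2, by grind⟩
    · intro w hw hT
      rcases hw.lt_or_eq with hw | rfl
      · exact h3 w hw hT
      · have := hT.adj
        have := a1 hT.ne_left hT.ne_right hT.notMem
        grind
  · rintro h' ⟨_, h2, h3⟩
    obtain ⟨w, hw⟩ := hex
    exact ⟨h2, h3 w hw.lt hw⟩

/-- The deleted vertices, compared with a cluster vertex deletion set `Y`. -/
structure IsPacking (E : EdgeList) (s t : ℕ) (Y : Finset ℕ) (r : ℕ) (X : Finset ℕ) : Prop where
  s_mem : s ∈ X
  t_mem : t ∈ X
  card_le : X.card ≤ 3 * r + 2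
  le_card : r ≤ (Y ∩ X).card

/-- `Y` contains one of the three vertices, and none of them was in `X`. So the part of `Y` inside
`X` grows strictly, while `X` grows by at most three. -/
theorem IsPacking.add_path {Y : Finset ℕ} {r u v w : ℕ} (hP : IsPacking E s t Y r X)
    (hY : E.IsCluster Y) (huv : E.KeptAdj X u v) (hw : E.Third X u v w) :
    IsPacking E s t Y (r + 1) (insert w (insert v (insert u X))) := by
  refine ⟨by simp [hP.s_mem], by simp [hP.t_mem], ?_, ?_⟩
  · have h1 := Finset.card_insert_le w (insert v (insert u X))
    have h2 := Finset.card_insert_le v (insert u X)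
    have h3 := Finset.card_insert_le u X
    have h4 := hP.card_le
    omega
  · refine hP.le_card.trans_lt (Finset.card_lt_card ?_)
    rw [Finset.ssubset_iff_of_subset
      (Finset.inter_subset_inter_left (fun x hx => by simp [hx]))]
    rcases hw.exists_mem hY huv.2.2 with h | h | h
    · exact ⟨u, by simp [h], by simp [huv.1]⟩
    · exact ⟨v, by simp [h], by simp [huv.2.1]⟩
    · exact ⟨w, by simp [h], by simp [hw.notMem]⟩

/-- Every round but the last one puts a further element of `Y` into `X`, which bounds the number of
rounds by `|Y| + 1` and the size of `X` by `3 * |Y| + 2`, where the `2` stands for `s` and `t`. -/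
theorem packing_spec (room : Room mc E) (hB : Base E s t k h) (hs : s < E.n) (ht : t < E.n)
    (h0 : ∀ v, h.a .del v = 0) {Y : Finset ℕ} (hY : E.IsCluster Y) :
    Tri mc packing h ((Y.card + 1) * (10 * (E.n + E.m + 2) * pieceSize) + 2 * pieceSize)
      fun h' => Frame [.i, .e, .u, .v, .found, .fu, .fv, .fw] [.del, .deg, .rep] h h' ∧
        ∃ X, IsDel E X h' ∧ s ∈ X ∧ t ∈ X ∧ X.card ≤ 3 * Y.card + 2 ∧ E.IsCluster X ∧
          E.Least (E.KeptAdj X) E.m (h'.a .rep) := by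
  have lin := room.lin
  have hstart : Tri mc (put .del (.var .s) 1 ;; put .del (.var .t) 1 ;; set .found 1) h pieceSize
      fun h' => h'.v .found = 1 ∧
        Frame [.i, .e, .u, .v, .found, .fu, .fv, .fw] [.del, .deg, .rep] h h' ∧
        ∃ X, IsDel E X h' ∧ IsPacking E s t Y 0 X := by
    refine Tri.of_wp (by decide) ?_
    simp [wp, hB.s, hB.t]
    refine ⟨by omega, by simp (maxDischargeDepth := 20), {s, t}, ⟨?_, ?_⟩,
      ⟨by simp, by simp, Finset.card_le_two, by simp⟩⟩
    · intro x hx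
      simp at hx ⊢
      omega
    · intro v hv
      simp [h0]
      grind
  refine (hstart.seq fun h' hh => Tri.loop (by decide) (T := 9 * (E.n + E.m + 2) * pieceSize)
    (fun j h' => ∃ X r, IsDel E X h' ∧ IsPacking E s t Y r X ∧
      Frame [.i, .e, .u, .v, .found, .fu, .fv, .fw] [.del, .deg, .rep] h h' ∧
      ((h'.v .found = 1 ∧ r = j) ∨ (h'.v .found = 0 ∧ E.IsCluster X ∧
          E.Least (E.KeptAdj X) E.m (h'.a .rep)))) (Y.card + 1) ?_ ?_ ?_ ?_).mono
    ?_ fun _ h => h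
  · obtain ⟨h1, h2, X, h3, h4⟩ := hh
    exact ⟨X, 0, h3, h4, h2, .inl ⟨h1, rfl⟩⟩
  -- While the loop is running, `r = j` paths have been packed, and `r` is at most `|Y|`.
  · rintro j h' ⟨X, r, -, hP, -, h1⟩ he
    have h2 := hP.le_card
    have h3 := Finset.card_le_card (Finset.inter_subset_left (s₁ := Y) (s₂ := X))
    simp at he
    omega
  · rintro j h1 ⟨X, r, hX, hP, hF, hc⟩ he
    simp at he
    have hrj : r = j := by omega
    subst hrj
    clear hc he hh
    have s1 : Tri mc (set .found 0) h1 pieceSize fun h' =>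
        Frame [.found] [] h1 h' ∧ h'.v .found = 0 := by
      refine Tri.of_wp (by decide) ?_
      simp [wp]
    refine (s1.seq (T₂ := E.n * (3 * pieceSize) + 2 * pieceSize +
      (E.m * (3 * pieceSize) + 2 * pieceSize + (E.m * (3 * pieceSize) + 2 * pieceSize +
      (E.n * (3 * pieceSize) + 2 * pieceSize + pieceSize + pieceSize))))
      fun h2 hh2 => ?_).mono (by ring_nf; unfold pieceSize; omega) fun _ h => h
    have hB1 := hB.of_frame hF (by decide) (by decide)
    have hB2 := hB1.of_frame hh2.1 (by decide) (by decide)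
    have hX2 := hX.of_frame hh2.1 (by decide)
    refine (initDegrees_spec room hB2).seq fun h3 hh3 => ?_
    have hB3 := hB2.of_frame hh3.1 (by decide) (by decide)
    have hX3 := hX2.of_frame hh3.1 (by decide)
    refine (degrees_spec room hB3 hX3 hh3.2).seq fun h4 hh4 => ?_
    have hB4 := hB3.of_frame hh4.1 (by decide) (by decide)
    have hX4 := hX3.of_frame hh4.1 (by decide)
    have hf4 : h4.v .found = 0 := by
      rw [hh4.1.v _ (by decide), hh3.1.v _ (by decide), hh2.2]
    refine (findEdge_spec room hB4 hX4 hf4).seq fun h5 hh5 => ?_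
    have hB5 := hB4.of_frame hh5.1 (by decide) (by decide)
    have hX5 := hX4.of_frame hh5.1 (by decide)
    obtain ⟨hF4, hdeg, hrep⟩ := hh4
    obtain ⟨hF5, hfind⟩ := hh5
    have hF15 : Frame [.i, .e, .u, .v, .found, .fu, .fv, .fw] [.del, .deg, .rep] h h5 :=
      hF.trans ((hh2.1.mono (by decide) (by decide)).trans
        ((hh3.1.mono (by decide) (by decide)).trans ((hF4.mono (by decide) (by decide)).trans
          (hF5.mono (by decide) (by decide)))))
    have hagr : ∀ u v, E.KeptAdj X u v → (h4.a .deg u = h4.a .deg v ∧ h4.a .rep u = h4.a .rep v ↔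
        E.degUpTo X E.m u = E.degUpTo X E.m v ∧ h4.a .rep u = h4.a .rep v) := by
      intro u v huv
      rw [hdeg u huv.2.2.lt_left, hdeg v huv.2.2.lt_right]
    refine Tri.ite (by decide) (fun he => ?_) fun he => ?_
    · simp only [Exp.eval_var] at he
      obtain ⟨hfd, huv, hne⟩ := hfind.resolve_left fun h => he h.1
      rw [hagr _ _ huv] at hne
      refine (findThird_spec room hB5 hX5 rfl rfl huv.2.2.lt_left huv.2.2.lt_right
        (EdgeList.exists_third hrep huv hne)).seq fun h6 hh6 => ?_
      have hX6 := hX5.of_frame hh6.1 (by decide)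
      have hF6 : Frame [.i, .e, .u, .v, .found, .fu, .fv, .fw] [.del, .deg, .rep] h h6 :=
        hF15.trans (hh6.1.mono (by decide) (by decide))
      refine Tri.of_wp (by decide) ?_
      have hu := hh6.1.v .fu (by decide)
      have hv := hh6.1.v .fv (by decide)
      have hfound := (hh6.1.v .found (by decide)).trans hfd
      simp [wp, hu, hv]
      refine ⟨by omega, _, ⟨?_, ?_⟩, _, hP.add_path hY huv hh6.2, ?_, ?_⟩
      · intro x hx
        have := hX6.sub
        simp only [Finset.mem_insert] at hx
        rcases hx with rfl | rfl | rfl | hx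
        · exact Finset.mem_range.2 hh6.2.lt
        · exact Finset.mem_range.2 huv.2.2.lt_right
        · exact Finset.mem_range.2 huv.2.2.lt_left
        · exact hX6.sub hx
      · intro v hv
        have := hX6.eq v hv
        simp
        grind
      · simp (maxDischargeDepth := 20) [hF6]
      · simp [hfound]
    · simp only [Exp.eval_var] at he
      have hnf := hfind.resolve_right fun h => by omega
      refine (Tri.of_wp (by decide) ?_).mono (T₁ := pieceSize)
        (by unfold pieceSize; omega) fun _ h => h
      refine ⟨X, r, hX5, hP, hF15, .inr ⟨he, ?_, ?_⟩⟩
      · refine EdgeList.isCluster_of_agree hrep fun u v huv => (hagr u v huv).1 ?_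
        obtain ⟨i, hi, ⟨rfl, rfl⟩ | ⟨rfl, rfl⟩⟩ := huv.2.2
        · exact hnf.2 i hi huv.1 huv.2.1
        · exact (hnf.2 i hi huv.2.1 huv.1).imp Eq.symm Eq.symm
      · rw [hF5.a _ (by decide)]
        exact hrep
  · rintro j h' ⟨X, r, hX, hP, hF, hc⟩ he
    simp at he
    have h2 := hP.le_card
    have h3 := Finset.card_le_card (Finset.inter_subset_left (s₁ := Y) (s₂ := X))
    have h4 := hP.card_le
    have hc := hc.resolve_left fun h => by omega
    exact ⟨hF, X, hX, hP.s_mem, hP.t_mem, by omega, hc.2.1, hc.2.2⟩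
  · ring_nf
    unfold pieceSize
    omega

end Cmd

end

end MVE

namespace MVE

/-! ### Twin classes and their numbering inside a clique -/

namespace EdgeList

variable {E : EdgeList} {X : Finset ℕ} {rep cls slot : ℕ → ℕ}

/-- The least closed neighbour of `v` lies in the common clique, so it competes for the minimum at
`u` as well. -/
theorem Least.rep_le (hX : E.IsCluster X) (hrep : E.Least (E.KeptAdj X) E.m rep) {u v : ℕ}
    (hu : u < E.n) (hv : v < E.n) (huX : u ∉ X) (hvX : v ∉ X) (huv : u = v ∨ E.Adj u v) :
    rep u ≤ rep v := by
  have hrv : rep v ∉ X ∧ (v = rep v ∨ E.Adj v (rep v)) := by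
    rcases hrep.mem v hv with h | h
    · rw [h]; exact ⟨hvX, .inl rfl⟩
    · exact ⟨h.2.1, .inr h.2.2⟩
  rcases hX.adj_trans huX hvX hrv.1 huv hrv.2 with h | h
  · rw [← h]
    exact hrep.le u hu
  · exact hrep.le_of_rel (fun _ _ => KeptAdj.symm) h ⟨huX, hrv.1, h⟩

theorem Least.rep_iff (hX : E.IsCluster X) (hrep : E.Least (E.KeptAdj X) E.m rep) :
    ∀ u < E.n, ∀ v < E.n, u ∉ X → v ∉ X → (rep u = rep v ↔ u = v ∨ E.Adj u v) := by
  intro u hu v hv huX hvX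
  have key : ∀ x < E.n, x ∉ X → rep x ∉ X ∧ (x = rep x ∨ E.Adj x (rep x)) := by
    intro x hx hxX
    rcases hrep.mem x hx with h | h
    · rw [h]; exact ⟨hxX, .inl rfl⟩
    · exact ⟨h.2.1, .inr h.2.2⟩
  constructor
  · intro h
    obtain ⟨h1, h2⟩ := key u hu huX
    obtain ⟨_, h3⟩ := key v hv hvX
    rw [← h] at h3
    exact hX.adj_trans huX h1 hvX h2 (h3.imp Eq.symm Adj.symm)
  · intro h
    exact le_antisymm (hrep.rep_le hX hu hv huX hvX h)
      (hrep.rep_le hX hv hu hvX huX (h.imp Eq.symm Adj.symm))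

/-- Distinct twins. -/
def Twin (E : EdgeList) (X : Finset ℕ) (u v : ℕ) : Prop := u ≠ v ∧ E.Same X u v

theorem Twin.symm {u v : ℕ} (h : E.Twin X u v) : E.Twin X v u := ⟨h.1.symm, h.2.symm⟩

theorem Least.same (hc : E.Least (E.Twin X) E.m cls) {v : ℕ} (hv : v < E.n) (hvX : v ∉ X) :
    E.Same X v (cls v) := by
  rcases hc.mem v hv with h | h
  · rw [h]; exact .refl hvX
  · exact h.2

theorem Least.cls_le (hc : E.Least (E.Twin X) E.m cls) {u v : ℕ} (hu : u < E.n)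
    (h : E.Same X u v) : cls u ≤ v := by
  rcases h.adj with rfl | hadj
  · exact hc.le u hu
  · exact hc.le_of_rel (fun _ _ => Twin.symm) hadj ⟨hadj.ne, h⟩

/-- Each twin class is thus named by its least member. -/
theorem Least.cls_eq (hX : E.IsCluster X) (hc : E.Least (E.Twin X) E.m cls) {u v : ℕ}
    (hu : u < E.n) (hv : v < E.n) (h : E.Same X u v) : cls u = cls v :=
  le_antisymm (hc.cls_le hu (h.trans hX (hc.same hv h.right)))
    (hc.cls_le hv (h.symm.trans hX (hc.same hu h.left)))

/-- The least members of the twin classes before the one of `x`, in the clique of `x`. -/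
def earlier (E : EdgeList) (X : Finset ℕ) (cls : ℕ → ℕ) (x : ℕ) : Finset ℕ :=
  (Finset.range E.n).filter fun w => E.Adj w x ∧ w ∉ X ∧ x ∉ X ∧ cls w = w ∧ w < cls x

/-- The number of twin classes before the one of `x`, as far as the first `j` edges show. -/
def rankUpTo (E : EdgeList) (X : Finset ℕ) (cls : ℕ → ℕ) (j x : ℕ) : ℕ :=
  ∑ i ∈ Finset.range j, if E.fst i ∉ X ∧ E.snd i ∉ X then
    (if E.fst i = cls (E.fst i) ∧ E.fst i < cls (E.snd i) ∧ E.snd i = x then 1 else 0) +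
    (if E.snd i = cls (E.snd i) ∧ E.snd i < cls (E.fst i) ∧ E.fst i = x then 1 else 0) else 0

theorem rankUpTo_le (j x : ℕ) : E.rankUpTo X cls j x ≤ 2 * j := by
  calc _ ≤ ∑ i ∈ Finset.range j, 2 := Finset.sum_le_sum fun i _ => by split_ifs <;> omega
    _ = 2 * j := by simp [mul_comm]

/-- Each earlier least member is joined to `x` by exactly one edge, so counting edges counts
classes. -/
theorem rankUpTo_eq {x : ℕ} (hx : x < E.n) :
    E.rankUpTo X cls E.m x = (E.earlier X cls x).card := by
  have h1 := E.sum_edges fun u v =>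
    if u ∉ X ∧ v ∉ X ∧ cls u = u ∧ u < cls v ∧ v = x then 1 else 0
  have h2 : E.rankUpTo X cls E.m x = ∑ i ∈ Finset.range E.m,
      ((if E.fst i ∉ X ∧ E.snd i ∉ X ∧ cls (E.fst i) = E.fst i ∧ E.fst i < cls (E.snd i) ∧
          E.snd i = x then 1 else 0) +
        (if E.snd i ∉ X ∧ E.fst i ∉ X ∧ cls (E.snd i) = E.snd i ∧ E.snd i < cls (E.fst i) ∧
          E.fst i = x then 1 else 0)) := by
    refine Finset.sum_congr rfl fun i _ => ?_
    by_cases hf : E.fst i ∈ X <;> by_cases hs : E.snd i ∈ X <;> simp [hf, hs]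
    simp only [eq_comm]
  rw [h2, h1, earlier, Finset.card_filter]
  refine Finset.sum_congr rfl fun u _ => ?_
  rw [Finset.sum_eq_single x]
  · grind
  · intro v _ hv
    grind
  · intro h
    exact (h (Finset.mem_range.2 hx)).elim

/-- All classes before that of `u` come before that of `v`, and the class of `u` itself is a further
one. -/
theorem earlier_ssubset (hX : E.IsCluster X) (hc : E.Least (E.Twin X) E.m cls) {u v : ℕ}
    (hu : u ∉ X) (hv : v ∉ X) (huv : E.Adj u v) (hlt : cls u < cls v) :
    (E.earlier X cls u).card < (E.earlier X cls v).card := by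
  have hun := huv.lt_left
  have hvn := huv.lt_right
  have hS := hc.same hun hu
  have hle := hc.le v hvn
  refine Finset.card_lt_card ((Finset.ssubset_iff_of_subset fun w hw => ?_).2 ⟨cls u, ?_, ?_⟩)
  · simp only [earlier, Finset.mem_filter] at hw ⊢
    obtain ⟨h1, h2, h3, h4, h5, h6⟩ := hw
    refine ⟨h1, ?_, h3, hv, h5, by omega⟩
    exact (hX.adj_trans h3 hu hv (.inr h2) (.inr huv)).resolve_left (by omega)
  · simp only [earlier, Finset.mem_filter, Finset.mem_range]
    refine ⟨by omega, ?_, hS.right, hv, ?_, hlt⟩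
    · exact (hX.adj_trans hS.right hu hv hS.symm.adj (.inr huv)).resolve_left (by omega)
    · exact (hc.cls_eq hX hun (hc.lt hun) hS).symm
  · simp [earlier]

/-- The least members of different classes of one clique have different neighbourhoods in `X`;
adding the class of `v` itself makes the inequality strict. -/
theorem earlier_card_lt (hX : E.IsCluster X) (hc : E.Least (E.Twin X) E.m cls) {v : ℕ}
    (hvn : v < E.n) (hv : v ∉ X) : (E.earlier X cls v).card < 2 ^ X.card := by
  classical
  have hS := hc.same hvn hv
  have hnot : cls v ∉ E.earlier X cls v := by simp [earlier]
  have hcl := hc.cls_eq hX hvn (hc.lt hvn) hS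
  rw [← Finset.card_powerset, Nat.lt_iff_add_one_le, ← Finset.card_insert_of_notMem hnot]
  refine Finset.card_le_card_of_injOn (fun w => X.filter fun z => E.Adj w z)
    
    (fun w _ => Finset.mem_coe.2 (Finset.mem_powerset.2 (Finset.filter_subset _ _))) ?_
  have key : ∀ w ∈ insert (cls v) (E.earlier X cls v),
      w < E.n ∧ w ∉ X ∧ cls w = w ∧ (w = v ∨ E.Adj w v) := by
    intro w hw
    simp only [earlier, Finset.mem_insert, Finset.mem_filter, Finset.mem_range] at hw
    rcases hw with rfl | hw
    · exact ⟨hc.lt hvn, hS.right, hcl.symm, hS.symm.adj⟩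
    · exact ⟨hw.1, hw.2.2.1, hw.2.2.2.2.1, .inr hw.2.1⟩
  intro w hw w' hw' heq
  obtain ⟨a1, a2, a3, a4⟩ := key w hw
  obtain ⟨b1, b2, b3, b4⟩ := key w' hw'
  have : E.Same X w w' := by
    refine ⟨a2, b2, hX.adj_trans a2 hv b2 a4 (b4.imp Eq.symm Adj.symm), fun z hz => ?_⟩
    have h := Finset.ext_iff.1 heq z
    simpa [hz] using h
  rw [← a3, ← b3]
  exact hc.cls_eq hX a1 b1 this

/-- The point is that slots separate the classes of a clique: by `earlier_ssubset` the rank is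
strictly increasing in the least member of the class. -/
theorem isSlots_of_rank {hi : ℕ} (hsub : X ⊆ Finset.range E.n) (hX : E.IsCluster X)
    (hrep : E.Least (E.KeptAdj X) E.m rep) (hc : E.Least (E.Twin X) E.m cls)
    (h1 : ∀ x ∈ X, slot x < X.card) (h2 : ∀ x ∈ X, ∀ y ∈ X, slot x = slot y → x = y)
    (h3 : ∀ v < E.n, v ∉ X → slot v = X.card + (E.earlier X cls v).card)
    (h4 : ∀ v < E.n, slot v < hi) : E.IsSlots X rep slot hi where
  sub := hsub
  cluster := hX
  rep_lt v hv := hrep.lt hv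
  rep_iff := hrep.rep_iff hX
  slot_lt := h1
  slot_inj := h2
  slot_ge v hv hvX := by rw [h3 v hv hvX]; omega
  slot_lt_hi v hv hvX := h4 v hv
  slot_same u v hu hv huv h := by
    rw [h3 u huv.lt_left hu, h3 v huv.lt_right hv] at h
    have e : cls u = cls v := by
      rcases lt_trichotomy (cls u) (cls v) with hlt | heq | hlt
      · have := earlier_ssubset hX hc hu hv huv hlt
        omega
      · exact heq
      · have := earlier_ssubset hX hc hv hu huv.symm hlt
        omega
    have h1 := hc.same huv.lt_left hu
    have h2 := hc.same huv.lt_right hv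
    rw [e] at h1
    exact h1.trans hX h2.symm

end EdgeList

/-! ### Commands that compute twin classes and slots -/

section

variable {mc : Machine} {E : EdgeList} {s t k : ℕ} {h : St} {X : Finset ℕ}

namespace Cmd

/-- The list `xs` inverts `slot` on `X`. This gives injectivity of the slots and guarantees that a
run through the list meets all of `X`. -/
theorem numberDeleted_spec (room : Room mc E) (hB : Base E s t k h) (hX : IsDel E X h) :
    Tri mc numberDeleted h (E.n * (3 * pieceSize) + 3 * pieceSize) fun h' =>
      Frame [.i, .xc] [.xs, .slot] h h' ∧ h'.v .xc = X.card ∧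
      (∀ z ∈ X, h'.a .slot z < X.card ∧ h'.a .xs (h'.a .slot z) = z) ∧
      ∀ i < X.card, h'.a .xs i ∈ X := by
  have lin := room.lin
  have hcard : ∀ j, (X.filter (· < j)).card ≤ E.n := fun j => by
    simpa using Finset.card_le_card ((Finset.filter_subset (· < j) X).trans hX.sub)
  have hinit : Tri mc (set .xc 0) h pieceSize fun h' => h' = h.set .xc 0 :=
    Tri.of_wp (by decide) (by simp [wp])
  refine (hinit.seq fun h' hh => Tri.forTo (T := pieceSize) (by decide) (fun j h' => h'.v .i = j ∧
    Frame [.i, .xc] [.xs, .slot] h h' ∧ h'.v .xc = (X.filter (· < j)).card ∧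
      (∀ z ∈ X, z < j → h'.a .slot z < (X.filter (· < j)).card ∧ h'.a .xs (h'.a .slot z) = z) ∧
      ∀ i < (X.filter (· < j)).card, h'.a .xs i ∈ X) E.n
    (by omega) ?_ ?_ ?_ ?_).mono (by unfold pieceSize; omega) fun _ h => h
  · subst hh
    simp
  · rintro j h' ⟨h1, h2, -⟩
    simp [h1, h2.v .n, hB.n]
  · rintro j hj h' ⟨h1, h2, h3, h4, h5⟩
    have hX' := hX.of_frame h2 (by decide)
    have hdel := hX'.eq_zero_iff hj
    have hc := hcard j
    refine Tri.of_wp (by decide) ?_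
    simp only [wp, Cmd.when, Exp.eval_get, Exp.eval_var, h1, ne_eq, hdel, not_not, h3]
    refine ⟨fun hjX => ?_, fun hjX => ?_⟩
    · have hfil : X.filter (· < j + 1) = insert j (X.filter (· < j)) := by
        ext x
        simp only [Finset.mem_filter, Finset.mem_insert]
        grind
      have hcard' : (X.filter (· < j + 1)).card = (X.filter (· < j)).card + 1 := by
        rw [hfil, Finset.card_insert_of_notMem (by simp)]
      rw [hcard']
      generalize (X.filter (· < j)).card = c at *
      simp [h1, h3]
      refine ⟨by omega, by omega, by omega, by simp (maxDischargeDepth := 20) [h2], ?_, ?_⟩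
      · intro z hz hzj
        have := h4 z hz
        grind
      · intro i hi
        have := h5 i
        grind
    · have hfil : X.filter (· < j + 1) = X.filter (· < j) := by
        ext x
        simp only [Finset.mem_filter]
        grind
      rw [hfil]
      simp [h3]
      refine ⟨by simp (maxDischargeDepth := 20) [h2], ?_, ?_⟩
      · intro z hz hzj
        have := h4 z hz
        grind
      · exact h5
  · rintro h' ⟨_, h2, h3, h4, h5⟩
    have hfil : X.filter (· < E.n) = X := by
      ext x
      have := @hX.sub x
      simp only [Finset.mem_filter, Finset.mem_range] at *
      grind
    rw [hfil] at h3 h4 h5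
    refine ⟨h2, h3, fun z hz => h4 z hz ?_, h5⟩
    simpa using hX.sub hz

theorem initClasses_spec (room : Room mc E) (hB : Base E s t k h) (hX : IsDel E X h)
    (hxc : h.v .xc = X.card) :
    Tri mc initClasses h (E.n * (3 * pieceSize) + 2 * pieceSize) fun h' =>
      Frame [.i] [.cls, .slot] h h' ∧ (∀ v < E.n, h'.a .cls v = v) ∧
        ∀ v < E.n, h'.a .slot v = if v ∈ X then h.a .slot v else X.card := by
  have lin := room.lin
  have hcard : X.card ≤ E.n := by simpa using Finset.card_le_card hX.sub
  refine (Tri.forTo (T := pieceSize) (by decide) (fun j h' => h'.v .i = j ∧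
    Frame [.i] [.cls, .slot] h h' ∧ (∀ v < j, h'.a .cls v = v) ∧
      ∀ v, h'.a .slot v = if v < j ∧ v ∉ X then X.card else h.a .slot v) E.n
    (by omega) ?_ ?_ ?_ ?_).mono (by unfold pieceSize; omega) fun _ h => h
  · simp
  · rintro j h' ⟨h1, h2, -⟩
    simp [h1, h2.v .n, hB.n]
  · rintro j hj h' ⟨h1, h2, h3, h4⟩
    have hX' := hX.of_frame h2 (by decide)
    refine Tri.of_wp (by decide) ?_
    simp [wp, Cmd.when, h1, hX'.eq_zero_iff hj, h2.v .xc, hxc]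
    refine ⟨by omega, fun hjX => ⟨by omega, by simp (maxDischargeDepth := 20) [h2], ?_, ?_⟩,
      fun hjX => ⟨by simp (maxDischargeDepth := 20) [h2], ?_, ?_⟩⟩
    · grind
    · grind
    · grind
    · grind
  · rintro h' ⟨_, h2, h3, h4⟩
    refine ⟨h2, h3, fun v hv => ?_⟩
    rw [h4]
    grind

theorem compareEnds_spec (room : Room mc E) (hB : Base E s t k h) (hsub : X ⊆ Finset.range E.n)
    (hxc : h.v .xc = X.card) (hxs : ∀ i < X.card, h.a .xs i ∈ X)
    (hu : h.v .u < E.n) (hv : h.v .v < E.n) :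
    Tri mc compareEnds h (X.card * (3 * pieceSize) + 2 * pieceSize) fun h' =>
      Frame [.j, .diff] [] h h' ∧ (h'.v .diff = 0 ↔ h.v .diff = 0 ∧
        ∀ i < X.card, (E.Adj (h.v .u) (h.a .xs i) ↔ E.Adj (h.v .v) (h.a .xs i))) := by
  have lin := room.lin
  have hcard : X.card ≤ E.n := by simpa using Finset.card_le_card hsub
  refine (Tri.forTo (T := pieceSize) (by decide) (fun j h' => h'.v .j = j ∧
    Frame [.j, .diff] [] h h' ∧ (h'.v .diff = 0 ↔ h.v .diff = 0 ∧
      ∀ i < j, (E.Adj (h.v .u) (h.a .xs i) ↔ E.Adj (h.v .v) (h.a .xs i)))) X.card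
    (by omega) ?_ ?_ ?_ ?_).mono (by unfold pieceSize; omega) fun _ h => h
  · simp
  · rintro j h' ⟨h1, h2, -⟩
    simp [h1, h2.v .xc, hxc]
  · rintro j hj h' ⟨h1, h2, h3⟩
    have hB' := hB.of_frame h2 (by decide) (by decide)
    have hx : h.a .xs j < E.n := by simpa using hsub (hxs j hj)
    have hall : ∀ i, i < j + 1 ↔ i < j ∨ i = j := by intro i; omega
    refine Tri.of_wp (by decide) ?_
    simp [wp, Cmd.when, adjEntry, h1, hB'.n, h2.v .u, h2.v .v, h2.a .xs, hB'.adj _ hu _ hx,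
      hB'.adj _ hv _ hx]
    refine ⟨fun hne => ⟨by omega, by simp (maxDischargeDepth := 20) [h2], ?_⟩,
      fun heq => ⟨by simp (maxDischargeDepth := 20) [h2], ?_⟩⟩
    · intro _
      refine ⟨j, by omega, ?_⟩
      grind
    · grind
  · rintro h' ⟨_, h2, h3⟩
    exact ⟨h2, h3⟩

/-- Comparing the ends of an edge takes time linear in `|X|` with the adjacency matrix; adjacent
vertices are all that matters, as distinct twins are adjacent. -/
theorem classes_spec (room : Room mc E) (hB : Base E s t k h) (hX : IsDel E X h)
    (hxc : h.v .xc = X.card) (hxs : ∀ i < X.card, h.a .xs i ∈ X)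
    (hsurj : ∀ z ∈ X, ∃ i < X.card, h.a .xs i = z) (hcls : ∀ v < E.n, h.a .cls v = v) :
    Tri mc classes h (E.m * ((X.card + 3) * (3 * pieceSize)) + 2 * pieceSize) fun h' =>
      Frame [.e, .u, .v, .j, .diff] [.cls] h h' ∧ E.Least (E.Twin X) E.m (h'.a .cls) := by
  have lin := room.lin
  refine (Tri.forTo (T := pieceSize + (X.card * (3 * pieceSize) + 2 * pieceSize + pieceSize))
    (by decide) (fun j h' => h'.v .e = j ∧
    Frame [.e, .u, .v, .j, .diff] [.cls] h h' ∧ E.Least (E.Twin X) j (h'.a .cls)) E.m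
    (by omega) ?_ ?_ ?_ ?_).mono (by unfold pieceSize; ring_nf; omega) fun _ h => h
  · exact ⟨by simp, by simp, .zero fun v hv => by simp [hcls v hv]⟩
  · rintro j h' ⟨h1, h2, -⟩
    simp [h1, h2.v .m, hB.m]
  · rintro j hj h1 ⟨he, hF1, hL⟩
    have hf := E.fst_lt j hj
    have hs := E.snd_lt j hj
    have hne := E.ne j hj
    have hadj := EdgeList.adj_edge hj
    have hB1 := hB.of_frame hF1 (by decide) (by decide)
    have hX1 := hX.of_frame hF1 (by decide)
    have s1 : Tri mc (loadEdge ;; set .diff (.lt bothKept 1)) h1 pieceSize fun h2 =>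
        Frame [.u, .v, .diff] [] h1 h2 ∧ h2.v .u = E.fst j ∧ h2.v .v = E.snd j ∧
        (h2.v .diff = 0 ↔ E.fst j ∉ X ∧ E.snd j ∉ X) := by
      refine Tri.of_wp (by decide) ?_
      simp [wp, loadEdge, bothKept, he, hB1.fst j hj, hB1.snd j hj,
        hX1.eq_zero_iff hf, hX1.eq_zero_iff hs]
      refine ⟨by omega, by omega, ?_, ?_⟩
      · split <;> omega
      · simp (maxDischargeDepth := 20)
    refine s1.seq fun h2 ⟨hF2, hu, hv, hd⟩ => ?_
    have hB2 := hB1.of_frame hF2 (by decide) (by decide)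
    have hxc2 : h2.v .xc = X.card := by rw [hF2.v _ (by decide), hF1.v _ (by decide), hxc]
    have hxse : h2.a .xs = h.a .xs := by rw [hF2.a _ (by decide), hF1.a _ (by decide)]
    refine (compareEnds_spec room hB2 hX.sub hxc2 (by rwa [hxse]) (by rwa [hu])
      (by rwa [hv])).seq fun h3 ⟨hF3, hd3⟩ => ?_
    -- The flag starts at zero only if both ends are kept, and stays zero only if no entry of the
    -- list of `X` tells them apart.
    have htwin : h3.v .diff = 0 ↔ E.Twin X (E.fst j) (E.snd j) := by
      rw [hd3, hd, hu, hv, hxse]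
      constructor
      · rintro ⟨⟨a1, a2⟩, a3⟩
        refine ⟨hne, a1, a2, .inr hadj, fun z hz => ?_⟩
        obtain ⟨i, hi, rfl⟩ := hsurj z hz
        exact a3 i hi
      · rintro ⟨_, a⟩
        exact ⟨⟨a.left, a.right⟩, fun i hi => a.iff _ (hxs i hi)⟩
    have hF13 : Frame [.e, .u, .v, .j, .diff] [.cls] h h3 :=
      hF1.trans ((hF2.mono (by decide) (by decide)).trans (hF3.mono (by decide) (by decide)))
    have he3 : h3.v .e = j := by rw [hF3.v _ (by decide), hF2.v _ (by decide), he]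
    have hu3 : h3.v .u = E.fst j := by rw [hF3.v _ (by decide), hu]
    have hv3 : h3.v .v = E.snd j := by rw [hF3.v _ (by decide), hv]
    have hc3 : h3.a .cls = h1.a .cls := by rw [hF3.a _ (by decide), hF2.a _ (by decide)]
    refine Tri.of_wp (by decide) ?_
    simp [wp, Cmd.when, hu3, hv3, he3, hc3]
    refine ⟨fun ht => ⟨by omega, by omega, by simp (maxDischargeDepth := 20) [hF13], ?_⟩,
      fun ht => ⟨by simp (maxDischargeDepth := 20) [hF13], hL.skip (mt htwin.2 ht)⟩⟩
    refine hL.step (fun _ _ => EdgeList.Twin.symm) hj (htwin.1 ht) fun v => ?_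
    simp [hc3]
    grind
  · rintro h' ⟨_, h2, h3⟩
    exact ⟨h2, h3⟩

theorem slots_spec (room : Room mc E) (hB : Base E s t k h) (hX : IsDel E X h)
    (hslot : ∀ v < E.n, h.a .slot v ≤ E.n) :
    Tri mc slots h (E.m * (3 * pieceSize) + 2 * pieceSize) fun h' =>
      Frame [.e, .u, .v] [.slot] h h' ∧
      ∀ v < E.n, h'.a .slot v = h.a .slot v + E.rankUpTo X (h.a .cls) E.m v := by
  have lin := room.lin
  refine (Tri.forTo (T := pieceSize) (by decide) (fun j h' => h'.v .e = j ∧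
    Frame [.e, .u, .v] [.slot] h h' ∧
      ∀ v < E.n, h'.a .slot v = h.a .slot v + E.rankUpTo X (h.a .cls) j v) E.m
    (by omega) ?_ ?_ ?_ ?_).mono (by unfold pieceSize; omega) fun _ h => h
  · simp [EdgeList.rankUpTo]
  · rintro j h' ⟨h1, h2, -⟩
    simp [h1, h2.v .m, hB.m]
  · rintro j hj h' ⟨h1, h2, h3⟩
    have hf := E.fst_lt j hj
    have hs := E.snd_lt j hj
    have hne := E.ne j hj
    have hB' := hB.of_frame h2 (by decide) (by decide)
    have hX' := hX.of_frame h2 (by decide)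
    have hdf := EdgeList.rankUpTo_le (E := E) (X := X) (cls := h.a .cls) j (E.fst j)
    have hds := EdgeList.rankUpTo_le (E := E) (X := X) (cls := h.a .cls) j (E.snd j)
    have hsf := hslot _ hf
    have hss := hslot _ hs
    have hrank : ∀ x, E.rankUpTo X (h.a .cls) (j + 1) x = E.rankUpTo X (h.a .cls) j x +
        if E.fst j ∉ X ∧ E.snd j ∉ X then
          (if E.fst j = h.a .cls (E.fst j) ∧ E.fst j < h.a .cls (E.snd j) ∧ E.snd j = x
            then 1 else 0) +
          (if E.snd j = h.a .cls (E.snd j) ∧ E.snd j < h.a .cls (E.fst j) ∧ E.fst j = x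
            then 1 else 0) else 0 :=
      fun x => Finset.sum_range_succ _ _
    refine Tri.of_wp (by decide) ?_
    simp [wp, loadEdge, Cmd.when, bothKept, h1, hB'.fst j hj, hB'.snd j hj, h3 _ hf, h3 _ hs,
      hX'.eq_zero_iff hf, hX'.eq_zero_iff hs, h2.a .cls, hrank, hne]
    refine ⟨by omega, by omega, fun hfX hsX => ⟨fun c1 c2 => ⟨by omega, fun c3 c4 => ?_,
      fun c3 => ?_⟩, fun c1 => ⟨fun c3 c4 => ?_, fun c3 => ?_⟩⟩, fun hX => ?_⟩
    · refine ⟨by omega, by simp (maxDischargeDepth := 20) [h2], fun v hv => ?_⟩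
      have := h3 v hv
      simp only [hfX, hsX, not_false_eq_true, and_self, if_true]
      grind
    · refine ⟨by simp (maxDischargeDepth := 20) [h2], fun v hv => ?_⟩
      have := h3 v hv
      simp only [hfX, hsX, not_false_eq_true, and_self, if_true]
      grind
    · refine ⟨by omega, by simp (maxDischargeDepth := 20) [h2], fun v hv => ?_⟩
      have := h3 v hv
      simp only [hfX, hsX, not_false_eq_true, and_self, if_true]
      grind
    · refine ⟨by simp (maxDischargeDepth := 20) [h2], fun v hv => ?_⟩
      have := h3 v hv
      simp only [hfX, hsX, not_false_eq_true, and_self, if_true]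
      grind
    · refine ⟨by simp (maxDischargeDepth := 20) [h2], fun v hv => ?_⟩
      have := h3 v hv
      grind
  · rintro h' ⟨_, h2, h3⟩
    exact ⟨h2, h3⟩

/-- The last alternative says that the maximum is attained, which later turns bounds on slots into
bounds on `hi`. -/
theorem maxSlot_spec (room : Room mc E) (hB : Base E s t k h) (hxc : h.v .xc ≤ E.n)
    (hslot : ∀ v < E.n, h.a .slot v < mc.M) :
    Tri mc maxSlot h (E.n * (3 * pieceSize) + 3 * pieceSize) fun h' =>
      Frame [.i, .hi] [] h h' ∧ (∀ v < E.n, h.a .slot v < h'.v .hi) ∧ h.v .xc ≤ h'.v .hi ∧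
      (h'.v .hi = h.v .xc ∨ ∃ v < E.n, h'.v .hi = h.a .slot v + 1) := by
  have lin := room.lin
  have hinit : Tri mc (set .hi (.var .xc)) h pieceSize fun h' => h' = h.set .hi (h.v .xc) :=
    Tri.of_wp (by decide) (by simp [wp]; omega)
  refine (hinit.seq fun h' hh => Tri.forTo (T := pieceSize) (by decide) (fun j h' => h'.v .i = j ∧
    Frame [.i, .hi] [] h h' ∧ (∀ v < j, h.a .slot v < h'.v .hi) ∧ h.v .xc ≤ h'.v .hi ∧
      (h'.v .hi = h.v .xc ∨ ∃ v < E.n, h'.v .hi = h.a .slot v + 1)) E.n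
    (by omega) ?_ ?_ ?_ ?_).mono (by unfold pieceSize; omega) fun _ h => h
  · subst hh
    simp
  · rintro j h' ⟨h1, h2, -⟩
    simp [h1, h2.v .n, hB.n]
  · rintro j hj h' ⟨h1, h2, h3, h4, h5⟩
    have := hslot j hj
    refine Tri.of_wp (by decide) ?_
    simp [wp, Cmd.when, h1, h2.a .slot]
    refine ⟨fun hlt => ⟨by omega, by simp (maxDischargeDepth := 20) [h2], ?_, by omega, ?_⟩,
      fun hle => ⟨by simp (maxDischargeDepth := 20) [h2], ?_, h4, h5⟩⟩
    · intro v hv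
      rcases hv.lt_or_eq with hv | rfl
      · have := h3 v hv
        omega
      · omega
    · exact .inr ⟨j, hj, rfl⟩
    · intro v hv
      rcases hv.lt_or_eq with hv | rfl
      · exact h3 v hv
      · omega
  · rintro h' ⟨_, h2, h3⟩
    exact ⟨h2, h3⟩

end Cmd

end

end MVE

namespace MVE

/-! ## Enumeration of digit sequences -/

/-- The number with the digits `d lo, …, d (hi - 1)` in base `b`, least significant digit first. -/
def digitValue (b lo hi : ℕ) (d : ℕ → ℕ) : ℕ := ∑ r ∈ Finset.Ico lo hi, d r * b ^ (r - lo)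

theorem digitValue_of_le {b lo hi : ℕ} (h : hi ≤ lo) (d : ℕ → ℕ) : digitValue b lo hi d = 0 := by
  simp [digitValue, Finset.Ico_eq_empty_of_le h]

theorem digitValue_succ {b lo hi : ℕ} (h : lo ≤ hi) (d : ℕ → ℕ) :
    digitValue b lo (hi + 1) d = digitValue b lo hi d + d hi * b ^ (hi - lo) :=
  Finset.sum_Ico_succ_top h _

theorem digitValue_congr {b lo hi : ℕ} {d d' : ℕ → ℕ} (h : ∀ r, lo ≤ r → r < hi → d r = d' r) :
    digitValue b lo hi d = digitValue b lo hi d' :=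
  Finset.sum_congr rfl fun r hr => by rw [h r (Finset.mem_Ico.1 hr).1 (Finset.mem_Ico.1 hr).2]

theorem digitValue_lt {l lo hi : ℕ} (h : lo ≤ hi) {d : ℕ → ℕ} (hd : ∀ r, d r ≤ l) :
    digitValue (l + 1) lo hi d < (l + 1) ^ (hi - lo) := by
  induction hi, h using Nat.le_induction with
  | base => simp [digitValue]
  | succ hi h ih =>
    rw [digitValue_succ h, Nat.succ_sub h, pow_succ]
    have := Nat.mul_le_mul_right ((l + 1) ^ (hi - lo)) (hd hi)
    calc _ < (l + 1) ^ (hi - lo) + l * (l + 1) ^ (hi - lo) := by omega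
      _ = _ := by ring

/-- The top digit is the quotient by the highest power. Injectivity is what shows that counting
through all values tries every digit sequence. -/
theorem digitValue_inj {l lo hi : ℕ} {d d' : ℕ → ℕ} (hd : ∀ r, d r ≤ l) (hd' : ∀ r, d' r ≤ l)
    (h : digitValue (l + 1) lo hi d = digitValue (l + 1) lo hi d') :
    ∀ r, lo ≤ r → r < hi → d r = d' r := by
  induction hi with
  | zero => intro r _ hr; omega
  | succ hi ih =>
    intro r h1 h2
    have hle : lo ≤ hi := by omega
    rw [digitValue_succ hle, digitValue_succ hle] at h
    have a1 := digitValue_lt hle hd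
    have a2 := digitValue_lt hle hd'
    have hpos : 0 < (l + 1) ^ (hi - lo) := by positivity
    have key : ∀ a x, a < (l + 1) ^ (hi - lo) →
        (a + x * (l + 1) ^ (hi - lo)) / (l + 1) ^ (hi - lo) = x := by
      intro a x ha
      rw [Nat.add_mul_div_right _ _ hpos, Nat.div_eq_of_lt ha, zero_add]
    have e1 : d hi = d' hi := by
      rw [← key _ (d hi) a1, ← key _ (d' hi) a2, h]
    rcases Nat.lt_succ_iff_lt_or_eq.1 h2 with h2 | rfl
    · refine ih ?_ r h1 h2
      rw [e1] at h
      omega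
    · exact e1

section

variable {mc : Machine} {E : EdgeList} {s t k l : ℕ} {h : St} {X : Finset ℕ}

/-- Adding one with carry, with wrap-around to zero after the largest value. The hypotheses `hlos`
and `hhis` list the expressions that occur, so that their sizes can be decided. -/
theorem Cmd.next_spec {lo hi : Exp} {go : Var} {a b : ℕ} (hl : h.v .l = l) (hlM : l < mc.M)
    (hbM : b ≤ mc.M) (hab : a ≤ b)
    (hlo : ∀ h', Frame [.j, .carry] [.dig] h h' → lo.eval h' = a)
    (hhi : ∀ h', Frame [.j, .carry] [.dig] h h' → hi.eval h' = b)
    (hlos : lo = 0 ∨ lo = .var .xc) (hhis : hi = .var .xc ∨ hi = .var .hi)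
    (hd : ∀ r, h.a .dig r ≤ l) :
    Tri mc (next lo hi go) h (b * (3 * pieceSize) + 4 * pieceSize) fun h' =>
      Frame [.j, .carry, go] [.dig] h h' ∧ (∀ r, h'.a .dig r ≤ l) ∧
      (∀ r, r < a ∨ b ≤ r → h'.a .dig r = h.a .dig r) ∧
      ((h'.v go = 1 ∧ digitValue (l + 1) a b (h'.a .dig) = digitValue (l + 1) a b (h.a .dig) + 1) ∨
        (h'.v go = 0 ∧ digitValue (l + 1) a b (h'.a .dig) = 0 ∧
          digitValue (l + 1) a b (h.a .dig) + 1 = (l + 1) ^ (b - a))) := by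
  have hM := mc.hM
  have s1 : Tri mc (set .carry 1) h pieceSize fun h' => h' = h.set .carry 1 :=
    Tri.of_wp (by decide) (by simp [wp]; omega)
  -- Invariant: the digits already processed, together with the pending carry, exceed their old
  -- value by one. Below position `a` the carry is only passed on.
  have s2 : ∀ h1, h1 = h.set .carry 1 →
      Tri mc (forTo .j hi (when (.var .carry * .lt lo (.var .j + 1))
      (ite (.lt (.get .dig (.var .j)) (.var .l))
        (put .dig (.var .j) (.get .dig (.var .j) + 1) ;; set .carry 0) (put .dig (.var .j) 0))))
      h1 (b * (3 * pieceSize) + 2 * pieceSize) fun h' =>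
        Frame [.j, .carry] [.dig] h h' ∧ (∀ r, h'.a .dig r ≤ l) ∧ h'.v .carry ≤ 1 ∧
        (∀ r, r < a ∨ b ≤ r → h'.a .dig r = h.a .dig r) ∧
        digitValue (l + 1) a b (h'.a .dig) + h'.v .carry * (l + 1) ^ (b - a) =
          digitValue (l + 1) a b (h.a .dig) + 1 := by
    rintro h1 rfl
    refine (Tri.forTo (T := pieceSize) (by rcases hhis with rfl | rfl <;> decide)
      (fun j h' => h'.v .j = j ∧
      Frame [.j, .carry] [.dig] h h' ∧ (∀ r, h'.a .dig r ≤ l) ∧ h'.v .carry ≤ 1 ∧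
      (j ≤ a → h'.v .carry = 1) ∧
      (∀ r, r < a ∨ j ≤ r → h'.a .dig r = h.a .dig r) ∧
        digitValue (l + 1) a j (h'.a .dig) + h'.v .carry * (l + 1) ^ (j - a) =
          digitValue (l + 1) a j (h.a .dig) + 1) b hbM ?_ ?_ ?_ ?_).mono
      (by unfold pieceSize; omega) fun _ h => h
    · simp [hd, digitValue_of_le]
    · rintro j h' ⟨h1, h2, -⟩
      exact ⟨h1, hhi h' h2⟩
    · rintro j hj h' ⟨h1, h2, h3, h4, h5, h6, h7⟩
      have hll : h'.v .l = l := by rw [h2.v _ (by decide), hl]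
      refine Tri.of_wp ?_ ?_
      · rcases hlos with rfl | rfl <;> decide
      · have hdj := h6 j (.inr le_rfl)
        simp [wp, Cmd.when, h1, hlo h' h2, hll, hdj]
        refine ⟨fun hc haj => ⟨fun hlt => ?_, fun hle => ?_⟩, fun hno => ?_⟩
        · have hc1 : h'.v .carry = 1 := by omega
          have haj : a ≤ j := by omega
          rw [digitValue_succ haj, digitValue_succ haj]
          have hcongr : digitValue (l + 1) a j
              ((((h'.put .dig j (h.a .dig j + 1)).set .carry 0).set .j (j + 1)).a .dig) =
              digitValue (l + 1) a j (h'.a .dig) := by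
            refine digitValue_congr fun r _ hr => ?_
            simp
            omega
          refine ⟨by omega, by simp (maxDischargeDepth := 20) [h2], ?_, by omega, ?_, ?_⟩
          · intro r
            have := h3 r
            split <;> omega
          · intro r hr
            rw [if_neg (by omega)]
            exact h6 r (by omega)
          · simp only [St.set_a] at hcongr
            rw [hcongr]
            simp only [hc1, one_mul] at h7
            simp
            linarith
        · have hc1 : h'.v .carry = 1 := by omega
          have haj : a ≤ j := by omega
          rw [digitValue_succ haj, digitValue_succ haj]
          have hcongr : digitValue (l + 1) a j (((h'.put .dig j 0).set .j (j + 1)).a .dig) =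
              digitValue (l + 1) a j (h'.a .dig) := by
            refine digitValue_congr fun r _ hr => ?_
            simp
            omega
          have hdl : h.a .dig j = l := le_antisymm (hd j) hle
          refine ⟨by simp (maxDischargeDepth := 20) [h2], ?_, h4, by omega, ?_, ?_⟩
          · intro r
            have := h3 r
            split <;> omega
          · intro r hr
            rw [if_neg (by omega)]
            exact h6 r (by omega)
          · simp only [St.set_a] at hcongr
            rw [hcongr, hc1, Nat.succ_sub haj, pow_succ, hdl]
            simp only [hc1, one_mul] at h7
            simp
            linarith
        · refine ⟨by simp (maxDischargeDepth := 20) [h2], h3, h4, fun hja => h5 (by omega),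
            fun r hr => h6 r (by omega), ?_⟩
          by_cases haj : a ≤ j
          · have hc0 : h'.v .carry = 0 := hno haj
            rw [digitValue_succ haj, digitValue_succ haj, hc0, hdj]
            rw [hc0] at h7
            linarith
          · have e1 := h5 (by omega)
            rw [digitValue_of_le (by omega), digitValue_of_le (by omega), e1,
              show j + 1 - a = 0 by omega]
            simp
    · rintro h' ⟨_, h2, h3, h4, _, h6, h7⟩
      exact ⟨h2, h3, h4, h6, h7⟩
  refine (s1.seq fun h1 hh1 => (s2 h1 hh1).seq (T₂ := pieceSize)
    fun h2 ⟨hF, hb, hc, hr, hv⟩ => ?_).mono (by unfold pieceSize; omega) fun _ h => h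
  refine Tri.of_wp (by show 5 ≤ 1000; omega) ?_
  have hlt := digitValue_lt hab hd
  have hF' : Frame [.j, .carry, go] [.dig] h h2 := hF.mono (by simp) (by simp)
  simp [wp]
  refine ⟨by split <;> omega, by simp (maxDischargeDepth := 20) [hF'], hb, hr, ?_⟩
  -- A carry that remains shows that the old value was the largest one, and then the new value must
  -- be zero.
  rcases Nat.le_one_iff_eq_zero_or_eq_one.1 hc with hc | hc
  · rw [hc] at hv
    omega
  · rw [hc] at hv
    omega

/-! ### Costs of the cliques for fixed labels of the deleted vertices -/

namespace EdgeList

variable {rep slot : ℕ → ℕ} {hi : ℕ}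

theorem IsSlots.slot_lt_max (H : E.IsSlots X rep slot hi) (hhi : X.card ≤ hi) {v : ℕ}
    (hv : v < E.n) : slot v < hi := by
  by_cases hX : v ∈ X
  · exact (H.slot_lt v hX).trans_le hhi
  · exact H.slot_lt_hi v hv hX

theorem IsSlots.costAt_congr (H : E.IsSlots X rep slot hi) (hhi : X.card ≤ hi) {d d' : ℕ → ℕ}
    (h : ∀ r < hi, d r = d' r) (o : ℕ) : E.costAt X rep slot d o = E.costAt X rep slot d' o := by
  unfold costAt costUpTo
  refine Finset.sum_congr rfl fun i hi => ?_
  have hi := Finset.mem_range.1 hi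
  rw [h _ (H.slot_lt_max hhi (E.fst_lt i hi)), h _ (H.slot_lt_max hhi (E.snd_lt i hi))]

/-- Digits that are bounded by `l` and extend `f`. -/
def Extension (X : Finset ℕ) (l : ℕ) (f d : ℕ → ℕ) : Prop :=
  (∀ r, d r ≤ l) ∧ ∀ r < X.card, d r = f r

/-- The numbers `best` are the least costs of the cliques for extensions of `f`. -/
def IsBest (E : EdgeList) (X : Finset ℕ) (rep slot : ℕ → ℕ) (l : ℕ) (f best : ℕ → ℕ) : Prop :=
  ∀ o < E.n, (∀ d, Extension X l f d → best o ≤ E.costAt X rep slot d o) ∧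
    ∃ d, Extension X l f d ∧ best o = E.costAt X rep slot d o

/-- The labels `G o` are independent for different `o`, so the minimum of the sum is the sum of the
minima. -/
theorem IsBest.extends_iff {best f : ℕ → ℕ} (hb : E.IsBest X rep slot l f best)
    (hf : ∀ r, f r ≤ l) : E.Extends X rep slot s t k l f ↔
      f (slot s) = 0 ∧ f (slot t) = l ∧ ∑ o ∈ Finset.range E.n, best o ≤ k := by
  classical
  constructor
  · rintro ⟨h1, h2, G, h3, h4, h5⟩
    refine ⟨h1, h2, (Finset.sum_le_sum fun o ho => ?_).trans h5⟩
    exact (hb o (Finset.mem_range.1 ho)).1 _ ⟨h4 o, h3 o⟩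
  · rintro ⟨h1, h2, h3⟩
    refine ⟨h1, h2, fun o => if h : o < E.n then (hb o h).2.choose else f, ?_, ?_, ?_⟩
    · intro o r hr
      dsimp only
      split
      next h => exact (hb o h).2.choose_spec.1.2 r hr
      · rfl
    · intro o r
      dsimp only
      split
      next h => exact (hb o h).2.choose_spec.1.1 r
      · exact hf r
    · refine le_trans (Finset.sum_le_sum fun o ho => ?_) h3
      have ho := Finset.mem_range.1 ho
      simp only [dif_pos ho]
      exact (hb o ho).2.choose_spec.2.ge

theorem Extends.congr (H : E.IsSlots X rep slot hi) (hs : s ∈ X) (ht : t ∈ X) {f f' : ℕ → ℕ}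
    (h : E.Extends X rep slot s t k l f) (hff : ∀ r < X.card, f r = f' r) :
    E.Extends X rep slot s t k l f' := by
  obtain ⟨h1, h2, G, h3, h4, h5⟩ := h
  exact ⟨by rw [← hff _ (H.slot_lt s hs), h1], by rw [← hff _ (H.slot_lt t ht), h2], G,
    fun o r hr => (h3 o r hr).trans (hff r hr), h4, h5⟩

end EdgeList

open EdgeList

/-- The parts of the state that the enumeration only reads. -/
structure Ready (E : EdgeList) (X : Finset ℕ) (s t k l hi : ℕ) (h : St) : Prop where
  base : Base E s t k h
  del : IsDel E X h
  slots : E.IsSlots X (h.a .rep) (h.a .slot) hi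
  xc : h.v .xc = X.card
  hi : h.v .hi = hi
  l : h.v .l = l

theorem Ready.of_frame {hi : ℕ} {h' : St} (H : Ready E X s t k l hi h) {R : List Var}
    {A : List Arr} (hF : Frame R A h h')
    (hR : ∀ x ∈ [Var.n, .m, .s, .t, .k, .xc, .hi, .l], x ∉ R)
    (hA : ∀ r ∈ [Arr.fst, .snd, .adj, .del, .rep, .slot], r ∉ A) : Ready E X s t k l hi h' where
  base := H.base.of_frame hF (fun x hx => hR x (by revert x; decide))
    (fun r hr => hA r (by revert r; decide))
  del := H.del.of_frame hF (hA _ (by decide))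
  slots := by rw [hF.a _ (hA .rep (by decide)), hF.a _ (hA .slot (by decide))]; exact H.slots
  xc := by rw [hF.v _ (hR .xc (by decide)), H.xc]
  hi := by rw [hF.v _ (hR .hi (by decide)), H.hi]
  l := by rw [hF.v _ (hR .l (by decide)), H.l]

namespace Cmd

variable {hi : ℕ}

/-- A single digit sequence is used for all cliques at once, so one pass over the edges evaluates it
in each of them. -/
theorem costs_spec (room : Room mc E) (H : Ready E X s t k l hi h) (hl : l ≤ E.n)
    (hd : ∀ r, h.a .dig r ≤ l) (h0 : ∀ o < E.n, h.a .cost o = 0) :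
    Tri mc costs h (E.m * (3 * pieceSize) + 2 * pieceSize) fun h' =>
      Frame [.e, .u, .v, .fu, .fv, .fw] [.cost] h h' ∧
      ∀ o < E.n, h'.a .cost o = E.costAt X (h.a .rep) (h.a .slot) (h.a .dig) o := by
  have lin := room.lin
  refine (Tri.forTo (T := pieceSize) (by decide) (fun j h' => h'.v .e = j ∧
    Frame [.e, .u, .v, .fu, .fv, .fw] [.cost] h h' ∧
      ∀ o < E.n, h'.a .cost o = E.costUpTo X (h.a .rep) (h.a .slot) (h.a .dig) o j) E.m
    (by omega) ?_ ?_ ?_ ?_).mono (by unfold pieceSize; omega) fun _ h => h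
  · simpa [EdgeList.costUpTo] using h0
  · rintro j h' ⟨h1, h2, -⟩
    simp [h1, h2.v .m, H.base.m]
  · rintro j hj h' ⟨h1, h2, h3⟩
    have hf := E.fst_lt j hj
    have hs := E.snd_lt j hj
    have H' := H.of_frame h2 (by decide) (by decide)
    have r1 := H.slots.rep_lt _ hf
    have r2 := H.slots.rep_lt _ hs
    have d1 := hd (h.a .slot (E.fst j))
    have d2 := hd (h.a .slot (E.snd j))
    have hcost : ∀ o, E.costUpTo X (h.a .rep) (h.a .slot) (h.a .dig) o (j + 1) =
        E.costUpTo X (h.a .rep) (h.a .slot) (h.a .dig) o j +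
        if E.owner X (h.a .rep) j = o then jump (h.a .dig (h.a .slot (E.fst j)))
          (h.a .dig (h.a .slot (E.snd j))) else 0 := fun o => Finset.sum_range_succ _ _
    have hcf := E.costUpTo_le X (h.a .rep) (h.a .slot) (h.a .dig) (h.a .rep (E.fst j)) j
    have hcs := E.costUpTo_le X (h.a .rep) (h.a .slot) (h.a .dig) (h.a .rep (E.snd j)) j
    refine Tri.of_wp (by decide) ?_
    simp [wp, loadEdge, Cmd.when, h1, H'.base.fst j hj, H'.base.snd j hj,
      H'.del.eq_zero_iff hf, h2.a .rep, h2.a .slot, h2.a .dig, h3 _ r1, h3 _ r2]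
    refine ⟨by omega, by omega, by omega, by omega, fun hfX => ⟨by omega, fun hj1 => ?_,
      fun hj1 hj2 => ?_⟩, fun hfX => ⟨by omega, fun hj1 => ?_, fun hj1 hj2 => ?_⟩⟩
    all_goals
      simp only [owner, hfX, if_true, if_false, jump] at hcost
    · refine ⟨by omega, by simp (maxDischargeDepth := 20) [h2], fun o ho => ?_⟩
      have := h3 o ho
      rw [hcost]
      grind
    · refine ⟨by simp (maxDischargeDepth := 20) [h2], fun o ho => ?_⟩
      have := h3 o ho
      rw [hcost]
      grind
    · refine ⟨by omega, by simp (maxDischargeDepth := 20) [h2], fun o ho => ?_⟩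
      have := h3 o ho
      rw [hcost]
      grind
    · refine ⟨by simp (maxDischargeDepth := 20) [h2], fun o ho => ?_⟩
      have := h3 o ho
      rw [hcost]
      grind
  · rintro h' ⟨_, h2, h3⟩
    exact ⟨h2, h3⟩

end Cmd

end

end MVE

namespace MVE

open EdgeList

/-! ### The two nested enumerations -/

section

variable {mc : Machine} {E : EdgeList} {s t k l hi : ℕ} {h : St} {X : Finset ℕ}

namespace Cmd

theorem fill_spec {r : Arr} {e : Exp} {b : ℕ}
    (hre : r = .best ∧ e = .var .m ∧ b = E.m ∨ r = .cost ∧ e = 0 ∧ b = 0)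
    (room : Room mc E) (hB : Base E s t k h) :
    Tri mc (forTo .i (.var .n) (put r (.var .i) e)) h (E.n * (3 * pieceSize) + 2 * pieceSize)
      fun h' => Frame [.i] [r] h h' ∧ ∀ o < E.n, h'.a r o = b := by
  have lin := room.lin
  refine (Tri.forTo (T := pieceSize) (by decide) (fun j h' => h'.v .i = j ∧
    Frame [.i] [r] h h' ∧ ∀ o < j, h'.a r o = b) E.n
    (by omega) ?_ ?_ ?_ ?_).mono (by unfold pieceSize; omega) fun _ h => h
  · simp
  · rintro j h' ⟨h1, h2, -⟩
    simp [h1, h2.v .n, hB.n]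
  · rintro j hj h' ⟨h1, h2, h3⟩
    have hm : h'.v .m = E.m := by rw [h2.v _ (by decide), hB.m]
    rcases hre with ⟨rfl, rfl, rfl⟩ | ⟨rfl, rfl, rfl⟩
    · refine Tri.of_wp (by decide) ?_
      simp [wp, h1, hm]
      exact ⟨by omega, by simp (maxDischargeDepth := 20) [h2], by grind⟩
    · refine Tri.of_wp (by decide) ?_
      simp [wp, h1]
      exact ⟨by simp (maxDischargeDepth := 20) [h2], by grind⟩
  · rintro h' ⟨_, h2, h3⟩
    exact ⟨h2, h3⟩

theorem lowerBest_spec (room : Room mc E) (hB : Base E s t k h)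
    (hc : ∀ o < E.n, h.a .cost o ≤ mc.M) :
    Tri mc (forTo .i (.var .n) (lower .best (.var .i) (.get .cost (.var .i)))) h
      (E.n * (3 * pieceSize) + 2 * pieceSize) fun h' =>
        Frame [.i] [.best] h h' ∧ ∀ o < E.n, h'.a .best o = min (h.a .best o) (h.a .cost o) := by
  have lin := room.lin
  refine (Tri.forTo (T := pieceSize) (by decide) (fun j h' => h'.v .i = j ∧
    Frame [.i] [.best] h h' ∧
      ∀ o, h'.a .best o = if o < j then min (h.a .best o) (h.a .cost o) else h.a .best o) E.n
    (by omega) ?_ ?_ ?_ ?_).mono (by unfold pieceSize; omega) fun _ h => h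
  · simp
  · rintro j h' ⟨h1, h2, -⟩
    simp [h1, h2.v .n, hB.n]
  · rintro j hj h' ⟨h1, h2, h3⟩
    have := hc j hj
    refine Tri.of_wp (by decide) ?_
    simp [h1, h2.a .cost]
    refine ⟨fun _ => this, by simp (maxDischargeDepth := 20) [h2], fun o => ?_⟩
    have := h3 o
    grind
  · rintro h' ⟨_, h2, h3⟩
    exact ⟨h2, fun o ho => by rw [h3, if_pos ho]⟩

/-- The effect of trying all labels of the cliques. -/
structure InnerPost (E : EdgeList) (X : Finset ℕ) (l hi : ℕ) (h h' : St) : Prop where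
  frame : Frame [.i, .e, .u, .v, .fu, .fv, .fw, .j, .carry, .goInner] [.best, .cost, .dig] h h'
  ext : Extension X l (h.a .dig) (h'.a .dig)
  zero : digitValue (l + 1) X.card hi (h'.a .dig) = 0
  isBest : E.IsBest X (h.a .rep) (h.a .slot) l (h.a .dig) (h'.a .best)
  le : ∀ o < E.n, h'.a .best o ≤ E.m

/-- After `j` rounds, `best` is a lower bound for the costs of all sequences with value below `j`,
and it is attained or still has its initial value. The upper digits return to zero by wrap-around,
ready for the next call. -/
theorem inner_spec (room : Room mc E) (H : Ready E X s t k l hi h) (hl : l ≤ E.n)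
    (hcard : X.card ≤ hi) (hhi : hi ≤ 2 * (E.n + E.m)) (hd : ∀ r, h.a .dig r ≤ l)
    (hd0 : digitValue (l + 1) X.card hi (h.a .dig) = 0) :
    Tri mc inner h ((l + 1) ^ (hi - X.card) * (30 * (E.n + E.m + 2) * pieceSize) +
      10 * (E.n + E.m + 2) * pieceSize) (InnerPost E X l hi h) := by
  have lin := room.lin
  set rep := h.a .rep with hrep
  set slot := h.a .slot with hslot
  set f := h.a .dig with hf
  set K := (l + 1) ^ (hi - X.card) with hK
  have hKpos : 0 < K := by positivity
  refine ((fill_spec (.inl ⟨rfl, rfl, rfl⟩) room H.base).seq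
    (T₂ := pieceSize + (K * (29 * (E.n + E.m + 2) * pieceSize + pieceSize) + pieceSize))
    fun h1 ⟨hF1, hbest1⟩ => ?_).mono ?_ fun _ h => h
  swap
  · rw [show 30 * (E.n + E.m + 2) * pieceSize =
      29 * (E.n + E.m + 2) * pieceSize + (E.n + E.m + 2) * pieceSize by ring,
      Nat.mul_add K, Nat.mul_add K]
    have h1 : K * pieceSize ≤ K * ((E.n + E.m + 2) * pieceSize) :=
      Nat.mul_le_mul_left _ (Nat.le_mul_of_pos_left _ (by omega))
    have h2 : E.n * (3 * pieceSize) + 4 * pieceSize ≤ 10 * (E.n + E.m + 2) * pieceSize := by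
      unfold pieceSize
      omega
    generalize K * (29 * (E.n + E.m + 2) * pieceSize) = a at *
    generalize K * ((E.n + E.m + 2) * pieceSize) = b at *
    generalize K * pieceSize = c at *
    generalize 10 * (E.n + E.m + 2) * pieceSize = d at *
    generalize E.n * (3 * pieceSize) = e at *
    omega
  have s2 : Tri mc (set .goInner 1) h1 pieceSize fun h' => h' = h1.set .goInner 1 :=
    Tri.of_wp (by decide) (by simp [wp]; omega)
  refine s2.seq fun h2 hh2 => ?_
  refine Tri.loop (by decide) (fun j h' =>
    Frame [.i, .e, .u, .v, .fu, .fv, .fw, .j, .carry, .goInner] [.best, .cost, .dig] h h' ∧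
    Extension X l f (h'.a .dig) ∧
    ((h'.v .goInner = 1 ∧ digitValue (l + 1) X.card hi (h'.a .dig) = j ∧ j < K) ∨
      (h'.v .goInner = 0 ∧ digitValue (l + 1) X.card hi (h'.a .dig) = 0 ∧ j = K)) ∧
    ∀ o < E.n, h'.a .best o ≤ E.m ∧
      (∀ d, Extension X l f d → digitValue (l + 1) X.card hi d < j →
        h'.a .best o ≤ E.costAt X rep slot d o) ∧
      (h'.a .best o = E.m ∨ ∃ d, Extension X l f d ∧ h'.a .best o = E.costAt X rep slot d o))
    K ?_ ?_ ?_ ?_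
  · subst hh2
    refine ⟨?_, ?_, ?_, ?_⟩
    · refine Frame.set (hF1.mono (by decide) (by decide)) _ (by decide)
    · simp only [St.set_a, hF1.a .dig (by decide)]
      exact ⟨hd, fun _ _ => rfl⟩
    · left
      simp only [St.set_a, hF1.a .dig (by decide)]
      exact ⟨by simp, hd0, hKpos⟩
    · intro o ho
      simp [hbest1 o ho]
  · rintro j h' ⟨-, -, hv, -⟩ he
    simp at he
    omega
  · rintro j h3 ⟨hF3, hx3, hv3, hb3⟩ he
    simp at he
    obtain ⟨_, hv3, hj⟩ := hv3.resolve_right fun h => he h.1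
    clear he
    have H3 := H.of_frame hF3 (by decide) (by decide)
    refine ((fill_spec (.inr ⟨rfl, rfl, rfl⟩) room H3.base).seq
      (T₂ := E.m * (3 * pieceSize) + 2 * pieceSize + (E.n * (3 * pieceSize) + 2 * pieceSize +
        (hi * (3 * pieceSize) + 4 * pieceSize)))
      fun h4 ⟨hF4, hc4⟩ => ?_).mono ?_ fun _ h => h
    swap
    · unfold pieceSize
      omega
    have H4 := H3.of_frame hF4 (by decide) (by decide)
    have hdig4 : h4.a .dig = h3.a .dig := hF4.a _ (by decide)
    refine (costs_spec room H4 hl (by rw [hdig4]; exact hx3.1) hc4).seq fun h5 ⟨hF5, hc5⟩ => ?_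
    have H5 := H4.of_frame hF5 (by decide) (by decide)
    have hdig5 : h5.a .dig = h3.a .dig := by rw [hF5.a _ (by decide), hdig4]
    have hrep4 : h4.a .rep = rep := by rw [hF4.a _ (by decide), hF3.a _ (by decide)]
    have hslot4 : h4.a .slot = slot := by rw [hF4.a _ (by decide), hF3.a _ (by decide)]
    have hbest5 : h5.a .best = h3.a .best := by rw [hF5.a _ (by decide), hF4.a _ (by decide)]
    rw [hrep4, hslot4, hdig4] at hc5
    refine (lowerBest_spec room H5.base (fun o ho => by
      rw [hc5 o ho]
      have := E.costUpTo_le X rep slot (h3.a .dig) o E.m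
      unfold costAt
      omega)).seq fun h6 ⟨hF6, hb6⟩ => ?_
    have H6 := H5.of_frame hF6 (by decide) (by decide)
    have hdig6 : h6.a .dig = h3.a .dig := by rw [hF6.a _ (by decide), hdig5]
    refine (next_spec (go := .goInner) H6.l (by omega) (b := hi) (by omega) hcard
      (fun h' hF => by rw [Exp.eval_var, hF.v _ (by decide), H6.xc])
      (fun h' hF => by rw [Exp.eval_var, hF.v _ (by decide), H6.hi])
      (.inr rfl) (.inr rfl) (by rw [hdig6]; exact hx3.1)).mono le_rfl
      fun h7 ⟨hF7, hd7, hr7, hv7⟩ => ?_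
    rw [hdig6] at hr7 hv7
    have hbest7 : ∀ o < E.n, h7.a .best o =
        min (h3.a .best o) (E.costAt X rep slot (h3.a .dig) o) := by
      intro o ho
      rw [hF7.a _ (by decide), hb6 o ho, hbest5, hc5 o ho]
    refine ⟨hF3.trans ((hF4.mono (by decide) (by decide)).trans
      ((hF5.mono (by decide) (by decide)).trans ((hF6.mono (by decide) (by decide)).trans
        (hF7.mono (by decide) (by decide))))), ⟨hd7, fun r hr => ?_⟩, ?_, ?_⟩
    · rw [hr7 r (.inl hr)]
      exact hx3.2 r hr
    · have := digitValue_lt hcard hd7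
      omega
    · intro o ho
      rw [hbest7 o ho]
      obtain ⟨b1, b2, b3⟩ := hb3 o ho
      refine ⟨(min_le_left _ _).trans b1, fun d hd hdj => ?_, ?_⟩
      · rcases Nat.lt_succ_iff_lt_or_eq.1 hdj with hdj | hdj
        · exact (min_le_left _ _).trans (b2 d hd hdj)
        · refine (min_le_right _ _).trans (le_of_eq ?_)
          -- A sequence with value `j` has the current digits in all slots below `hi`, hence the
          -- current cost.
          have := digitValue_inj hx3.1 hd.1 (hv3.trans hdj.symm)
          refine H.slots.costAt_congr hcard (fun r hr => ?_) o
          by_cases hrx : r < X.card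
          · rw [hx3.2 r hrx, hd.2 r hrx]
          · exact this r (by omega) hr
      · rcases min_choice (h3.a .best o) (E.costAt X rep slot (h3.a .dig) o) with e | e <;> rw [e]
        · exact b3
        · exact .inr ⟨_, hx3, rfl⟩
  · rintro j h' ⟨hF, hx, hv, hb⟩ he
    simp at he
    obtain ⟨_, hz, rfl⟩ := hv.resolve_left fun h => by omega
    refine ⟨hF, hx, hz, fun o ho => ?_, fun o ho => (hb o ho).1⟩
    obtain ⟨b1, b2, b3⟩ := hb o ho
    have hall : ∀ d, Extension X l f d → h'.a .best o ≤ E.costAt X rep slot d o :=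
      fun d hd => b2 d hd (digitValue_lt hcard hd.1)
    refine ⟨hall, ?_⟩
    rcases b3 with b3 | b3
    -- The initial value `E.m` bounds every cost from above, so if it survives as a lower bound,
    -- then any extension attains it, for example `f`.
    · refine ⟨f, ⟨hd, fun _ _ => rfl⟩, le_antisymm (hall f ⟨hd, fun _ _ => rfl⟩) ?_⟩
      rw [b3]
      exact E.costUpTo_le _ _ _ _ _ _
    · exact b3

/-- Partial sums may reach `E.n * E.m`, the reason for the quadratic bound in `Room`. -/
theorem sumBest_spec (room : Room mc E) (hB : Base E s t k h) (h0 : h.v .sum = 0)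
    (hb : ∀ o < E.n, h.a .best o ≤ E.m) :
    Tri mc (forTo .i (.var .n) (set .sum (.var .sum + .get .best (.var .i)))) h
      (E.n * (3 * pieceSize) + 2 * pieceSize) fun h' =>
        Frame [.i, .sum] [] h h' ∧ h'.v .sum = ∑ o ∈ Finset.range E.n, h.a .best o := by
  have lin := room.lin
  have mul := room.mul
  refine (Tri.forTo (T := pieceSize) (by decide) (fun j h' => h'.v .i = j ∧
    Frame [.i, .sum] [] h h' ∧ h'.v .sum = ∑ o ∈ Finset.range j, h.a .best o) E.n
    (by omega) ?_ ?_ ?_ ?_).mono (by unfold pieceSize; omega) fun _ h => h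
  · simp [h0]
  · rintro j h' ⟨h1, h2, -⟩
    simp [h1, h2.v .n, hB.n]
  · rintro j hj h' ⟨h1, h2, h3⟩
    have hsum : ∑ o ∈ Finset.range (j + 1), h.a .best o ≤ E.n * E.m := by
      calc _ ≤ ∑ o ∈ Finset.range (j + 1), E.m :=
            Finset.sum_le_sum fun o ho => hb o (by simp at ho; omega)
        _ = (j + 1) * E.m := by simp
        _ ≤ _ := Nat.mul_le_mul_right _ hj
    rw [Finset.sum_range_succ] at hsum
    refine Tri.of_wp (by decide) ?_
    simp [wp, h1, h2.a .best, h3, Finset.sum_range_succ]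
    exact ⟨by omega, by simp (maxDischargeDepth := 20) [h2]⟩
  · rintro h' ⟨_, h2, h3⟩
    exact ⟨h2, h3⟩

/-- The answer becomes `1` only in the presence of an actual extension. If it stays `0` to the end,
all label sequences on `X` have been refuted, and `hasLabeling_iff` applies. -/
theorem outer_spec (room : Room mc E) (H : Ready E X s t k l hi h) (hl : l ≤ E.n)
    (hs : s ∈ X) (ht : t ∈ X)
    (hcard : X.card ≤ hi) (hhi : hi ≤ 2 * (E.n + E.m)) (hd : ∀ r, h.a .dig r = 0) :
    Tri mc outer h ((l + 1) ^ X.card * ((l + 1) ^ (hi - X.card) *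
      (30 * (E.n + E.m + 2) * pieceSize) + 30 * (E.n + E.m + 2) * pieceSize) + 2 * pieceSize)
      fun h' => (E.HasLabeling s t k l → h'.v .ans = 1) ∧
        (¬ E.HasLabeling s t k l → h'.v .ans = 0) := by
  have lin := room.lin
  set rep := h.a .rep with hrep
  set slot := h.a .slot with hslot
  set K := (l + 1) ^ X.card with hK
  have hKpos : 0 < K := by positivity
  have hcn : X.card ≤ E.n := by simpa using Finset.card_le_card H.slots.sub
  have hsn : s < E.n := by simpa using H.slots.sub hs
  have htn : t < E.n := by simpa using H.slots.sub ht
  have s1 : Tri mc (set .ans 0 ;; set .goOuter 1) h pieceSize fun h' =>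
      h' = (h.set .ans 0).set .goOuter 1 := Tri.of_wp (by decide) (by simp [wp]; omega)
  refine (s1.seq (T₂ := K * (((l + 1) ^ (hi - X.card) * (30 * (E.n + E.m + 2) * pieceSize) +
      10 * (E.n + E.m + 2) * pieceSize + (pieceSize + (E.n * (3 * pieceSize) + 2 * pieceSize +
      (pieceSize + (X.card * (3 * pieceSize) + 4 * pieceSize))))) + pieceSize) + pieceSize)
      fun h1 hh1 => ?_).mono ?_ fun _ h => h
  swap
  · have : K * (((l + 1) ^ (hi - X.card) * (30 * (E.n + E.m + 2) * pieceSize) +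
      10 * (E.n + E.m + 2) * pieceSize + (pieceSize + (E.n * (3 * pieceSize) + 2 * pieceSize +
      (pieceSize + (X.card * (3 * pieceSize) + 4 * pieceSize))))) + pieceSize) ≤
      K * ((l + 1) ^ (hi - X.card) *
      (30 * (E.n + E.m + 2) * pieceSize) + 30 * (E.n + E.m + 2) * pieceSize) := by
      refine Nat.mul_le_mul_left _ ?_
      generalize (l + 1) ^ (hi - X.card) * (30 * (E.n + E.m + 2) * pieceSize) = a
      unfold pieceSize
      omega
    omega
  refine Tri.loop (by decide) (fun j h' =>
    Frame [.i, .e, .u, .v, .fu, .fv, .fw, .j, .carry, .goInner, .sum, .ans, .goOuter]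
      [.best, .cost, .dig] h h' ∧ (∀ r, h'.a .dig r ≤ l) ∧
    digitValue (l + 1) X.card hi (h'.a .dig) = 0 ∧
    ((h'.v .goOuter = 1 ∧ digitValue (l + 1) 0 X.card (h'.a .dig) = j ∧ j < K) ∨
      (h'.v .goOuter = 0 ∧ j = K)) ∧
    ((h'.v .ans = 1 ∧ E.HasLabeling s t k l) ∨ (h'.v .ans = 0 ∧ ∀ f, (∀ r, f r ≤ l) →
      digitValue (l + 1) 0 X.card f < j → ¬ E.Extends X rep slot s t k l f))) K ?_ ?_ ?_ ?_
  · subst hh1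
    refine ⟨by simp (maxDischargeDepth := 20), by simp [hd], ?_, .inl ⟨by simp, ?_, hKpos⟩,
      .inr ⟨by simp, fun f _ h => by omega⟩⟩
    · simp [digitValue, hd]
    · simp [digitValue, hd]
  · rintro j h' ⟨-, -, -, hv, -⟩ he
    simp at he
    omega
  · rintro j h2 ⟨hF2, hd2, hz2, hv2, ha2⟩ he
    simp at he
    obtain ⟨_, hv2, hj⟩ := hv2.resolve_right fun h => he h.1
    clear he
    have H2 := H.of_frame hF2 (by decide) (by decide)
    refine (inner_spec room H2 hl hcard hhi hd2 hz2).seq fun h3 P3 => ?_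
    have H3 := H2.of_frame P3.frame (by decide) (by decide)
    have hrep2 : h2.a .rep = rep := hF2.a _ (by decide)
    have hslot2 : h2.a .slot = slot := hF2.a _ (by decide)
    have hslots : E.IsSlots X rep slot hi := H.slots
    have hbest := P3.isBest
    rw [hrep2, hslot2] at hbest
    have s4 : Tri mc (set .sum 0) h3 pieceSize fun h' => h' = h3.set .sum 0 :=
      Tri.of_wp (by decide) (by simp [wp])
    refine s4.seq fun h4 hh4 => ?_
    have hF4 : Frame [.sum] [] h3 h4 := by subst hh4; simp
    have H4 := H3.of_frame hF4 (by decide) (by decide)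
    refine (sumBest_spec room H4.base (by subst hh4; simp)
      (by rw [hF4.a _ (by decide)]; exact P3.le)).seq fun h5 ⟨hF5, hsum⟩ => ?_
    rw [hF4.a _ (by decide)] at hsum
    have H5 := H4.of_frame hF5 (by decide) (by decide)
    have hdig5 : h5.a .dig = h3.a .dig := by rw [hF5.a _ (by decide), hF4.a _ (by decide)]
    have hslot5 : h5.a .slot = slot := by
      rw [hF5.a _ (by decide), hF4.a _ (by decide), P3.frame.a _ (by decide), hslot2]
    have hans5 : h5.v .ans = h2.v .ans := by
      rw [hF5.v _ (by decide), hF4.v _ (by decide), P3.frame.v _ (by decide)]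
    have hcond : E.Extends X rep slot s t k l (h2.a .dig) ↔
        h5.v .sum ≤ k ∧ h5.a .dig (slot s) = 0 ∧ h5.a .dig (slot t) = l := by
      rw [hbest.extends_iff hd2, hsum, hdig5, P3.ext.2 _ (hslots.slot_lt s hs),
        P3.ext.2 _ (hslots.slot_lt t ht)]
      tauto
    have s6 : Tri mc (when (.lt (.var .sum) (.var .k + 1) *
        .eq (.get .dig (.get .slot (.var .s))) 0 *
        .eq (.get .dig (.get .slot (.var .t))) (.var .l)) (set .ans 1)) h5 pieceSize fun h' =>
          Frame [.ans] [] h5 h' ∧ ((E.Extends X rep slot s t k l (h2.a .dig) ∧ h'.v .ans = 1) ∨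
            (¬ E.Extends X rep slot s t k l (h2.a .dig) ∧ h'.v .ans = h5.v .ans)) := by
      refine Tri.of_wp (by decide) ?_
      rw [hcond]
      simp [wp, Cmd.when, H5.base.k, H5.base.s, H5.base.t, H5.l, hslot5]
      refine ⟨fun a1 a2 a3 => ⟨by omega, ?_⟩, fun a1 => ?_⟩
      · left
        exact ⟨by omega, by omega, by omega⟩
      · grind
    refine s6.seq fun h6 ⟨hF6, ha6⟩ => ?_
    have H6 := H5.of_frame hF6 (by decide) (by decide)
    have hdig6 : h6.a .dig = h3.a .dig := by rw [hF6.a _ (by decide), hdig5]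
    refine (next_spec (go := .goOuter) H6.l (by omega) (a := 0) (b := X.card) (by omega)
      (by omega) (fun h' hF => Exp.eval_zero _)
      (fun h' hF => by rw [Exp.eval_var, hF.v _ (by decide), H6.xc])
      (.inl rfl) (.inl rfl) (by rw [hdig6]; exact P3.ext.1)).mono le_rfl
      fun h7 ⟨hF7, hd7, hr7, hv7⟩ => ?_
    rw [hdig6] at hr7 hv7
    have hans7 : h7.v .ans = h6.v .ans := hF7.v _ (by decide)
    have hval : digitValue (l + 1) 0 X.card (h3.a .dig) = j := by
      rw [← hv2]
      exact digitValue_congr fun r _ hr => P3.ext.2 r hr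
    rw [hval] at hv7
    refine ⟨hF2.trans ((P3.frame.mono (by decide) (by decide)).trans
      ((hF4.mono (by decide) (by decide)).trans ((hF5.mono (by decide) (by decide)).trans
        ((hF6.mono (by decide) (by decide)).trans (hF7.mono (by decide) (by decide)))))),
        hd7, ?_, ?_, ?_⟩
    -- Advancing the digits of `X` does not touch those of the classes, which `inner` left at zero.
    · rw [← P3.zero]
      exact digitValue_congr fun r hr _ => hr7 r (.inr hr)
    · have := digitValue_lt (Nat.zero_le X.card) hd7
      simp only [Nat.sub_zero] at hv7 this
      omega
    · rw [hans7]
      rcases ha6 with ⟨hE, ha6⟩ | ⟨hE, ha6⟩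
      · exact .inl ⟨ha6, (hasLabeling_iff hslots hs ht).2 ⟨_, hd2, hE⟩⟩
      · rw [ha6, hans5]
        refine ha2.imp id fun ⟨a1, a2⟩ => ⟨a1, fun f hf hfj hfE => ?_⟩
        rcases Nat.lt_succ_iff_lt_or_eq.1 hfj with hfj | hfj
        · exact a2 f hf hfj hfE
        · have := digitValue_inj hf hd2 (hfj.trans hv2.symm)
          exact hE (hfE.congr hslots hs ht fun r hr => this r (by omega) hr)
  · rintro j h' ⟨-, -, -, hv, ha⟩ he
    simp at he
    obtain ⟨_, rfl⟩ := hv.resolve_left fun h => by omega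
    have hslots : E.IsSlots X rep slot hi := H.slots
    rcases ha with ⟨a1, a2⟩ | ⟨a1, a2⟩
    · exact ⟨fun _ => a1, fun h => (h a2).elim⟩
    · refine ⟨fun hL => ?_, fun _ => a1⟩
      obtain ⟨f, hf, hE⟩ := (hasLabeling_iff hslots hs ht).1 hL
      have := digitValue_lt (Nat.zero_le X.card) hf
      simp only [Nat.sub_zero] at this
      exact (a2 f hf this hE).elim

end Cmd

end

end MVE

namespace MVE

open EdgeList

/-! ## Correctness and running time of the algorithm -/

/-- The number of label sequences that the algorithm tries, for at most `a` deleted vertices. -/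
theorem pow_labels_le {a xc hi l : ℕ} (ha : xc ≤ a) (hhi : hi ≤ xc + 2 ^ xc)
    (hl : l ≤ xc * (hi - xc + 1)) : (l + 1) ^ hi ≤ 2 ^ 2 ^ (2 * a + 3) := by
  have h1 : 2 ^ xc ≤ 2 ^ a := Nat.pow_le_pow_right (by omega) ha
  have h2 : a < 2 ^ a := Nat.lt_two_pow_self
  -- With `b = 2 ^ a > a`, the quantity `a * (b + 1) + 1` is at most `2 * b ^ 3`.
  have hl2 : l + 1 ≤ 2 ^ (3 * a + 1) := by
    have h3 : l ≤ a * (2 ^ a + 1) := hl.trans (Nat.mul_le_mul ha (by omega))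
    have h4 : 2 ^ (3 * a + 1) = 2 * (2 ^ a * 2 ^ a * 2 ^ a) := by
      rw [pow_succ, show 3 * a = a + a + a by ring, pow_add, pow_add]; ring
    rw [h4]
    generalize 2 ^ a = b at *
    have h5 : 1 ≤ b := by omega
    have h6 : a * (b + 1) + (b + 1) ≤ b * (b + 1) := by
      rw [← Nat.succ_mul]
      exact Nat.mul_le_mul_right _ h2
    have h7 : b ≤ b * b := Nat.le_mul_self b
    have h8 : b * b ≤ b * b * b := Nat.le_mul_of_pos_right _ h5
    rw [mul_add b b 1] at h6
    omega
  have hhi2 : hi ≤ 2 ^ (a + 1) := by rw [pow_succ]; omega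
  calc (l + 1) ^ hi ≤ (2 ^ (3 * a + 1)) ^ 2 ^ (a + 1) :=
        (Nat.pow_le_pow_left hl2 _).trans (Nat.pow_le_pow_right (by positivity) hhi2)
    _ = 2 ^ ((3 * a + 1) * 2 ^ (a + 1)) := (pow_mul _ _ _).symm
    _ ≤ 2 ^ (2 ^ (a + 2) * 2 ^ (a + 1)) := by
        refine Nat.pow_le_pow_right (by omega) (Nat.mul_le_mul_right _ ?_)
        rw [pow_add]
        omega
    _ = 2 ^ 2 ^ (2 * a + 3) := by rw [← pow_add]; congr 2; ring

section

variable {mc : Machine} {E : EdgeList} {s t k l : ℕ} {h : St}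

/-- The input numbers `k` and `l` are assumed to be clipped already. The set `Y` only bounds the
time and is unknown to the program. -/
theorem Cmd.main_spec (room : Room mc E) (hs : s < E.n) (ht : t < E.n) (hk : k ≤ E.m)
    (hl : l ≤ E.n) (hD : mc.D = 6 + 2 * E.m) (h0 : ∀ r i, h.a r i = 0)
    (i0 : mc.inp 0 = E.n) (i1 : mc.inp 1 = E.m) (i2 : mc.inp 2 = s) (i3 : mc.inp 3 = t)
    (i4 : mc.inp 4 = k) (i5 : mc.inp 5 = l)
    (hinp : ∀ i < E.m, mc.inp (6 + 2 * i) = E.fst i ∧ mc.inp (7 + 2 * i) = E.snd i)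
    {Y : Finset ℕ} (hY : E.IsCluster Y) :
    Tri mc main h ((E.n + E.m + 2) * pieceSize *
      (100 * 2 ^ 2 ^ (6 * Y.card + 7) + 30 * Y.card + 200)) fun h' =>
        (E.HasLabeling s t k l → h'.v .ans = 1) ∧
        (¬ E.HasLabeling s t k l → h'.v .ans = 0) := by
  have lin := room.lin
  set P := pieceSize with hP
  set W := (E.n + E.m + 2) * P with hW
  have hPW : P ≤ W := Nat.le_mul_of_pos_left _ (by omega)
  have hWn : E.n * P + E.m * P + 2 * P = W := by rw [hW]; ring
  have s1 : Tri mc (read .n 0 ;; read .m 1 ;; read .s (1 + 1) ;; read .t (1 + 1 + 1) ;;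
      read .k (1 + 1 + 1 + 1) ;; read .l (1 + 1 + 1 + 1 + 1)) h P fun h' =>
      Frame [.n, .m, .s, .t, .k, .l] [] h h' ∧ h'.v .n = E.n ∧ h'.v .m = E.m ∧ h'.v .s = s ∧
      h'.v .t = t ∧ h'.v .k = k ∧ h'.v .l = l := by
    refine Tri.of_wp (by decide) ?_
    simp [wp, i0, i1, i2, i3, i4, i5, hD]
    refine ⟨by omega, by omega, by omega, by omega, by omega, by omega, ?_⟩
    simp (maxDischargeDepth := 20)
  -- The factor `62 = 30 + 30 + 2` of the last summand covers the inner enumerations, the other work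
  -- of the outer rounds and the final overhead.
  refine (s1.seq (T₂ := E.m * (3 * P) + 2 * P + (
      ((Y.card + 1) * (10 * (E.n + E.m + 2) * P) + 2 * P) + ((E.n * (3 * P) + 3 * P) +
      ((E.n * (3 * P) + 2 * P) + ((E.m * ((3 * Y.card + 5) * (3 * P)) + 2 * P) +
      ((E.m * (3 * P) + 2 * P) + ((E.n * (3 * P) + 3 * P) + (P +
      (62 * 2 ^ 2 ^ (6 * Y.card + 7)) * W))))))))
    fun h1 ⟨F1, n1, m1, s1, t1, k1, l1⟩ => ?_).mono ?_ fun _ h => h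
  swap
  · have e1 : (Y.card + 1) * (10 * (E.n + E.m + 2) * P) = 10 * (Y.card * W) + 10 * W := by
      rw [hW]; ring
    have e2 : E.m * ((3 * Y.card + 5) * (3 * P)) ≤ 9 * (Y.card * W) + 15 * W := by
      have : E.m * P ≤ W := by omega
      calc _ = (9 * Y.card + 15) * (E.m * P) := by ring
        _ ≤ (9 * Y.card + 15) * W := Nat.mul_le_mul_left _ this
        _ = _ := by ring
    have e3 : W * (100 * 2 ^ 2 ^ (6 * Y.card + 7) + 30 * Y.card + 200) =
        100 * (2 ^ 2 ^ (6 * Y.card + 7) * W) + 30 * (Y.card * W) + 200 * W := by ring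
    have e4 : 62 * 2 ^ 2 ^ (6 * Y.card + 7) * W = 62 * (2 ^ 2 ^ (6 * Y.card + 7) * W) := by ring
    have e5 : E.m * (3 * P) = 3 * (E.m * P) := by ring
    have e6 : E.n * (3 * P) = 3 * (E.n * P) := by ring
    rw [e1, e3, e4, e5, e6]
    generalize 2 ^ 2 ^ (6 * Y.card + 7) * W = a at *
    generalize Y.card * W = b at *
    generalize E.n * P = c at *
    generalize E.m * ((3 * Y.card + 5) * (3 * P)) = d at *
    generalize E.m * P = e at *
    clear_value W P
    omega
  refine (readEdges_spec room n1 m1 (by rw [F1.a _ (by decide)]; exact h0 _) fun i hi =>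
    ⟨by omega, hinp i hi⟩).seq fun h2 ⟨F2, f2, g2, a2⟩ => ?_
  have B2 : Base E s t k h2 := ⟨by rw [F2.v _ (by decide), n1], by rw [F2.v _ (by decide), m1],
    by rw [F2.v _ (by decide), s1], by rw [F2.v _ (by decide), t1],
    by rw [F2.v _ (by decide), k1], f2, g2, a2⟩
  refine (packing_spec room B2 hs ht (by rw [F2.a _ (by decide), F1.a _ (by decide)]; exact h0 _)
    hY).seq fun h3 ⟨F3, X, D3, hsX, htX, hXY, hX, hrep⟩ => ?_
  have B3 := B2.of_frame F3 (by decide) (by decide)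
  refine (numberDeleted_spec room B3 D3).seq fun h4 ⟨F4, xc4, sl4, xs4⟩ => ?_
  have B4 := B3.of_frame F4 (by decide) (by decide)
  have D4 := D3.of_frame F4 (by decide)
  refine (initClasses_spec room B4 D4 xc4).seq fun h5 ⟨F5, cl5, sl5⟩ => ?_
  have B5 := B4.of_frame F5 (by decide) (by decide)
  have D5 := D4.of_frame F5 (by decide)
  have xc5 : h5.v .xc = X.card := by rw [F5.v _ (by decide), xc4]
  have xse : h5.a .xs = h4.a .xs := F5.a _ (by decide)
  have hcn : X.card ≤ E.n := by simpa using Finset.card_le_card D3.sub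
  refine ((classes_spec room B5 D5 xc5 (by rw [xse]; exact xs4)
    (fun z hz => ⟨_, (sl4 z hz).1, by rw [xse]; exact (sl4 z hz).2⟩) cl5).mono
    (Nat.add_le_add_right (Nat.mul_le_mul_left _ (Nat.mul_le_mul_right _ (by omega))) _)
    fun _ h => h).seq fun h6 ⟨F6, hcls⟩ => ?_
  have B6 := B5.of_frame F6 (by decide) (by decide)
  have D6 := D5.of_frame F6 (by decide)
  have sl6 : h6.a .slot = h5.a .slot := F6.a _ (by decide)
  have hsl5 : ∀ v < E.n, h5.a .slot v ≤ X.card := by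
    intro v hv
    rw [sl5 v hv]
    split
    next hvX => exact (sl4 v hvX).1.le
    · exact le_rfl
  refine (slots_spec room B6 D6 (fun v hv => by
    rw [sl6]; exact (hsl5 v hv).trans hcn)).seq fun h7 ⟨F7, sl7⟩ => ?_
  have B7 := B6.of_frame F7 (by decide) (by decide)
  have D7 := D6.of_frame F7 (by decide)
  rw [sl6] at sl7
  have xc7 : h7.v .xc = X.card := by rw [F7.v _ (by decide), F6.v _ (by decide), xc5]
  -- Ranks are counted for kept vertices only, so the slots of `X` do not change.
  have hslX : ∀ v ∈ X, h7.a .slot v = h4.a .slot v := by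
    intro v hv
    have hvn : v < E.n := by simpa using D3.sub hv
    rw [sl7 v hvn, sl5 v hvn, if_pos hv, rankUpTo_eq hvn]
    simp [earlier, hv]
  have hslK : ∀ v < E.n, v ∉ X →
      h7.a .slot v = X.card + (E.earlier X (h6.a .cls) v).card := by
    intro v hvn hv
    rw [sl7 v hvn, sl5 v hvn, if_neg hv, rankUpTo_eq hvn]
  have hslb : ∀ v < E.n, h7.a .slot v ≤ X.card + 2 * E.m := by
    intro v hv
    have h1 := hsl5 v hv
    have h2 := rankUpTo_le (E := E) (X := X) (cls := h6.a .cls) E.m v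
    rw [sl7 v hv]
    omega
  have hsl2 : ∀ v < E.n, h7.a .slot v < X.card + 2 ^ X.card := by
    intro v hvn
    by_cases hv : v ∈ X
    · rw [hslX v hv]
      exact (sl4 v hv).1.trans_le (Nat.le_add_right _ _)
    · rw [hslK v hvn hv]
      exact Nat.add_lt_add_left (earlier_card_lt hX hcls hvn hv) _
  refine (maxSlot_spec room B7 (by omega) (fun v hv => by
    have := hslb v hv
    omega)).seq fun h8 ⟨F8, hi8, hxc8, hmax8⟩ => ?_
  have B8 := B7.of_frame F8 (by decide) (by decide)
  have D8 := D7.of_frame F8 (by decide)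
  have xc8 : h8.v .xc = X.card := by rw [F8.v _ (by decide), xc7]
  rw [xc7] at hxc8 hmax8
  have hhi : h8.v .hi ≤ 2 * (E.n + E.m) := by
    rcases hmax8 with h | ⟨v, hv, h⟩
    · omega
    · have := hslb v hv
      omega
  have hhi2 : h8.v .hi ≤ X.card + 2 ^ X.card := by
    rcases hmax8 with h | ⟨v, hv, h⟩
    · exact h.le.trans (Nat.le_add_right _ _)
    · have := hsl2 v hv
      omega
  have l8 : h8.v .l = l := by
    rw [F8.v _ (by decide), F7.v _ (by decide), F6.v _ (by decide), F5.v _ (by decide),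
      F4.v _ (by decide), F3.v _ (by decide), F2.v _ (by decide), l1]
  have rep8 : h8.a .rep = h3.a .rep := by
    rw [F8.a _ (by decide), F7.a _ (by decide), F6.a _ (by decide), F5.a _ (by decide),
      F4.a _ (by decide)]
  have slot8 : h8.a .slot = h7.a .slot := F8.a _ (by decide)
  have dig8 : h8.a .dig = h.a .dig := by
    rw [F8.a _ (by decide), F7.a _ (by decide), F6.a _ (by decide), F5.a _ (by decide),
      F4.a _ (by decide), F3.a _ (by decide), F2.a _ (by decide), F1.a _ (by decide)]
  have hslots : E.IsSlots X (h8.a .rep) (h8.a .slot) (h8.v .hi) := by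
    rw [rep8, slot8]
    refine isSlots_of_rank D3.sub hX hrep hcls (fun x hx => ?_) (fun x hx y hy hxy => ?_) hslK hi8
    · rw [hslX x hx]
      exact (sl4 x hx).1
    · rw [hslX x hx, hslX y hy] at hxy
      rw [← (sl4 x hx).2, ← (sl4 y hy).2, hxy]
  set q := h8.v .hi - X.card with hq
  have s9 : Tri mc (when (.lt distBound (.var .l)) (set .l distBound)) h8 P fun h' =>
      Frame [.l] [] h8 h' ∧ h'.v .l = min l (X.card * (q + 1)) := by
    refine Tri.of_wp (by decide) ?_
    have : distBound.eval h8 = X.card * (q + 1) := by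
      simp [distBound, Exp.eval, WordRAM.Op.eval, xc8, hq]
    simp [wp, Cmd.when, this, l8]
    exact fun hlt => ⟨by omega, hlt.le⟩
  refine s9.seq fun h9 ⟨F9, l9⟩ => ?_
  have R9 : Ready E X s t k (min l (X.card * (q + 1))) (h8.v .hi) h9 := by
    refine ⟨B8.of_frame F9 (by decide) (by decide), D8.of_frame F9 (by decide), ?_, ?_, ?_, l9⟩
    · rw [F9.a _ (by decide), F9.a _ (by decide)]
      exact hslots
    · rw [F9.v _ (by decide), xc8]
    · rw [F9.v _ (by decide)]
  refine (outer_spec room R9 (by omega) hsX htX hxc8 hhi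
    (by rw [F9.a _ (by decide), dig8]; exact h0 _)).mono ?_ fun h' hh => ?_
  -- The set `X` has at most `3 * |Y| + 2` elements, whence the exponent `2 * (3 * |Y| + 2) + 3 = 6
  -- * |Y| + 7`.
  · have hpow := pow_labels_le (a := 3 * Y.card + 2) hXY hhi2
      (min_le_right l (X.card * (h8.v .hi - X.card + 1)))
    rw [← hq, show 2 * (3 * Y.card + 2) + 3 = 6 * Y.card + 7 by ring] at hpow
    generalize min l (X.card * (q + 1)) = l' at *
    have e1 : (l' + 1) ^ X.card * (l' + 1) ^ q = (l' + 1) ^ h8.v .hi := by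
      rw [← pow_add]
      congr 1
      omega
    have e2 : (l' + 1) ^ X.card ≤ (l' + 1) ^ h8.v .hi :=
      Nat.pow_le_pow_right (by omega) hxc8
    have e3 : (l' + 1) ^ X.card * ((l' + 1) ^ q * (30 * (E.n + E.m + 2) * P) +
        30 * (E.n + E.m + 2) * P) = 30 * (((l' + 1) ^ X.card * (l' + 1) ^ q) * W) +
        30 * ((l' + 1) ^ X.card * W) := by
      rw [hW]; ring
    rw [e3, e1]
    have e4 := Nat.mul_le_mul_right W hpow
    have e5 := Nat.mul_le_mul_right W e2
    have e6 : W ≤ 2 ^ 2 ^ (6 * Y.card + 7) * W := Nat.le_mul_of_pos_left _ (by positivity)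
    rw [show 62 * 2 ^ 2 ^ (6 * Y.card + 7) * W = 62 * (2 ^ 2 ^ (6 * Y.card + 7) * W) by ring]
    generalize 2 ^ 2 ^ (6 * Y.card + 7) * W = a at *
    generalize (l' + 1) ^ X.card * W = b at *
    generalize (l' + 1) ^ h8.v .hi * W = c at *
    clear_value W P
    omega
  · rw [← hasLabeling_min_iff hslots hsX htX]
    exact hh

end

end MVE

namespace MVE

open WordRAM

/-! ## The word RAM program -/

/-- Lower the memory cell `j` to the value of the memory cell `i`, if it is larger. -/
def clip (i j : ℕ) : Prog :=
  .cond (.op .lt (.load (.const i)) (.load (.const j))) (.store (.const j) (.load (.const i))) .nop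

theorem exec_clip {B i j : ℕ} {σ : State} (hi : i ≤ B) (hj : j ≤ B) (hB : 1 ≤ B)
    (hmi : σ.mem i ≤ B) (hmj : σ.mem j ≤ B) :
    ∃ T ≤ 10, Exec B (clip i j) σ T
      ⟨σ.reg, Function.update σ.mem j (min (σ.mem j) (σ.mem i))⟩ := by
  have hf : (Term.op .lt (.load (.const i)) (.load (.const j))).Fits B σ := by
    refine ⟨⟨hi, hmi⟩, ⟨hj, hmj⟩, ?_⟩
    simp only [Op.eval]
    split <;> omega
  by_cases h : σ.mem i < σ.mem j
  · have hx := Exec.cond_true (q := .nop) hf (by simp [Term.eval, Op.eval, h])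
      (.store σ (.const j) (.load (.const i)) hj ⟨hi, hmi⟩)
    rw [min_eq_right h.le]
    exact ⟨_, by simp [Term.cost], hx⟩
  · have hx := Exec.cond_false (p := .store (.const j) (.load (.const i))) hf
      (by simp [Term.eval, Op.eval, h]) (.nop σ)
    rw [min_eq_left (not_lt.1 h), Function.update_eq_self]
    exact ⟨_, by simp [Term.cost], hx⟩

/-- Clip the input numbers `k` and `ℓ`, and write the base address of the arrays to register `0`. -/
def prologue : Prog :=
  .seq (clip 1 4) (.seq (clip 0 5)
    (.assign 0 (.op .add (.const 6) (.op .mul (.const 2) (.load (.const 1))))))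

/-- The program that decides the problem. -/
def program : Prog :=
  .seq prologue (.seq Cmd.main.compile (.assign 0 (.reg Var.ans.idx)))

section

variable {n : ℕ} {L : List (Fin n × Fin n)} {s t : Fin n}

/-- Clipping in place yields the memory of the clipped instance, so the main program can be analysed
as if started on that instance. -/
theorem update_mem_initState (k l k' l' : ℕ) :
    Function.update (Function.update (initState (encodeInstance n L s t k l)).mem 4 k') 5 l' =
      (initState (encodeInstance n L s t k' l')).mem := by
  funext i
  rcases i with _ | _ | _ | _ | _ | _ | i <;>
    simp [initState, encodeInstance]

/-- Only this part handles the possibly huge `k` and `l`, which the capacity admits merely as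
summands; afterwards all contents are polynomial in `n + m`. -/
theorem exec_prologue {B k l : ℕ} (hB : 6 + 2 * L.length ≤ B) (hn : n ≤ B) (hk : k ≤ B)
    (hl : l ≤ B) :
    ∃ T ≤ 30, Exec B prologue (initState (encodeInstance n L s t k l)) T
      ⟨Function.update (fun _ => 0) 0 (6 + 2 * L.length),
        (initState (encodeInstance n L s t (min k L.length) (min l n))).mem⟩ := by
  obtain ⟨T1, hT1, h1⟩ := exec_clip (B := B) (i := 1) (j := 4)
    (σ := initState (encodeInstance n L s t k l)) (by omega) (by omega) (by omega)
    (by simp [initState, encodeInstance]; omega) (by simpa [initState, encodeInstance])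
  obtain ⟨T2, hT2, h2⟩ := exec_clip (B := B) (i := 0) (j := 5)
    (σ := ⟨(initState (encodeInstance n L s t k l)).reg,
      Function.update (initState (encodeInstance n L s t k l)).mem 4 (min k L.length)⟩)
    (by omega) (by omega) (by omega)
    (by simpa [initState, encodeInstance]) (by simpa [initState, encodeInstance])
  have e5 : Function.update (initState (encodeInstance n L s t k l)).mem 4
      (min k L.length) 5 = l := by
    simp [initState, encodeInstance]
  have e0 : Function.update (initState (encodeInstance n L s t k l)).mem 4
      (min k L.length) 0 = n := by
    simp [initState, encodeInstance]
  simp only [e5, e0, update_mem_initState] at h2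
  have h3 := Exec.assign (B := B) ⟨(initState (encodeInstance n L s t k l)).reg,
      (initState (encodeInstance n L s t (min k L.length) (min l n))).mem⟩ 0
    (.op .add (.const 6) (.op .mul (.const 2) (.load (.const 1)))) (by
      simp [Term.Fits, Term.eval, Op.eval, initState, encodeInstance]
      omega)
  refine ⟨_, ?_, .seq h1 (.seq h2 h3)⟩
  simp [Term.cost]
  omega

/-- The bound for the numbers in the run after the prologue. -/
theorem pow_bound {N : ℕ} (hN : 1 ≤ N) (c : ℕ) : ((N + 4) ^ 2) ^ c ≤ (N + 1) ^ (6 * c) := by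
  rw [pow_mul]
  refine Nat.pow_le_pow_left ?_ c
  rw [show 6 = 3 * 2 by rfl, pow_mul]
  refine Nat.pow_le_pow_left ?_ 2
  nlinarith [Nat.zero_le (N ^ 3)]

theorem time_bound {N P y : ℕ} (hN : 1 ≤ N) (hP : P = 1000) :
    40 + (N + 2) * P * (100 * 2 ^ 2 ^ (6 * y + 7) + 30 * y + 200) ≤
      2 ^ 2 ^ (6 * P * (y + 1)) * N := by
  have h1 : y < 2 ^ 2 ^ (6 * y + 7) :=
    calc y < 2 ^ y := Nat.lt_two_pow_self
      _ ≤ 2 ^ (6 * y + 7) := Nat.pow_le_pow_right (by omega) (by omega)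
      _ ≤ 2 ^ 2 ^ (6 * y + 7) := Nat.lt_two_pow_self.le
  -- The factor `2 ^ 20` absorbs the constants `40 + 3000 * 330`; it costs little in the exponent,
  -- since `20 ≤ 2 ^ (6 * y + 7)`.
  have h2 : 2 ^ 20 * 2 ^ 2 ^ (6 * y + 7) ≤ 2 ^ 2 ^ (6 * P * (y + 1)) := by
    rw [← pow_add]
    refine Nat.pow_le_pow_right (by omega) ?_
    have h3 : 2 ^ 7 ≤ 2 ^ (6 * y + 7) := Nat.pow_le_pow_right (by omega) (by omega)
    calc 20 + 2 ^ (6 * y + 7) ≤ 2 ^ (6 * y + 8) := by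
          rw [pow_succ 2 (6 * y + 7)]; omega
      _ ≤ _ := Nat.pow_le_pow_right (by omega) (by subst hP; omega)
  refine le_trans ?_ (Nat.mul_le_mul_right N h2)
  generalize 2 ^ 2 ^ (6 * y + 7) = A at *
  have h4 : 100 * A + 30 * y + 200 ≤ 330 * A := by omega
  have h5 : (N + 2) * P ≤ 3000 * N := by subst hP; omega
  calc _ ≤ 40 + 3000 * N * (330 * A) := Nat.add_le_add_left (Nat.mul_le_mul h5 h4) _
    _ = 40 + 990000 * (A * N) := by ring
    _ ≤ 2 ^ 20 * (A * N) := by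
        have : 1 ≤ A * N := Nat.mul_pos (by omega) hN
        omega
    _ = _ := by ring

theorem mem_encode_le {k l M : ℕ} (hn : n ≤ M) (hm : L.length ≤ M) (hk : k ≤ M) (hl : l ≤ M)
    (i : ℕ) : (encodeInstance n L s t k l).getD i 0 ≤ M := by
  rcases lt_or_ge i (encodeInstance n L s t k l).length with h | h
  · rw [List.getD_eq_getElem _ _ h]
    have hs := s.2
    have ht := t.2
    have hmem := List.getElem_mem h
    generalize (encodeInstance n L s t k l)[i] = a at *
    simp only [encodeInstance, List.cons_append, List.nil_append, List.mem_cons,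
      List.mem_flatMap, List.not_mem_nil, or_false] at hmem
    rcases hmem with h | h | h | h | h | h | ⟨e, -, h | h⟩
    all_goals omega
  · rw [List.getD_eq_default _ _ h]
    exact Nat.zero_le _

/-- The machine that runs the program after the prologue. -/
def machine (n : ℕ) (L : List (Fin n × Fin n)) (s t : Fin n) (k l : ℕ) : Machine where
  B := (n + L.length + 1) ^ (6 * pieceSize) + k + l
  M := (n + L.length + 4) ^ 2
  D := 6 + 2 * L.length
  inp := (initState (encodeInstance n L s t (min k L.length) (min l n))).mem
  hM := le_trans (by decide) (Nat.pow_le_pow_left (Nat.le_add_left 4 _) 2)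
  hB := by
    have := s.pos
    have := pow_bound (N := n + L.length) (by omega) pieceSize
    omega

theorem le_machine_M {k l : ℕ} : 4 * (n + L.length + 4) ≤ (machine n L s t k l).M := by
  show 4 * (n + L.length + 4) ≤ (n + L.length + 4) ^ 2
  rw [pow_two]
  exact Nat.mul_le_mul_right _ (by omega)

theorem machine_M_le {k l : ℕ} : (machine n L s t k l).M ≤ (machine n L s t k l).B :=
  (Nat.le_self_pow (by decide) _).trans (machine n L s t k l).hB

/-- The arrays begin right behind the input, where the memory is zero, so all of them are zero at
the start. -/
theorem sim_machine {k l : ℕ} :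
    Sim (machine n L s t k l) ⟨Function.update (fun _ => 0) 0 (6 + 2 * L.length),
        (initState (encodeInstance n L s t (min k L.length) (min l n))).mem⟩
      ⟨fun _ => 0, fun _ _ => 0⟩ := by
  have hM := le_machine_M (n := n) (L := L) (s := s) (t := t) (k := k) (l := l)
  refine ⟨fun i => ?_, mem_encode_le (by omega) (by omega) (by omega) (by omega), by simp [machine],
    fun x => ?_, fun r i => ?_, fun _ _ => rfl⟩
  · simp only [Function.update_apply]
    split <;> omega
  · simp [(Var.idx_pos x).ne']
  · refine List.getD_eq_default _ _ ?_
    rw [length_encode]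
    simp only [machine]
    omega

end

end MVE

open MVE in
/-- There are one word RAM program `p` and one constant `c` such that, on every instance with
unit-length edges (`n` vertices, `m = L.length` edges, cluster vertex deletion number `x`), `p`
halts after at most `2 ^ 2 ^ (c * (x + 1)) * (n + m)` steps, with the answer (`1` for yes and `0`
for no) in register `0`. Neither `x` nor a cluster vertex deletion set is part of the input. All
numbers in the run are at most `(n + m + 1) ^ c + k + ℓ`. -/
theorem theorem10 :
    ∃ (p : WordRAM.Prog) (c : ℕ),
      ∀ (n : ℕ) (G : SimpleGraph (Fin n)) (L : List (Fin n × Fin n)) (s t : Fin n) (k ℓ : ℕ),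
        IsEdgeList G L →
        ∃ (T : ℕ) (σ : WordRAM.State),
          WordRAM.Exec ((n + L.length + 1) ^ c + k + ℓ) p
              (WordRAM.initState (encodeInstance n L s t k ℓ)) T σ ∧
            T ≤ 2 ^ 2 ^ (c * (clusterVertexDeletionNumber G + 1)) * (n + L.length) ∧
            (UnitSPMVE G s t k ℓ → σ.reg 0 = 1) ∧
            (¬ UnitSPMVE G s t k ℓ → σ.reg 0 = 0) := by
  -- One constant serves both the capacity, by `pow_bound`, and the running time, by `time_bound`.
  refine ⟨program, 6 * pieceSize, fun n G L s t k l hL => ?_⟩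
  obtain ⟨Y, hY, hYc⟩ := exists_isCluster (hL := hL)
  have hn : 0 < n := s.pos
  have hM := le_machine_M (n := n) (L := L) (s := s) (t := t) (k := k) (l := l)
  have hMB := machine_M_le (n := n) (L := L) (s := s) (t := t) (k := k) (l := l)
  have hB : (machine n L s t k l).B = (n + L.length + 1) ^ (6 * pieceSize) + k + l := rfl
  have room : Room (machine n L s t k l) (edgeListOf hL) := by
    refine ⟨hM, ?_⟩
    show n * L.length ≤ (n + L.length + 4) ^ 2
    nlinarith
  obtain ⟨T1, hT1, h1⟩ := exec_prologue (n := n) (L := L) (s := s) (t := t) (k := k) (l := l)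
    (B := (machine n L s t k l).B) (by omega) (by omega) (by omega) (by omega)
  obtain ⟨T2, σ2, h2, hx2, hT2, S2, hyes, hno⟩ := Cmd.main_spec (h := ⟨fun _ => 0, fun _ _ => 0⟩)
    (s := s) (t := t) (k := min k L.length) (l := min l n) room s.2 t.2 (min_le_right _ _)
    (min_le_right _ _) rfl (fun _ _ => rfl) rfl rfl rfl rfl rfl rfl (fun i hi => by
      have hi : i < L.length := hi
      simp only [edgeListOf, hi, dif_pos]
      exact getD_encode L s t (min k L.length) (min l n) i hi) hY _ sim_machine
  -- Clipping does not change the answer: more than `m` deletions are never needed, and a distance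
  -- of at least `n` is infinite.
  have hiff : (edgeListOf hL).HasLabeling s t (min k L.length) (min l n) ↔ UnitSPMVE G s t k l :=
    (hasLabeling_min (edgeListOf hL) s t k (min l n)).trans
      ((unitSPMVE_iff hL s t k (min l n)).symm.trans (unitSPMVE_min s t k l))
  rw [hiff] at hyes hno
  have hans : (WordRAM.Term.reg Var.ans.idx).eval σ2 = h2.v .ans := S2.var .ans
  refine ⟨_, _, .seq h1 (.seq hx2 (.assign σ2 0 (.reg Var.ans.idx) ((S2.reg_le _).trans hMB))),
    ?_, fun h => ?_, fun h => ?_⟩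
  · rw [← hYc]
    refine le_trans ?_ (time_bound (N := n + L.length) (P := pieceSize) (by omega) rfl)
    have hT2 : T2 ≤ (n + L.length + 2) * pieceSize *
      (100 * 2 ^ 2 ^ (6 * Y.card + 7) + 30 * Y.card + 200) := hT2
    simp only [WordRAM.Term.cost]
    omega
  · simp [hans, hyes h]
  · simp [hans, hno h]
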